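/- Fix a critical exponent $\alpha>1$ and put $\theta_\alpha=1+\frac{\log 2}{\log(3\alpha)}$. **Lorenz maps.** A Lorenz map $f:[0,1]\setminus\{c\}\to[0,1]$ with critical point $\operatorname{crit}(f)=c\in(0,1)$ is given by $f=\phi_-\circ q$ on $[0,c)$ and $f=\phi_+\circ q$ on $(c,1]$, where $q(x)=u\bigl(1-(\tfrac{c-x}{c})^\alpha\bigr)$ for $x<c$, $q(x)=1+v\bigl(-1+(\tfrac{x-c}{1-c})^\alpha\bigr)$ for $x>c$, $u,v\in[0,1]$, and the diffeomorphic parts $\phi_\pm$ are increasing $C^3$ diffeomorphisms of $[0,1]$ with Schwarzian derivative $\le 0$; moreover $0$ and $1$ are the only fixed points of $f$. Its critical values are $f_\pm(c)=\lim_{x\to c^\pm}f(x)$. It is nontrivial if $f_+(c)<c<f_-(c)$, and full if $f_-(c)=1$ and $f_+(c)=0$. It is $\varepsilon$-close to standard maps if $\phi_\pm$, $\phi_\pm'$, $\phi_\pm''$ are within $\varepsilon$ of $x$, $1$, $0$ on $[0,1]$. **Renormalization.** For integers $a,b\ge1$, $f$ is $(a,b)$-renormalizable with renormalization $\mathcal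 Rf$ if there is an interval $C=[l,r]\subsetneq[0,1]$ with $l<c<r$ such that the first-return map to $C$ is $f^{a+1}$ on $C\cap[0,c)$ and $f^{b+1}$ on $C\cap(c,1]$, the intermediate iterates of $C\cap[0,c)$ lie to the right of $c$, those of $C\cap(c,1]$ to the left of $c$, both outside the interior of $C$, and this first-return map, affinely rescaled to $[0,1]$, is a nontrivial Lorenz map $\mathcal Rf$ (with the same exponent $\alpha$). **Families.** An analytic family is a family $(F_\lambda)_{\lambda\in U}$ of Lorenz maps over a compact, simply connected, semianalytic set $U\subset\mathbb R^2$, such that $c,u,v$ extend real-analytically in $\lambda$ to a neighbourhood of $U$ and $\phi_\pm(\lambda,x)$ extend real-analytically in $(\lambda,x)$ to a neighbourhood of $U\times[0,1]$; every $F_\lambda$ satisfies $F_{\lambda,+}(c)\le c\le F_{\lambda,-}(c)$, and is nontrivial when $\lambda$ is interior to $U$. A full vertex of type $(a,b)$ is a parameter $\lambda\in U$ for which $F_\lambda$ is $(a,b)$-renormalizable and $\mathcal RF_\lambda$ is full; we write $f_{a,b}=F_\lambda$ for any such $\lambda$. **Statement.** There is $\varepsilon>0$, depending only on $\alpha$,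 such that the following holds for every analytic family all of whose maps are $\varepsilon$-close to standard maps and which contains exactly one full map $\hat f$ (that is, exactly one $\hat\lambda\in U$ with $F_{\hat\lambda}$ full); put $\hat c=\operatorname{crit}(\hat f)$. (A) If $\hat c\ge\frac23$, there are $\theta>\theta_\alpha>1$ and integers $N,n,m$ such that for every $a\ge N$ the integers $\lfloor\theta a\rfloor-n$ and $\lfloor\theta a\rfloor-m$ are at least $1$, and 1. if $b=\lfloor\theta a\rfloor-n$, then $\frac18\le\operatorname{crit}(\mathcal Rf_{a,b})\le\frac13$ for every full vertex of type $(a,b)$; 2. if $b=\lfloor\theta a\rfloor-m$, then $\operatorname{crit}(\mathcal Rf_{a,b})\ge\frac23$ for every full vertex of type $(a,b)$. (B) If $\hat c\le\frac13$, there are $\theta>\theta_\alpha>1$ and integers $N,n,m$ such that for every $b\ge N$ the integers $\lfloor\theta b\rfloor-n$ and $\lfloor\theta b\rfloor-m$ are at least $1$, and 1. if $a=\lfloor\theta b\rfloor-n$, then $\frac23\le\operatorname{crit}(\mathcal Rf_{a,b})\le\frac78$ for every full vertex of type $(a,b)$; 2. if $a=\lfloor\theta b\rfloor-m$, then $\operatorname{crit}(\mathcal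 Rf_{a,b})\le\frac13$ for every full vertex of type $(a,b)$. -/

import Mathlib

open Set Filter Topology

noncomputable section

/-- The data of a Lorenz map on `[0,1]`: critical point `c`, the numbers `u`, `v` that fix the
critical values of the standard part, and the two diffeomorphic parts. -/
structure LorenzData where
  c : ℝ
  u : ℝ
  v : ℝ
  phiL : ℝ → ℝ
  phiR : ℝ → ℝ

/-- The Schwarzian derivative of `φ` on `[0,1]` (one-sided derivatives at the end points). -/
def schwarzian (φ : ℝ → ℝ) (x : ℝ) : ℝ :=
  iteratedDerivWithin 3 φ (Icc 0 1) x / iteratedDerivWithin 1 φ (Icc 0 1) x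
    - 3 / 2 * (iteratedDerivWithin 2 φ (Icc 0 1) x / iteratedDerivWithin 1 φ (Icc 0 1) x) ^ 2

/-- `φ` restricts to an increasing `C^3` diffeomorphism of `[0,1]` without positive Schwarzian
derivative. Equality to zero is allowed, so that the identity qualifies. -/
structure IsDiffeoPart (φ : ℝ → ℝ) : Prop where
  contDiffOn : ContDiffOn ℝ 3 φ (Icc 0 1)
  map_zero : φ 0 = 0
  map_one : φ 1 = 1
  deriv_pos : ∀ x ∈ Icc (0 : ℝ) 1, 0 < iteratedDerivWithin 1 φ (Icc 0 1) x
  schwarzian_nonpos : ∀ x ∈ Icc (0 : ℝ) 1, schwarzian φ x ≤ 0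

/-- The `C^2` distance on `[0,1]` from `φ` to the identity is at most `ε`. -/
def IsC2CloseToId (ε : ℝ) (φ : ℝ → ℝ) : Prop :=
  ∀ x ∈ Icc (0 : ℝ) 1, |φ x - x| ≤ ε ∧ |iteratedDerivWithin 1 φ (Icc 0 1) x - 1| ≤ ε ∧
    |iteratedDerivWithin 2 φ (Icc 0 1) x| ≤ ε

namespace LorenzData

/-- The standard Lorenz map with critical exponent `α`. Its value at `c` itself is irrelevant. -/
def std (α : ℝ) (f : LorenzData) (x : ℝ) : ℝ :=
  if x < f.c then f.u * (1 - ((f.c - x) / f.c) ^ α)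
  else 1 + f.v * (-1 + ((x - f.c) / (1 - f.c)) ^ α)

/-- The Lorenz map on `[0,1] \ {c}`. Its value at `c` itself is irrelevant. -/
def map (α : ℝ) (f : LorenzData) (x : ℝ) : ℝ :=
  if x < f.c then f.phiL (f.std α x) else f.phiR (f.std α x)

/-- The left critical value, the limit of the map at `c` from the left. -/
def critValL (f : LorenzData) : ℝ := f.phiL f.u

/-- The right critical value, the limit of the map at `c` from the right. -/
def critValR (f : LorenzData) : ℝ := f.phiR (1 - f.v)

/-- `f` is a Lorenz map with critical exponent `α`, whose only fixed points are `0` and `1`. -/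
structure IsLorenz (α : ℝ) (f : LorenzData) : Prop where
  c_mem : f.c ∈ Ioo (0 : ℝ) 1
  u_mem : f.u ∈ Icc (0 : ℝ) 1
  v_mem : f.v ∈ Icc (0 : ℝ) 1
  phiL : IsDiffeoPart f.phiL
  phiR : IsDiffeoPart f.phiR
  fixed : ∀ x ∈ Icc (0 : ℝ) 1, x ≠ f.c → f.map α x = x → x = 0 ∨ x = 1

def IsNontrivial (f : LorenzData) : Prop := f.critValR < f.c ∧ f.c < f.critValL

/-- Both branches are onto `[0,1]`. -/
def IsFull (f : LorenzData) : Prop := f.critValL = 1 ∧ f.critValR = 0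

def IsCloseToStandard (ε : ℝ) (f : LorenzData) : Prop :=
  IsC2CloseToId ε f.phiL ∧ IsC2CloseToId ε f.phiR

/-- `f` is `(a,b)`-renormalizable (of monotone type) with renormalization `g`: for a closed
interval `C = [l,r]`, properly contained in `[0,1]` and with `c` in its interior, the first-return
map to `C` is `f^(a+1)` on `C ∩ [0,c)` and `f^(b+1)` on `C ∩ (c,1]`, with the intermediate iterates
to the right and to the left of `c` respectively, and it becomes the nontrivial Lorenz map `g` when
`C` is affinely rescaled to `[0,1]`.  The intermediate iterates avoid the interior of `C`; an end
point of `C` may be hit by them, as happens for `a = b = 1`, where the two end points form a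
single cycle. -/
def IsRenormalization (α : ℝ) (a b : ℕ) (f g : LorenzData) : Prop :=
  1 ≤ a ∧ 1 ≤ b ∧ g.IsLorenz α ∧ g.IsNontrivial ∧
    ∃ l r : ℝ, 0 ≤ l ∧ l < f.c ∧ f.c < r ∧ r ≤ 1 ∧ r - l < 1 ∧
      g.c = (f.c - l) / (r - l) ∧
      (∀ x ∈ Ico l f.c,
        (∀ i : ℕ, 1 ≤ i → i ≤ a → f.c < (f.map α)^[i] x ∧ (f.map α)^[i] x ∉ Ioo l r) ∧
        (f.map α)^[a + 1] x = l + (r - l) * g.map α ((x - l) / (r - l))) ∧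
      (∀ x ∈ Ioc f.c r,
        (∀ i : ℕ, 1 ≤ i → i ≤ b → (f.map α)^[i] x < f.c ∧ (f.map α)^[i] x ∉ Ioo l r) ∧
        (f.map α)^[b + 1] x = l + (r - l) * g.map α ((x - l) / (r - l)))

end LorenzData

/-- A semianalytic subset of the plane: near every point it is a finite union of sets
`{f = 0, g₁ > 0, …, g_k > 0}` with real analytic `f, g₁, …, g_k`. -/
def IsSemianalytic (S : Set (ℝ × ℝ)) : Prop :=
  ∀ p : ℝ × ℝ, ∃ W ∈ 𝓝 p, ∃ (m k : ℕ) (f : Fin m → ℝ × ℝ → ℝ) (g : Fin m → Fin k → ℝ × ℝ → ℝ),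
    (∀ i, AnalyticOnNhd ℝ (f i) W) ∧ (∀ i j, AnalyticOnNhd ℝ (g i j) W) ∧
    ∀ x ∈ W, x ∈ S ↔ ∃ i, f i x = 0 ∧ ∀ j, 0 < g i j x

/-- An analytic family of Lorenz maps with parameter domain `U`.  Only the values of `F` on `U`
are Lorenz maps; those off `U` serve to express that the data extend analytically to a
neighbourhood of `U` (of `U × [0,1]` for the diffeomorphic parts).  Maps with trivial branches
are allowed on the boundary of `U`; all others are nontrivial. -/
structure IsAnalyticFamily (α : ℝ) (U : Set (ℝ × ℝ)) (F : ℝ × ℝ → LorenzData) : Prop where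
  isCompact : IsCompact U
  simplyConnected : SimplyConnectedSpace U
  semianalytic : IsSemianalytic U
  isLorenz : ∀ p ∈ U, (F p).IsLorenz α
  critVal_le : ∀ p ∈ U, (F p).critValR ≤ (F p).c ∧ (F p).c ≤ (F p).critValL
  nontrivial : ∀ p ∈ interior U, (F p).IsNontrivial
  analytic_c : AnalyticOnNhd ℝ (fun p => (F p).c) U
  analytic_u : AnalyticOnNhd ℝ (fun p => (F p).u) U
  analytic_v : AnalyticOnNhd ℝ (fun p => (F p).v) U
  analytic_phiL :
    AnalyticOnNhd ℝ (fun z : (ℝ × ℝ) × ℝ => (F z.1).phiL z.2) (U ×ˢ Icc (0 : ℝ) 1)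
  analytic_phiR :
    AnalyticOnNhd ℝ (fun z : (ℝ × ℝ) × ℝ => (F z.1).phiR z.2) (U ×ˢ Icc (0 : ℝ) 1)

/-- `p` is the unique parameter in `U` whose map is full. -/
def IsUniqueFullParam (U : Set (ℝ × ℝ)) (F : ℝ × ℝ → LorenzData) (p : ℝ × ℝ) : Prop :=
  p ∈ U ∧ (F p).IsFull ∧ ∀ p' ∈ U, (F p').IsFull → p' = p

/-- `p` belongs to the `(a,b)`-archipelago, the set of parameters in `U` whose map is
`(a,b)`-renormalizable, and the renormalization `g` at `p` is full. The full vertex of any full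
island of type `(a,b)` is such a parameter. -/
def IsFullVertex (α : ℝ) (U : Set (ℝ × ℝ)) (F : ℝ × ℝ → LorenzData) (a b : ℕ)
    (p : ℝ × ℝ) (g : LorenzData) : Prop :=
  p ∈ U ∧ (F p).IsRenormalization α a b g ∧ g.IsFull

/-- `θ_α = 1 + log 2 / log (3 α)`. -/
def thetaCrit (α : ℝ) : ℝ := 1 + Real.log 2 / Real.log (3 * α)

end

/-! Write L for the left branch and R for the right branch conjugated by x ↦ 1 - x. Both are
increasing branches fixing 0, with multipliers λ_L and λ_R there. If the map is (a,b)-renormalizable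
on [l, r] with full renormalization, then R^a carries [1 - L(c), 1 - L(l)] onto [1 - r, 1 - l], and
L^b carries [1 - R(1 - c), 1 - R(1 - r)] onto [l, r] (`exists_fullReturn`).

Long orbits of this kind spend most of their time near the repelling point 0. By a distortion
argument (`exists_tendsto_log_iterate_sub`) and the power law at the critical point
(`tendsto_log_branch_self_sub`), r - l is asymptotic to a constant times λ_R^a (c - l)^α, and also
to a constant times λ_L^b (r - c)^α. If x = (c - l)/(r - l) is the critical point of the
renormalization, dividing the two gives that α log(x/(1 - x)) + a log λ_R - b log λ_L converges to
some κ (`exists_tendsto_log_crit`).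

So far the multipliers are those of the vertex p, and they have to be replaced by those of the full
parameter q. For this, a‖p - q‖ and b‖p - q‖ must tend to 0. Vertices converge to q by compactness
(`exists_critVal_gap`, `tendsto_param`), and expansion near 0 makes (1 - u) + (1 - v) exponentially
small in min(a, b). This analytic function vanishes on U only at q, so a Łojasiewicz inequality on
the closed semianalytic set U bounds a power of ‖p - q‖ by it. The inequality is obtained from
Weierstrass division in an algebra of summable power series: on the zero set of one analytic
function, another satisfies a monic equation over series in one variable. It is transferred to U by
minimising on slices.

For a full map with c ≥ 2/3 take θ = log λ_R / log λ_L and b = ⌊θa⌋ - k. Each unit of k shifts α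
log(x/(1 - x)) by log λ_L, asymptotically up to the rounding in the floor. The window [1/8, 1/3] for
x has length α log(7/2) in this scale, which exceeds 2 log λ_L because λ_L is at most about 3α/2;
hence some k hits it for all large a, and another k pushes x beyond 2/3. The bound θ > θ_α comes
from λ_R ≥ 3α(1 - ε) and log(3α)/log(3α/2) > θ_α. The case c ≤ 1/3 is the mirror image. -/

section

/-! ### The Banach algebra of absolutely summable power series -/

/-- The ring of power series over a normed ring whose coefficients are absolutely summable. -/
def SummableSeries (R : Type*) [NormedCommRing R] : Subring (PowerSeries R) where
  carrier := {p | Summable fun n => ‖PowerSeries.coeff n p‖}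
  mul_mem' {p q} hp hq := by
    simpa only [mem_ofPred_eq, PowerSeries.coeff_mul] using
      summable_norm_sum_mul_antidiagonal_of_summable_norm hp hq
  one_mem' := by
    refine summable_of_ne_finset_zero (s := {0}) fun n hn => ?_
    rw [PowerSeries.coeff_one, if_neg (by simpa using hn), norm_zero]
  add_mem' {p q} hp hq := by
    refine Summable.of_nonneg_of_le (fun _ => norm_nonneg _) (fun n => ?_) (hp.add hq)
    rw [map_add]
    exact norm_add_le _ _
  zero_mem' := by simp [summable_zero]
  neg_mem' {p} hp := by simpa only [mem_ofPred_eq, map_neg, norm_neg] using hp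

namespace SummableSeries

variable {R : Type*} [NormedCommRing R]

/-- The coefficients of an absolutely summable power series. -/
noncomputable def coeff (n : ℕ) : SummableSeries R →+ R :=
  (PowerSeries.coeff (R := R) n).toAddMonoidHom.comp (SummableSeries R).subtype.toAddMonoidHom

theorem summable_norm (p : SummableSeries R) : Summable fun n => ‖coeff n p‖ := p.2

/-- The power series with given absolutely summable coefficients. -/
noncomputable def mk (a : ℕ → R) (ha : Summable fun n => ‖a n‖) : SummableSeries R :=
  ⟨PowerSeries.mk a, by
    change Summable _
    simpa only [PowerSeries.coeff_mk] using ha⟩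

@[simp] theorem coeff_mk (a : ℕ → R) (ha : Summable fun n => ‖a n‖) (n : ℕ) :
    coeff n (mk a ha) = a n := PowerSeries.coeff_mk n a

@[ext] theorem ext {p q : SummableSeries R} (h : ∀ n, coeff n p = coeff n q) : p = q :=
  Subtype.ext (PowerSeries.ext h)

theorem coeff_mul (n : ℕ) (p q : SummableSeries R) :
    coeff n (p * q) = ∑ k ∈ Finset.HasAntidiagonal.antidiagonal n, coeff k.1 p * coeff k.2 q :=
  PowerSeries.coeff_mul n _ _

theorem coeff_one (n : ℕ) : coeff n (1 : SummableSeries R) = if n = 0 then 1 else 0 :=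
  PowerSeries.coeff_one n

noncomputable instance : NormedCommRing (SummableSeries R) :=
  { (inferInstance : CommRing (SummableSeries R)),
    (AddGroupNorm.toNormedAddCommGroup
      { toFun := fun p => ∑' n, ‖coeff n p‖
        map_zero' := by simp
        add_le' := fun p q => by
          rw [← (summable_norm p).tsum_add (summable_norm q)]
          refine (summable_norm (p + q)).tsum_le_tsum (fun n => ?_)
            ((summable_norm p).add (summable_norm q))
          rw [map_add]
          exact norm_add_le _ _
        neg' := fun p => by simp
        eq_zero_of_map_eq_zero' := fun p hp => by
          ext n
          have h := (summable_norm p).hasSum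
          rw [hp, hasSum_zero_iff_of_nonneg fun n => norm_nonneg _] at h
          simpa using congrFun h n } : NormedAddCommGroup (SummableSeries R)) with
    norm_mul_le := fun p q => by
      change ∑' n, ‖coeff n (p * q)‖ ≤ (∑' n, ‖coeff n p‖) * ∑' n, ‖coeff n q‖
      have h := summable_norm_sum_mul_antidiagonal_of_summable_norm
        (f := fun n => ‖coeff n p‖) (g := fun n => ‖coeff n q‖)
        (by simpa using summable_norm p) (by simpa using summable_norm q)
      rw [tsum_mul_tsum_eq_tsum_sum_antidiagonal_of_summable_norm
        (by simpa using summable_norm p) (by simpa using summable_norm q)]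
      refine (summable_norm (p * q)).tsum_le_tsum (fun n => ?_) h.of_norm
      rw [coeff_mul]
      exact (norm_sum_le _ _).trans (Finset.sum_le_sum fun k _ => norm_mul_le _ _) }

theorem norm_def (p : SummableSeries R) : ‖p‖ = ∑' n, ‖coeff n p‖ := rfl

instance [NormOneClass R] : NormOneClass (SummableSeries R) where
  norm_one := by
    rw [norm_def, tsum_eq_single 0 fun n hn => by rw [coeff_one, if_neg hn, norm_zero], coeff_one,
      if_pos rfl, norm_one]

/-- The coefficients identify the algebra isometrically with ℓ¹. Completeness is needed for the
fixed point in Weierstrass division, with coefficients that are themselves series. -/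
instance [CompleteSpace R] : CompleteSpace (SummableSeries R) := by
  let Φ : SummableSeries R → lp (fun _ : ℕ => R) 1 := fun p =>
    ⟨fun n => coeff n p, memℓp_gen (by simpa using summable_norm p)⟩
  have hiso : Isometry Φ := by
    refine Isometry.of_dist_eq fun p q => ?_
    rw [dist_eq_norm, dist_eq_norm, lp.norm_eq_tsum_rpow (by simp), norm_def]
    simp only [ENNReal.toReal_one, Real.rpow_one, div_one, map_sub, Φ]
    rfl
  have hsurj : Function.Surjective Φ := fun f => by
    have hf : Summable fun n => ‖f n‖ := by
      simpa using (lp.memℓp f).summable (by simp)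
    exact ⟨mk f hf, Subtype.ext (funext fun n => coeff_mk _ _ n)⟩
  exact (hiso.isUniformInducing.completeSpace_congr hsurj).2 inferInstance

/-- Constant power series. -/
noncomputable def const : R →+* SummableSeries R :=
  (PowerSeries.C (R := R)).codRestrict (SummableSeries R) fun a => by
    refine summable_of_ne_finset_zero (s := {0}) fun n hn => ?_
    rw [PowerSeries.coeff_C, if_neg (by simpa using hn), norm_zero]

theorem coeff_const (n : ℕ) (a : R) : coeff n (const a) = if n = 0 then a else 0 :=
  PowerSeries.coeff_C n a

theorem norm_const (a : R) : ‖(const a : SummableSeries R)‖ = ‖a‖ := by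
  rw [norm_def, tsum_eq_single 0 fun n hn => by rw [coeff_const, if_neg hn, norm_zero],
    coeff_const, if_pos rfl]

/-- The monomial `Y ^ d`. -/
noncomputable def monomial (d : ℕ) : SummableSeries R :=
  ⟨(PowerSeries.X : PowerSeries R) ^ d, by
    refine summable_of_ne_finset_zero (s := {d}) fun n hn => ?_
    rw [PowerSeries.coeff_X_pow, if_neg (by simpa using hn), norm_zero]⟩

theorem coeff_monomial (n d : ℕ) :
    coeff n (monomial d : SummableSeries R) = if n = d then 1 else 0 :=
  PowerSeries.coeff_X_pow n d

theorem coeff_const_mul (n : ℕ) (a : R) (p : SummableSeries R) :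
    coeff n (const a * p) = a * coeff n p :=
  PowerSeries.coeff_C_mul n _ a

theorem coeff_mul_monomial (n d : ℕ) (p : SummableSeries R) :
    coeff (n + d) (p * monomial d) = coeff n p :=
  PowerSeries.coeff_mul_X_pow (p : PowerSeries R) d n

/-- The series obtained by deleting the terms of degree less than `d` and dividing by `Y ^ d`. -/
noncomputable def shift (d : ℕ) : SummableSeries R →+ SummableSeries R where
  toFun p := mk (fun n => coeff (n + d) p) ((summable_nat_add_iff d).2 (summable_norm p))
  map_zero' := by ext; simp
  map_add' p q := by ext; simp

@[simp] theorem coeff_shift (n d : ℕ) (p : SummableSeries R) :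
    coeff n (shift d p) = coeff (n + d) p := by
  unfold shift
  exact coeff_mk (fun n => coeff (n + d) p) ((summable_nat_add_iff d).2 (summable_norm p)) n

theorem norm_shift_le (d : ℕ) (p : SummableSeries R) : ‖shift d p‖ ≤ ‖p‖ := by
  rw [norm_def, norm_def]
  simp only [coeff_shift]
  exact tsum_comp_le_tsum_of_inj (summable_norm p) (fun _ => norm_nonneg _)
    (add_left_injective d)

/-- Weierstrass division by a small perturbation of `Y ^ d`. -/
theorem exists_eq_mul_add_sum [CompleteSpace R] {d : ℕ} {Q : SummableSeries R}
    (hQ : ‖Q - monomial d‖ < 1) (G : SummableSeries R) :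
    ∃ (k : SummableSeries R) (r : ℕ → R),
      G = k * Q + ∑ j ∈ Finset.range d, const (r j) * monomial j := by
  set W := Q - monomial d with hW
  -- Since Q = Y^d + W, comparing the coefficients of degree at least d in G = kQ + remainder says
  -- that k is a fixed point of T. The map T contracts because ‖W‖ < 1.
  let T : SummableSeries R → SummableSeries R := fun k => shift d G - shift d (k * W)
  have hT : ContractingWith ‖W‖₊ T := by
    refine ⟨by exact_mod_cast hQ, LipschitzWith.of_dist_le_mul fun k k' => ?_⟩
    rw [dist_eq_norm, dist_eq_norm]
    have : T k - T k' = shift d ((k' - k) * W) := by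
      simp only [T, sub_mul, map_sub]; abel
    rw [this, coe_nnnorm, mul_comm, norm_sub_rev k k']
    exact (norm_shift_le _ _).trans (norm_mul_le _ _)
  obtain ⟨k, hk⟩ : ∃ k, T k = k := ⟨_, hT.fixedPoint_isFixedPt⟩
  refine ⟨k, fun j => coeff j (G - k * Q), ?_⟩
  rw [← sub_eq_iff_eq_add']
  ext n
  have hsum : coeff n (∑ j ∈ Finset.range d, const (coeff j (G - k * Q)) * monomial j)
      = if n < d then coeff n (G - k * Q) else 0 := by
    rw [map_sum]
    simp only [coeff_const_mul, coeff_monomial, mul_ite, mul_one, mul_zero]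
    rw [Finset.sum_ite_eq]
    simp
  rw [hsum]
  split_ifs with h
  · rfl
  · obtain ⟨m, rfl⟩ := Nat.exists_eq_add_of_le (not_lt.1 h)
    have hQ' : Q = monomial d + W := by rw [hW]; abel
    have := congrArg (coeff m) hk
    simp only [T, map_sub, coeff_shift] at this
    rw [add_comm d m, map_sub, hQ', mul_add, map_add, coeff_mul_monomial]
    linear_combination this

/-- Every series satisfies a monic equation modulo a small perturbation of `Y ^ d`. -/
theorem exists_monic_eval₂_eq_mul [CompleteSpace R] {d : ℕ} {Q : SummableSeries R}
    (hQ : ‖Q - monomial d‖ < 1) (h : SummableSeries R) :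
    ∃ χ : Polynomial R, χ.Monic ∧ ∃ k, χ.eval₂ const h = k * Q := by
  let I : Ideal (SummableSeries R) := Ideal.span {Q}
  let f : R →+* SummableSeries R ⧸ I := (Ideal.Quotient.mk I).comp const
  -- Division by Q makes the quotient a finite module over the constants, spanned by the monomials
  -- of degree below d, so every class in it is integral.
  have hfin : f.Finite := by
    classical
    let := f.toAlgebra
    refine ⟨⟨(Finset.range d).image fun j => Ideal.Quotient.mk I (monomial j), ?_⟩⟩
    rw [eq_top_iff]
    rintro x -
    obtain ⟨G, rfl⟩ := Ideal.Quotient.mk_surjective x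
    obtain ⟨k, r, hG⟩ := exists_eq_mul_add_sum hQ G
    have hkQ : Ideal.Quotient.mk I (k * Q) = 0 :=
      Ideal.Quotient.eq_zero_iff_mem.2 (Ideal.mul_mem_left _ _ (Ideal.mem_span_singleton_self Q))
    rw [hG, map_add, hkQ, zero_add, map_sum]
    refine Submodule.sum_mem _ fun j hj => ?_
    rw [map_mul]
    exact Submodule.smul_mem _ (r j) (Submodule.subset_span (by
      simp only [Finset.coe_image, mem_image]
      exact ⟨j, by simpa using hj, rfl⟩))
  obtain ⟨χ, hχ, h0⟩ := hfin.to_isIntegral (Ideal.Quotient.mk I h)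
  refine ⟨χ, hχ, ?_⟩
  have : Ideal.Quotient.mk I (χ.eval₂ const h) = 0 := by
    rw [Polynomial.hom_eval₂]; exact h0
  rw [Ideal.Quotient.eq_zero_iff_mem, Ideal.mem_span_singleton'] at this
  obtain ⟨k, hk⟩ := this
  exact ⟨k, hk.symm⟩

section eval

variable [NormOneClass R]

theorem summable_norm_coeff_mul_pow (p : SummableSeries R) {x : R} (hx : ‖x‖ ≤ 1) :
    Summable fun n => ‖coeff n p * x ^ n‖ := by
  refine Summable.of_nonneg_of_le (fun _ => norm_nonneg _) (fun n => ?_) (summable_norm p)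
  refine (norm_mul_le _ _).trans (mul_le_of_le_one_right (norm_nonneg _) ?_)
  exact (norm_pow_le _ _).trans (pow_le_one₀ (norm_nonneg _) hx)

variable [CompleteSpace R]

/-- Evaluation of an absolutely summable power series at a point of the unit ball. -/
noncomputable def eval (x : R) (hx : ‖x‖ ≤ 1) : SummableSeries R →+* R where
  toFun p := ∑' n, coeff n p * x ^ n
  map_zero' := by simp
  map_one' := by
    rw [tsum_eq_single 0 fun n hn => by rw [coeff_one, if_neg hn, zero_mul]]
    simp [coeff_one]
  map_add' p q := by
    rw [← (summable_norm_coeff_mul_pow p hx).of_norm.tsum_add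
      (summable_norm_coeff_mul_pow q hx).of_norm]
    simp only [map_add, add_mul]
  map_mul' p q := by
    rw [tsum_mul_tsum_eq_tsum_sum_antidiagonal_of_summable_norm
      (summable_norm_coeff_mul_pow p hx) (summable_norm_coeff_mul_pow q hx)]
    refine tsum_congr fun n => ?_
    rw [coeff_mul, Finset.sum_mul]
    refine Finset.sum_congr rfl fun k hk => ?_
    rw [← Finset.HasAntidiagonal.mem_antidiagonal.1 hk, pow_add]
    ring

theorem eval_apply (x : R) (hx : ‖x‖ ≤ 1) (p : SummableSeries R) :
    eval x hx p = ∑' n, coeff n p * x ^ n := rfl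

theorem eval_const (x : R) (hx : ‖x‖ ≤ 1) (a : R) : eval x hx (const a) = a := by
  rw [eval_apply, tsum_eq_single 0 fun n hn => by rw [coeff_const, if_neg hn, zero_mul]]
  simp [coeff_const]

theorem norm_eval_le (x : R) (hx : ‖x‖ ≤ 1) (p : SummableSeries R) : ‖eval x hx p‖ ≤ ‖p‖ := by
  refine (norm_tsum_le_tsum_norm (summable_norm_coeff_mul_pow p hx)).trans
    ((summable_norm_coeff_mul_pow p hx).tsum_le_tsum (fun n => ?_) (summable_norm p))
  refine (norm_mul_le _ _).trans (mul_le_of_le_one_right (norm_nonneg _) ?_)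
  exact (norm_pow_le _ _).trans (pow_le_one₀ (norm_nonneg _) hx)

theorem eval_mul_monomial (x : R) (hx : ‖x‖ ≤ 1) (d : ℕ) :
    eval x hx (monomial d) = x ^ d := by
  rw [eval_apply, tsum_eq_single d fun n hn => by rw [coeff_monomial, if_neg hn, zero_mul]]
  simp [coeff_monomial]

end eval

/-- A nonzero real series of order `m` is bounded below by a multiple of `|x| ^ m` near `0`. -/
theorem exists_le_abs_eval {p : SummableSeries ℝ} (hp : p ≠ 0) :
    ∃ (m : ℕ) (c δ : ℝ), 0 < c ∧ 0 < δ ∧ ∀ (x : ℝ) (hx : ‖x‖ ≤ 1), |x| ≤ δ →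
      c * |x| ^ m ≤ |eval x hx p| := by
  classical
  have hex : ∃ n, coeff n p ≠ 0 := by
    by_contra! h
    exact hp (ext h)
  set m := Nat.find hex
  have hm : coeff m p ≠ 0 := Nat.find_spec hex
  have hlt : ∀ n < m, coeff n p = 0 := fun n hn => not_not.1 (Nat.find_min hex hn)
  have hdec : p = const (coeff m p) * monomial m + shift (m + 1) p * monomial (m + 1) := by
    ext n
    rw [map_add, coeff_const_mul, coeff_monomial]
    rcases lt_or_ge n (m + 1) with h | h
    · have h0 : coeff n (shift (m + 1) p * monomial (m + 1)) = 0 := by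
        rw [coeff_mul]
        refine Finset.sum_eq_zero fun k hk => ?_
        rw [coeff_monomial, if_neg, mul_zero]
        have := Finset.HasAntidiagonal.mem_antidiagonal.1 hk
        omega
      rw [h0, add_zero]
      split_ifs with h'
      · rw [h', mul_one]
      · rw [mul_zero, hlt n (by omega)]
    · obtain ⟨k, rfl⟩ := Nat.exists_eq_add_of_le' h
      rw [coeff_mul_monomial, coeff_shift, if_neg (by omega), mul_zero, zero_add]
  set q := shift (m + 1) p
  have hc : 0 < |coeff m p| := abs_pos.2 hm
  -- The bound on |x| keeps the tail below half the leading coefficient; the `+ 1` covers q = 0.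
  refine ⟨m, |coeff m p| / 2, |coeff m p| / (2 * (‖q‖ + 1)), by positivity, by positivity,
    fun x hx hxδ => ?_⟩
  have hev : eval x hx p = x ^ m * (coeff m p + eval x hx q * x) := by
    conv_lhs => rw [hdec]
    rw [map_add, map_mul, map_mul, eval_const, eval_mul_monomial, eval_mul_monomial]
    ring
  have hq : |eval x hx q * x| ≤ |coeff m p| / 2 := by
    rw [abs_mul]
    have h1 : |eval x hx q| ≤ ‖q‖ + 1 := (norm_eval_le x hx q).trans (by linarith)
    calc _ ≤ (‖q‖ + 1) * (|coeff m p| / (2 * (‖q‖ + 1))) :=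
          mul_le_mul h1 hxδ (abs_nonneg _) (by positivity)
      _ = _ := by field_simp
  rw [hev, abs_mul, abs_pow, mul_comm]
  refine mul_le_mul_of_nonneg_left ?_ (by positivity)
  have := abs_sub_abs_le_abs_sub (coeff m p) (-(eval x hx q * x))
  rw [abs_neg, sub_neg_eq_add] at this
  linarith

end SummableSeries

end

section

/-! ### Real analytic functions of two variables as double power series -/

/-- Expand the n-th term at (x, 0) + (0, y) by multilinearity and collect equal powers. The number
of summands is 2^n, which is absorbed by halving the radius. -/
theorem AnalyticAt.exists_hasSum_double_series {f : ℝ × ℝ → ℝ} (hf : AnalyticAt ℝ f 0) :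
    ∃ (a : ℕ × ℕ → ℝ) (ρ : ℝ), 0 < ρ ∧ (Summable fun z : ℕ × ℕ => |a z| * ρ ^ (z.1 + z.2)) ∧
      ∀ x y : ℝ, |x| ≤ ρ → |y| ≤ ρ → HasSum (fun z : ℕ × ℕ => a z * x ^ z.1 * y ^ z.2) (f (x, y)) := by
  classical
  obtain ⟨p, r, hp⟩ := hf
  obtain ⟨s, hs0, hsr⟩ := ENNReal.lt_iff_exists_nnreal_btwn.1 hp.r_pos
  have hs0' : 0 < (s : ℝ) := by exact_mod_cast hs0
  have hsum : Summable fun n => ‖p n‖ * (s : ℝ) ^ n :=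
    p.summable_norm_mul_pow (hsr.trans_le hp.r_le)
  let e (n : ℕ) (S : Finset (Fin n)) : Fin n → ℝ × ℝ :=
    S.piecewise (fun _ => ((1 : ℝ), (0 : ℝ))) (fun _ => ((0 : ℝ), (1 : ℝ)))
  let A (n i : ℕ) : ℝ := ∑ S ∈ Finset.powersetCard i (Finset.univ : Finset (Fin n)), p n (e n S)
  have he : ∀ n S, ‖p n (e n S)‖ ≤ ‖p n‖ := fun n S => by
    refine ((p n).le_opNorm _).trans (mul_le_of_le_one_right (norm_nonneg _) ?_)
    refine Finset.prod_le_one (fun _ _ => norm_nonneg _) fun i _ => ?_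
    by_cases hi : i ∈ S <;> simp [e, hi, Prod.norm_def]
  have hA : ∀ n i, |A n i| ≤ n.choose i * ‖p n‖ := fun n i => by
    refine (Finset.abs_sum_le_sum_abs _ _).trans ((Finset.sum_le_sum fun S _ => he n S).trans ?_)
    simp
  have hexp : ∀ n (x y : ℝ), p n (fun _ => (x, y)) =
      ∑ z ∈ Finset.HasAntidiagonal.antidiagonal n, A n z.1 * x ^ z.1 * y ^ z.2 := fun n x y => by
    have h1 : (fun _ : Fin n => (x, y)) = (fun _ => (x, (0 : ℝ))) + fun _ => ((0 : ℝ), y) := by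
      ext <;> simp
    rw [h1, ContinuousMultilinearMap.map_add_univ, ← Finset.powerset_univ, Finset.sum_powerset,
      Finset.Nat.sum_antidiagonal_eq_sum_range_succ_mk]
    simp only [Finset.card_univ, Fintype.card_fin]
    refine Finset.sum_congr rfl fun i _ => ?_
    rw [Finset.sum_mul, Finset.sum_mul]
    refine Finset.sum_congr rfl fun S hS => ?_
    have hcard : S.card = i := (Finset.mem_powersetCard.1 hS).2
    have h2 : S.piecewise (fun _ => (x, (0 : ℝ))) (fun _ => ((0 : ℝ), y)) =
        fun k => (if k ∈ S then x else y) • e n S k := by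
      funext k
      by_cases hk : k ∈ S <;> simp [e, hk]
    rw [h2, ContinuousMultilinearMap.map_smul_univ, Finset.prod_ite, smul_eq_mul]
    simp only [Finset.prod_const]
    have h3 : (Finset.univ.filter fun k => k ∈ S).card = i := by
      rw [Finset.filter_univ_mem, hcard]
    have h4 : (Finset.univ.filter fun k => k ∉ S).card = n - i := by
      rw [Finset.filter_not, Finset.filter_univ_mem, Finset.card_sdiff_of_subset (by simp), hcard]
      simp
    rw [h3, h4]
    ring
  set ρ : ℝ := s / 2 with hρ
  have hρ0 : 0 < ρ := by positivity
  have hsumA : Summable fun z : ℕ × ℕ => |A (z.1 + z.2) z.1| * ρ ^ (z.1 + z.2) := by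
    rw [← Finset.HasAntidiagonal.sigmaAntidiagonalEquivProd.summable_iff,
      summable_sigma_of_nonneg fun z => by dsimp; positivity]
    refine ⟨fun n => (hasSum_fintype _).summable, ?_⟩
    refine Summable.of_nonneg_of_le (fun n => tsum_nonneg fun z => by dsimp; positivity)
      (fun n => ?_) hsum
    rw [tsum_fintype]
    calc ∑ z : Finset.HasAntidiagonal.antidiagonal n, _
        ≤ ∑ z : Finset.HasAntidiagonal.antidiagonal n,
            (n.choose z.1.1 : ℝ) * (‖p n‖ * ρ ^ n) := by
          refine Finset.sum_le_sum fun z _ => ?_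
          have hz := Finset.HasAntidiagonal.mem_antidiagonal.1 z.2
          simp only [Function.comp, Finset.HasAntidiagonal.sigmaAntidiagonalEquivProd_apply, hz]
          rw [← mul_assoc]
          exact mul_le_mul_of_nonneg_right (hA n _) (by positivity)
      _ = ∑ z ∈ Finset.HasAntidiagonal.antidiagonal n, (n.choose z.1 : ℝ) * (‖p n‖ * ρ ^ n) :=
          Finset.sum_coe_sort (Finset.HasAntidiagonal.antidiagonal n)
            fun z => (n.choose z.1 : ℝ) * (‖p n‖ * ρ ^ n)
      _ = 2 ^ n * (‖p n‖ * ρ ^ n) := by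
          rw [← Finset.sum_mul, Finset.Nat.sum_antidiagonal_eq_sum_range_succ_mk]
          congr 1
          exact_mod_cast Nat.sum_range_choose n
      _ = ‖p n‖ * (s : ℝ) ^ n := by
          rw [hρ, div_pow]; field_simp
  refine ⟨fun z => A (z.1 + z.2) z.1, ρ, hρ0, hsumA, fun x y hx hy => ?_⟩
  have hmem : (x, y) ∈ Metric.eball (0 : ℝ × ℝ) r := by
    rw [Metric.mem_eball, edist_zero_right]
    refine lt_of_le_of_lt ?_ hsr
    rw [← ofReal_norm, ← ENNReal.ofReal_coe_nnreal]
    refine ENNReal.ofReal_le_ofReal ?_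
    rw [Prod.norm_def]
    exact max_le (hx.trans (by rw [hρ]; linarith)) (hy.trans (by rw [hρ]; linarith))
  have hS := hp.hasSum hmem
  rw [zero_add] at hS
  rw [← Finset.HasAntidiagonal.sigmaAntidiagonalEquivProd.hasSum_iff]
  refine HasSum.sigma_of_hasSum hS (fun n => ?_) ?_
  · rw [hexp n x y, ← Finset.sum_coe_sort]
    convert hasSum_fintype _ using 2 with z
    have hz := Finset.HasAntidiagonal.mem_antidiagonal.1 z.2
    simp only [Function.comp, Finset.HasAntidiagonal.sigmaAntidiagonalEquivProd_apply, hz]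
  · refine (Finset.HasAntidiagonal.sigmaAntidiagonalEquivProd.summable_iff (f := fun z : ℕ × ℕ =>
      A (z.1 + z.2) z.1 * x ^ z.1 * y ^ z.2)).2 ?_
    refine Summable.of_norm (Summable.of_nonneg_of_le (fun _ => norm_nonneg _) (fun z => ?_) hsumA)
    rw [norm_mul, norm_mul, norm_pow, norm_pow, Real.norm_eq_abs, Real.norm_eq_abs,
      Real.norm_eq_abs, pow_add, mul_assoc]
    gcongr

namespace SummableSeries

/-- The element of the iterated algebra with prescribed coefficients. -/
noncomputable def ofDouble (b : ℕ × ℕ → ℝ) (hb : Summable fun z => |b z|) :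
    SummableSeries (SummableSeries ℝ) :=
  have h := (summable_prod_of_nonneg (f := fun z : ℕ × ℕ => |b z.swap|) fun z => abs_nonneg _).1
    ((Equiv.prodComm ℕ ℕ).summable_iff.2 hb)
  -- The outer variable is y: division takes place in y, over series in x.
  mk (fun j => mk (fun i => b (i, j)) (h.1 j)) (by
    simp only [norm_def, coeff_mk]
    exact h.2)

theorem coeff_coeff_ofDouble (b : ℕ × ℕ → ℝ) (hb : Summable fun z => |b z|) (i j : ℕ) :
    coeff i (coeff j (ofDouble b hb)) = b (i, j) := by
  rw [ofDouble, coeff_mk, coeff_mk]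

theorem norm_ofDouble (b : ℕ × ℕ → ℝ) (hb : Summable fun z => |b z|) :
    ‖ofDouble b hb‖ = ∑' z, |b z| := by
  rw [← (Equiv.prodComm ℕ ℕ).tsum_eq fun z => |b z|]
  refine Eq.trans ?_ (Summable.tsum_prod ((Equiv.prodComm ℕ ℕ).summable_iff.2 hb)).symm
  simp only [norm_def, coeff_coeff_ofDouble]
  rfl

/-- Evaluation of a double power series at a point of the unit square. -/
noncomputable def evalTwo (x y : ℝ) (hx : ‖x‖ ≤ 1) (hy : ‖y‖ ≤ 1) :
    SummableSeries (SummableSeries ℝ) →+* ℝ :=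
  (eval x hx).comp (eval (const y) ((norm_const y).trans_le hy))

theorem evalTwo_const (x y : ℝ) (hx : ‖x‖ ≤ 1) (hy : ‖y‖ ≤ 1) (p : SummableSeries ℝ) :
    evalTwo x y hx hy (const p) = eval x hx p := by
  rw [evalTwo, RingHom.comp_apply, eval_const]

theorem evalTwo_ofDouble (x y : ℝ) (hx : ‖x‖ ≤ 1) (hy : ‖y‖ ≤ 1) (b : ℕ × ℕ → ℝ)
    (hb : Summable fun z => |b z|) :
    evalTwo x y hx hy (ofDouble b hb) = ∑' z : ℕ × ℕ, b z * x ^ z.1 * y ^ z.2 := by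
  have hcont : Continuous (eval x hx) :=
    AddMonoidHomClass.continuous_of_bound (eval x hx) 1 fun p => by
      simpa using norm_eval_le x hx p
  have hsum := (summable_norm_coeff_mul_pow (ofDouble b hb) (x := const y)
    ((norm_const y).trans_le hy)).of_norm
  rw [evalTwo, RingHom.comp_apply, eval_apply (const y), hsum.map_tsum (eval x hx) hcont]
  have hsum2 : Summable fun z : ℕ × ℕ => b z.swap * x ^ z.2 * y ^ z.1 := by
    refine Summable.of_norm (Summable.of_nonneg_of_le (fun _ => norm_nonneg _) (fun z => ?_)
      ((Equiv.prodComm ℕ ℕ).summable_iff.2 hb))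
    rw [norm_mul, norm_mul, norm_pow, norm_pow, mul_assoc]
    exact mul_le_of_le_one_right (norm_nonneg _)
      (mul_le_one₀ (pow_le_one₀ (norm_nonneg _) hx) (by positivity)
        (pow_le_one₀ (norm_nonneg _) hy))
  rw [← (Equiv.prodComm ℕ ℕ).tsum_eq fun z : ℕ × ℕ => b z * x ^ z.1 * y ^ z.2]
  refine Eq.trans ?_ (Summable.tsum_prod hsum2).symm
  refine tsum_congr fun j => ?_
  rw [map_mul, map_pow, eval_const, eval_apply, ← tsum_mul_right]
  simp only [coeff_coeff_ofDouble, Prod.swap_prod_mk]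

end SummableSeries

open SummableSeries in
/-- On the zero set of an analytic function that does not vanish identically on the axis `x = 0`,
another analytic function `h` either vanishes or is bounded below by a multiple of a power
of `|x|`. -/
theorem AnalyticAt.exists_eventually_eq_zero_or_le_abs {Q h : ℝ × ℝ → ℝ} (hQ : AnalyticAt ℝ Q 0)
    (hh : AnalyticAt ℝ h 0) (hreg : ¬ ∀ᶠ y in 𝓝 (0 : ℝ), Q (0, y) = 0) :
    ∃ (M : ℕ) (c : ℝ), 0 < c ∧
      ∀ᶠ z in 𝓝 (0 : ℝ × ℝ), Q z = 0 → h z = 0 ∨ c * |z.1| ^ M ≤ |h z| := by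
  classical
  obtain ⟨a, ρ₁, hρ₁, ha, haQ⟩ := hQ.exists_hasSum_double_series
  obtain ⟨b, ρ₂, hρ₂, hb, hbh⟩ := hh.exists_hasSum_double_series
  obtain ⟨ρ₀, hρ₀, h01, h02⟩ : ∃ ρ₀ : ℝ, 0 < ρ₀ ∧ ρ₀ ≤ ρ₁ ∧ ρ₀ ≤ ρ₂ :=
    ⟨min ρ₁ ρ₂, lt_min hρ₁ hρ₂, min_le_left _ _, min_le_right _ _⟩
  replace ha : Summable fun z : ℕ × ℕ => |a z| * ρ₀ ^ (z.1 + z.2) :=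
    Summable.of_nonneg_of_le (fun _ => by positivity) (fun z => by gcongr) ha
  replace hb : Summable fun z : ℕ × ℕ => |b z| * ρ₀ ^ (z.1 + z.2) :=
    Summable.of_nonneg_of_le (fun _ => by positivity) (fun z => by gcongr) hb
  have hex : ∃ j, a (0, j) ≠ 0 := by
    by_contra! hzero
    refine hreg (Metric.eventually_nhds_iff.2 ⟨ρ₁, hρ₁, fun y hy => ?_⟩)
    have h1 := haQ 0 y (by simpa using hρ₁.le) (by simpa [Real.dist_eq] using hy.le)
    refine h1.unique ?_
    convert hasSum_zero with z
    obtain ⟨i, j⟩ := z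
    rcases Nat.eq_zero_or_pos i with rfl | hi
    · simp [hzero j]
    · simp [hi.ne']
  set d := Nat.find hex
  have hd : a (0, d) ≠ 0 := Nat.find_spec hex
  have hlt : ∀ j < d, a (0, j) = 0 := fun j hj => not_not.1 (Nat.find_min hex hj)
  set S := ∑' z : ℕ × ℕ, |a z| * ρ₀ ^ (z.1 + z.2) with hS
  have had : 0 < |a (0, d)| := abs_pos.2 hd
  have hleS : |a (0, d)| * ρ₀ ^ d ≤ S := by
    simpa using ha.le_tsum (0, d) fun _ _ => by positivity
  have hSpos : 0 < S := lt_of_lt_of_le (by positivity) hleS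
  set t : ℝ := |a (0, d)| * ρ₀ ^ d / (2 * S) with ht
  have ht0 : 0 < t := by positivity
  have ht1 : t ≤ 1 := by rw [ht, div_le_one (by positivity)]; linarith
  set w : ℝ := t ^ (d + 1) with hw
  have hw0 : 0 < w := by positivity
  have hw1 : w ≤ 1 := pow_le_one₀ ht0.le ht1
  set σ := t * ρ₀ with hσ
  set ρ := w * ρ₀ with hρ
  have hσ0 : 0 < σ := by positivity
  have hρ0 : 0 < ρ := by positivity
  have hσle : σ ≤ ρ₀ := mul_le_of_le_one_left hρ₀.le ht1
  have hρle : ρ ≤ ρ₀ := mul_le_of_le_one_left hρ₀.le hw1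
  have hscale : ∀ i j : ℕ, ρ ^ i * σ ^ j ≤ ρ₀ ^ (i + j) := fun i j => by
    rw [pow_add]; gcongr
  set q : ℝ := a (0, d) * σ ^ d with hq
  have hq0 : 0 < |q| := by rw [hq, abs_mul, abs_of_pos (pow_pos hσ0 d)]; positivity
  have hqne : q ≠ 0 := abs_pos.1 hq0
  have hwS : w * S = |q| / 2 := by
    rw [hq, abs_mul, abs_of_pos (pow_pos hσ0 d), hσ, hw, mul_pow, pow_succ]
    have : t * S = |a (0, d)| * ρ₀ ^ d / 2 := by rw [ht]; field_simp
    linear_combination t ^ d * this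
  let a' : ℕ × ℕ → ℝ := fun z => a z * (ρ ^ z.1 * σ ^ z.2) / q
  let b' : ℕ × ℕ → ℝ := fun z => b z * (ρ ^ z.1 * σ ^ z.2)
  have ha' : Summable fun z => |a' z| := by
    refine Summable.of_nonneg_of_le (fun _ => abs_nonneg _) (fun z => ?_) (ha.div_const |q|)
    rw [abs_div, abs_mul, abs_of_pos (mul_pos (pow_pos hρ0 _) (pow_pos hσ0 _))]
    gcongr
    exact hscale _ _
  have hb' : Summable fun z => |b' z| := by
    refine Summable.of_nonneg_of_le (fun _ => abs_nonneg _) (fun z => ?_) hb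
    rw [abs_mul, abs_of_pos (mul_pos (pow_pos hρ0 _) (pow_pos hσ0 _))]
    gcongr
    exact hscale _ _
  let e : ℕ × ℕ → ℝ := fun z => if z = (0, d) then 0 else a' z
  have heabs : ∀ z, |e z| ≤ w / |q| * (|a z| * ρ₀ ^ (z.1 + z.2)) := by
    rintro ⟨i, j⟩
    by_cases hz : (i, j) = (0, d)
    · simp only [e, if_pos hz, abs_zero]; positivity
    have hle : |a (i, j)| * (ρ ^ i * σ ^ j) ≤ |a (i, j)| * (w * ρ₀ ^ (i + j)) := by
      rcases Nat.eq_zero_or_pos i with rfl | hi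
      · rcases lt_or_ge j d with hj | hj
        · simp [hlt j hj]
        · have hj' : d + 1 ≤ j := by
            rcases hj.eq_or_lt with rfl | h'
            · exact absurd rfl hz
            · exact h'
          refine mul_le_mul_of_nonneg_left ?_ (abs_nonneg _)
          rw [pow_zero, one_mul, zero_add, hσ, mul_pow]
          gcongr
          exact pow_le_pow_of_le_one ht0.le ht1 hj'
      · refine mul_le_mul_of_nonneg_left ?_ (abs_nonneg _)
        rw [hρ, mul_pow, pow_add ρ₀, mul_assoc]
        gcongr
        exact pow_le_of_le_one hw0.le hw1 (by omega)
    simp only [e, if_neg hz, a', abs_div, abs_mul, abs_of_pos (pow_pos hρ0 _),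
      abs_of_pos (pow_pos hσ0 _)]
    calc _ ≤ |a (i, j)| * (w * ρ₀ ^ (i + j)) / |q| := by gcongr
      _ = _ := by ring
  have hesum : Summable fun z => |e z| :=
    Summable.of_nonneg_of_le (fun _ => abs_nonneg _) heabs (ha.mul_left _)
  have hnorm : ‖ofDouble a' ha' - monomial d‖ < 1 := by
    have : ofDouble a' ha' - monomial d = ofDouble e hesum := by
      ext j i
      rw [map_sub, map_sub, coeff_coeff_ofDouble, coeff_coeff_ofDouble, coeff_monomial]
      simp only [e, Prod.mk.injEq]
      by_cases hj : j = d
      · rw [if_pos hj, coeff_one]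
        by_cases hi : i = 0
        · rw [if_pos hi, if_pos ⟨hi, hj⟩, hi, hj]
          simp only [a']
          rw [pow_zero, one_mul, ← hq, div_self hqne, sub_self]
        · rw [if_neg hi, if_neg fun h => hi h.1, sub_zero]
      · rw [if_neg hj, if_neg fun h => hj h.2, map_zero, sub_zero]
    rw [this, norm_ofDouble]
    calc ∑' z, |e z| ≤ ∑' z : ℕ × ℕ, w / |q| * (|a z| * ρ₀ ^ (z.1 + z.2)) :=
          hesum.tsum_le_tsum heabs (ha.mul_left _)
      _ = w * S / |q| := by rw [tsum_mul_left, ← hS]; ring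
      _ < 1 := by rw [hwS, div_lt_one hq0]; linarith
  obtain ⟨χ, hχ, k, hk⟩ := exists_monic_eval₂_eq_mul hnorm (ofDouble b' hb')
  -- Removing the largest power of X from χ discards the root 0. The constant coefficient of the
  -- cofactor is a nonzero series in x, and it bounds the nonzero roots from below.
  obtain ⟨χ', hχ'⟩ : Polynomial.X ^ χ.natTrailingDegree ∣ χ :=
    Polynomial.X_pow_dvd_iff.2 fun n hn => Polynomial.coeff_eq_zero_of_lt_natTrailingDegree hn
  have hχ'0 : χ'.coeff 0 ≠ 0 := by
    have h1 : χ.coeff χ.natTrailingDegree ≠ 0 :=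
      fun h => hχ.ne_zero (Polynomial.trailingCoeff_eq_zero.1 h)
    intro h2
    apply h1
    rw [← h2, ← Polynomial.coeff_X_pow_mul χ' χ.natTrailingDegree 0, ← hχ', zero_add]
  obtain ⟨M, c, δ, hc, hδ, hlow⟩ := exists_le_abs_eval hχ'0
  set ψ := χ'.divX
  -- C bounds ψ at every h with |h| ≤ 1, and C ≥ c makes the estimate trivial when |h| > 1.
  set C : ℝ := ∑ n ∈ Finset.range (ψ.natDegree + 1), ‖ψ.coeff n‖ + c + 1 with hC
  have hC0 : 0 < C := by positivity
  have hCc : c ≤ C := by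
    have : 0 ≤ ∑ n ∈ Finset.range (ψ.natDegree + 1), ‖ψ.coeff n‖ := by positivity
    linarith
  refine ⟨M, c / (C * ρ ^ M), by positivity, ?_⟩
  have hball : ∀ᶠ z in 𝓝 (0 : ℝ × ℝ), ‖z‖ < min σ (min ρ (δ * ρ)) :=
    Metric.eventually_nhds_iff.2 ⟨min σ (min ρ (δ * ρ)), by positivity,
      fun z hz => by simpa only [dist_zero_right] using hz⟩
  filter_upwards [hball] with ⟨x, y⟩ hz hQz
  rw [lt_min_iff, lt_min_iff, Prod.norm_def, max_lt_iff, max_lt_iff, max_lt_iff] at hz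
  simp only [Real.norm_eq_abs] at hz
  obtain ⟨⟨-, hyσ⟩, ⟨hxρ, -⟩, hxδ, -⟩ := hz
  have hX : ‖x / ρ‖ ≤ 1 := by
    rw [Real.norm_eq_abs, abs_div, abs_of_pos hρ0, div_le_one hρ0]; exact hxρ.le
  have hY : ‖y / σ‖ ≤ 1 := by
    rw [Real.norm_eq_abs, abs_div, abs_of_pos hσ0, div_le_one hσ0]; exact hyσ.le
  set ev := evalTwo (x / ρ) (y / σ) hX hY
  have hevQ : ev (ofDouble a' ha') = 0 := by
    rw [evalTwo_ofDouble]
    have h1 := (haQ x y (hxρ.le.trans (hρle.trans h01))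
      (hyσ.le.trans (hσle.trans h01))).tsum_eq
    rw [hQz] at h1
    have h2 : ∀ z : ℕ × ℕ, a' z * (x / ρ) ^ z.1 * (y / σ) ^ z.2 =
        a z * x ^ z.1 * y ^ z.2 / q := fun z => by
      simp only [a', div_pow]
      have := (pow_pos hρ0 z.1).ne'
      have := (pow_pos hσ0 z.2).ne'
      field_simp
    rw [tsum_congr h2, tsum_div_const, h1, zero_div]
  have hevh : ev (ofDouble b' hb') = h (x, y) := by
    rw [evalTwo_ofDouble, ← (hbh x y (hxρ.le.trans (hρle.trans h02))
      (hyσ.le.trans (hσle.trans h02))).tsum_eq]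
    refine tsum_congr fun z => ?_
    simp only [b', div_pow]
    have := (pow_pos hρ0 z.1).ne'
    have := (pow_pos hσ0 z.2).ne'
    field_simp
  set H := h (x, y)
  have hcomp : ev.comp const = eval (x / ρ) hX := by
    ext p; exact evalTwo_const _ _ hX hY p
  have hroot : χ.eval₂ (eval (x / ρ) hX) H = 0 := by
    have := congrArg ev hk
    rwa [Polynomial.hom_eval₂, hcomp, map_mul, hevQ, mul_zero, hevh] at this
  rw [or_iff_not_imp_left]
  intro hH
  rw [hχ', Polynomial.eval₂_mul, Polynomial.eval₂_X_pow] at hroot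
  replace hroot := (mul_eq_zero.1 hroot).resolve_left (pow_ne_zero _ hH)
  rw [← Polynomial.divX_mul_X_add χ', Polynomial.eval₂_add, Polynomial.eval₂_mul,
    Polynomial.eval₂_X, Polynomial.eval₂_C] at hroot
  have hl := hlow (x / ρ) hX (by
    rw [abs_div, abs_of_pos hρ0, div_le_iff₀ hρ0]; exact hxδ.le)
  have hgoal : c / (C * ρ ^ M) * |x| ^ M = c * |x / ρ| ^ M / C := by
    rw [abs_div, abs_of_pos hρ0, div_pow]; field_simp
  rw [hgoal, div_le_iff₀ hC0]
  rcases le_or_gt |H| 1 with hH1 | hH1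
  · have hψ : |ψ.eval₂ (eval (x / ρ) hX) H| ≤ C := by
      rw [Polynomial.eval₂_eq_sum_range]
      refine (Finset.abs_sum_le_sum_abs _ _).trans (le_trans (Finset.sum_le_sum fun n _ => ?_)
        (by rw [hC]; linarith : ∑ n ∈ Finset.range (ψ.natDegree + 1), ‖ψ.coeff n‖ ≤ C))
      rw [abs_mul, abs_pow]
      exact (mul_le_of_le_one_right (abs_nonneg _) (pow_le_one₀ (abs_nonneg _) hH1)).trans
        (norm_eval_le _ hX _)
    have h3 : eval (x / ρ) hX (χ'.coeff 0) = -(ψ.eval₂ (eval (x / ρ) hX) H * H) := by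
      linarith
    rw [h3, abs_neg, abs_mul] at hl
    calc _ ≤ _ := hl
      _ ≤ C * |H| := by gcongr
      _ = _ := mul_comm _ _
  · calc c * |x / ρ| ^ M ≤ c * 1 := by
          gcongr; exact pow_le_one₀ (abs_nonneg _) hX
      _ ≤ 1 * C := by linarith
      _ ≤ |H| * C := by gcongr

end

section

/-! ### A Łojasiewicz inequality on closed semianalytic subsets of the plane -/

theorem AnalyticAt.not_eventually_mul_eq_zero {F G : ℝ → ℝ} {t : ℝ} (hF : AnalyticAt ℝ F t)
    (hG : AnalyticAt ℝ G t) (hF0 : ¬ ∀ᶠ y in 𝓝 t, F y = 0) (hG0 : ¬ ∀ᶠ y in 𝓝 t, G y = 0) :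
    ¬ ∀ᶠ y in 𝓝 t, F y * G y = 0 := fun h => by
  have h1 := hF.eventually_eq_zero_or_eventually_ne_zero.resolve_left hF0
  have h2 := hG.eventually_eq_zero_or_eventually_ne_zero.resolve_left hG0
  obtain ⟨y, ⟨hy1, hy2⟩, hy⟩ := ((h1.and h2).and (h.filter_mono nhdsWithin_le_nhds)).exists
  exact mul_ne_zero hy1 hy2 hy

/-- On a closed plane set whose relative boundary lies in the zero set of an analytic function, an
analytic function with an isolated zero at the origin is bounded below by a multiple of a power of
the first coordinate. -/
theorem exists_eventually_mul_abs_fst_pow_le {S : Set (ℝ × ℝ)} (hS : IsClosed S)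
    {Q h : ℝ × ℝ → ℝ} (hQ : AnalyticAt ℝ Q 0) (hh : AnalyticAt ℝ h 0)
    (hQreg : ¬ ∀ᶠ y in 𝓝 (0 : ℝ), Q (0, y) = 0) (hhreg : ¬ ∀ᶠ y in 𝓝 (0 : ℝ), h (0, y) = 0)
    (h0 : h 0 = 0) (hloc : ∀ᶠ z in 𝓝 (0 : ℝ × ℝ), z ∈ S → Q z = 0 ∨ S ∈ 𝓝 z)
    (hne : ∀ᶠ z in 𝓝 (0 : ℝ × ℝ), z ∈ S → h z = 0 → z = 0) :
    ∃ (M : ℕ) (c : ℝ), 0 < c ∧ ∀ᶠ z in 𝓝 (0 : ℝ × ℝ), z ∈ S → c * |z.1| ^ M ≤ |h z| := by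
  have hline : ∀ x y : ℝ, HasDerivAt (fun y : ℝ => (x, y)) ((0 : ℝ), (1 : ℝ)) y := fun x y =>
    (hasDerivAt_const y x).prodMk (hasDerivAt_id y)
  have haxis : AnalyticAt ℝ (fun y : ℝ => ((0 : ℝ), y)) 0 := analyticAt_const.prod analyticAt_id
  have hax0 : (fun y : ℝ => ((0 : ℝ), y)) 0 = 0 := rfl
  set D : ℝ × ℝ → ℝ := fun z => fderiv ℝ h z (0, 1) with hD
  have hDan : AnalyticAt ℝ D 0 := 
    ((ContinuousLinearMap.apply ℝ ℝ ((0 : ℝ), (1 : ℝ))).analyticAt _).comp hh.fderiv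
  have hderiv : ∀ᶠ z in 𝓝 (0 : ℝ × ℝ),
      HasDerivAt (fun y => h (z.1, y)) (D z) z.2 := by
    filter_upwards [hh.eventually_analyticAt] with z hz
    exact hz.differentiableAt.hasFDerivAt.comp_hasDerivAt z.2 (hline z.1 z.2)
  -- If ∂h/∂y vanished along the axis near 0, h(0, ·) would be locally constant, equal to h(0) = 0,
  -- against `hhreg`.
  have hDreg : ¬ ∀ᶠ y in 𝓝 (0 : ℝ), D (0, y) = 0 := fun hD0 => by
    apply hhreg
    have h1 : ∀ᶠ y in 𝓝 (0 : ℝ), HasDerivAt (fun y => h (0, y)) 0 y := by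
      have := ((haxis.continuousAt.tendsto : Tendsto _ _ (𝓝 (0 : ℝ × ℝ))).eventually hderiv).and hD0
      filter_upwards [this] with y hy
      have h2 := hy.1
      simp only [hy.2] at h2
      exact h2
    obtain ⟨r, hr, hball⟩ := Metric.eventually_nhds_iff_ball.1 h1
    filter_upwards [Metric.ball_mem_nhds (0 : ℝ) hr] with y hy
    have h3 := (convex_ball (0 : ℝ) r).norm_image_sub_le_of_norm_hasDerivWithin_le
      (f := fun y => h (0, y)) (f' := fun _ => 0) (C := 0)
      (fun x hx => (hball x hx).hasDerivWithinAt) (by simp) (Metric.mem_ball_self hr) hy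
    have h4 : h (0, 0) = 0 := h0
    rw [h4] at h3
    simpa using h3
  have hprod : ¬ ∀ᶠ y in 𝓝 (0 : ℝ), (Q * D) (0, y) = 0 :=
    AnalyticAt.not_eventually_mul_eq_zero (F := fun y => Q (0, y)) (G := fun y => D (0, y))
      (hQ.comp_of_eq haxis hax0) (hDan.comp_of_eq haxis hax0) hQreg hDreg
  obtain ⟨M, c, hc, hM⟩ := (hQ.mul hDan).exists_eventually_eq_zero_or_le_abs hh hprod
  have hhne : ∀ᶠ y in 𝓝 (0 : ℝ), y ≠ 0 → h (0, y) ≠ 0 := by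
    have := ((hh.comp_of_eq haxis hax0).eventually_eq_zero_or_eventually_ne_zero).resolve_left hhreg
    exact eventually_nhdsWithin_iff.1 this
  obtain ⟨r₁, hr₁, hball⟩ := Metric.eventually_nhds_iff_ball.1
    (hM.and (hloc.and (hne.and (hderiv.and hh.eventually_analyticAt))))
  obtain ⟨r₂, hr₂, hball₂⟩ := Metric.eventually_nhds_iff_ball.1 hhne
  obtain ⟨δ, hδ, hδ₁, hδ₂⟩ : ∃ δ : ℝ, 0 < δ ∧ δ < r₁ ∧ δ < r₂ :=
    ⟨min r₁ r₂ / 2, by positivity, by linarith [min_le_left r₁ r₂, lt_min hr₁ hr₂],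
      by linarith [min_le_right r₁ r₂, lt_min hr₁ hr₂]⟩
  have hbox : ∀ x y : ℝ, |x| ≤ δ → |y| ≤ δ → (x, y) ∈ Metric.ball (0 : ℝ × ℝ) r₁ := by
    intro x y hx hy
    rw [mem_ball_zero_iff, Prod.norm_def]
    exact max_lt (hx.trans_lt hδ₁) (hy.trans_lt hδ₁)
  have hside : ∀ y : ℝ, |y| = δ → ∃ c₀ : ℝ, 0 < c₀ ∧ ∀ᶠ x in 𝓝 (0 : ℝ), c₀ ≤ |h (x, y)| := by
    intro y hy
    have hpos : 0 < |h (0, y)| := abs_pos.2 (hball₂ y (by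
      rw [mem_ball_zero_iff, Real.norm_eq_abs, hy]; exact hδ₂)
      (abs_pos.1 (hy ▸ hδ)))
    have hcont : ContinuousAt (fun x : ℝ => |h (x, y)|) 0 := by
      have h1 : ContinuousAt h (0, y) :=
        (hball (0, y) (hbox 0 y (by simpa using hδ.le) hy.le)).2.2.2.2.continuousAt
      have h2 : ContinuousAt (fun x : ℝ => h (x, y)) 0 :=
        h1.comp_of_eq (f := fun x : ℝ => (x, y)) (by fun_prop) rfl
      exact h2.abs
    exact ⟨|h (0, y)| / 2, by positivity,
      (hcont.eventually_const_le (by dsimp only; linarith))⟩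
  obtain ⟨c₁, hc₁, hs₁⟩ := hside δ (abs_of_pos hδ)
  obtain ⟨c₂, hc₂, hs₂⟩ := hside (-δ) (by rw [abs_neg, abs_of_pos hδ])
  -- The exponent M + 1 makes the bound trivial on the slice x = 0, even if M = 0.
  refine ⟨M + 1, min c (min c₁ c₂), by positivity, ?_⟩
  have hfst : Tendsto (Prod.fst : ℝ × ℝ → ℝ) (𝓝 0) (𝓝 0) := continuous_fst.tendsto 0
  filter_upwards [hfst.eventually hs₁, hfst.eventually hs₂, Metric.ball_mem_nhds 0 hδ,
    Metric.ball_mem_nhds 0 one_pos] with ⟨x, y₀⟩ hx₁ hx₂ hzδ hz1 hzS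
  simp only at hx₁ hx₂ ⊢
  rw [mem_ball_zero_iff, Prod.norm_def, max_lt_iff] at hzδ hz1
  simp only [Real.norm_eq_abs] at hzδ hz1
  rcases eq_or_ne x 0 with rfl | hx0
  · simp
  have hK : IsCompact {y ∈ Icc (-δ) δ | (x, y) ∈ S} :=
    isCompact_Icc.inter_right (hS.preimage (by fun_prop : Continuous fun y : ℝ => (x, y)))
  have hcontK : ContinuousOn (fun y => |h (x, y)|) {y ∈ Icc (-δ) δ | (x, y) ∈ S} := fun y hy => by
    have h1 := (hball (x, y) (hbox x y hzδ.1.le (abs_le.2 hy.1))).2.2.2.1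
    exact h1.continuousAt.continuousWithinAt.abs
  -- Minimise |h| over the slice of S at abscissa x. A minimiser away from the edges |y| = δ lies on
  -- Q = 0 or in the interior of S; in the second case ∂h/∂y = 0. Either way Q · D vanishes there,
  -- and `hM` applies.
  obtain ⟨y, ⟨hyI, hyS⟩, hmin⟩ := hK.exists_isMinOn ⟨y₀, abs_le.1 hzδ.2.le, hzS⟩ hcontK
  have hle : |h (x, y)| ≤ |h (x, y₀)| := hmin ⟨abs_le.1 hzδ.2.le, hzS⟩
  refine le_trans ?_ hle
  have hxpow : |x| ^ (M + 1) ≤ 1 := pow_le_one₀ (abs_nonneg _) hz1.1.le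
  have hxpow0 : 0 ≤ |x| ^ (M + 1) := by positivity
  have hedge : ∀ c' : ℝ, min c (min c₁ c₂) ≤ c' → 0 < c' → c' ≤ |h (x, y)| →
      min c (min c₁ c₂) * |x| ^ (M + 1) ≤ |h (x, y)| := fun c' h1 h2 h3 =>
    (mul_le_mul h1 hxpow hxpow0 h2.le).trans ((mul_one c').trans_le h3)
  rcases hyI.2.eq_or_lt with rfl | hyδ
  · exact hedge c₁ ((min_le_right _ _).trans (min_le_left _ _)) hc₁ hx₁
  rcases hyI.1.eq_or_lt with rfl | hyδ'
  · exact hedge c₂ ((min_le_right _ _).trans (min_le_right _ _)) hc₂ hx₂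
  obtain ⟨b1, b2, b3, b4, -⟩ := hball (x, y) (hbox x y hzδ.1.le (abs_le.2 hyI))
  have hhy : h (x, y) ≠ 0 := fun h' => hx0 (congrArg Prod.fst (b3 hyS h'))
  have hzero : (Q * D) (x, y) = 0 := by
    rcases b2 hyS with hq | hnhds
    · simp [hq]
    · have hlm : IsLocalMin (fun y => h (x, y) ^ 2) y := by
        have hcl : Continuous fun y : ℝ => (x, y) := by fun_prop
        filter_upwards [hcl.continuousAt.preimage_mem_nhds hnhds, Ioo_mem_nhds hyδ' hyδ]
          with y' hy'S hy'I
        exact sq_le_sq.2 (hmin ⟨Ioo_subset_Icc_self hy'I, hy'S⟩)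
      have hz := hlm.hasDerivAt_eq_zero (b4.pow 2)
      have hD0 : D (x, y) = 0 := by
        have : (2 : ℝ) * h (x, y) * D (x, y) = 0 := by simpa using hz
        exact (mul_eq_zero.1 this).resolve_left (mul_ne_zero two_ne_zero hhy)
      simp [hD0]
  refine le_trans ?_ ((b1 hzero).resolve_left hhy)
  exact mul_le_mul (min_le_left _ _)
    (pow_le_pow_of_le_one (abs_nonneg _) hz1.1.le (Nat.le_succ M)) hxpow0 hc.le

/-- Germs of analytic functions have no zero divisors: g vanishes on an open set where f does not,
and the identity theorem spreads this over a ball. -/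
theorem AnalyticAt.eventually_eq_zero_or_of_mul {f g : ℝ × ℝ → ℝ} {z : ℝ × ℝ}
    (hf : AnalyticAt ℝ f z) (hg : AnalyticAt ℝ g z) (h : ∀ᶠ w in 𝓝 z, f w * g w = 0) :
    (∀ᶠ w in 𝓝 z, f w = 0) ∨ ∀ᶠ w in 𝓝 z, g w = 0 := by
  rw [or_iff_not_imp_left]
  intro hf0
  obtain ⟨r, hr, hball⟩ := Metric.eventually_nhds_iff_ball.1
    (h.and (hf.eventually_analyticAt.and hg.eventually_analyticAt))
  obtain ⟨w, hw, hfw⟩ : ∃ w ∈ Metric.ball z r, f w ≠ 0 := by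
    by_contra! hcon
    exact hf0 (by filter_upwards [Metric.ball_mem_nhds z hr] using hcon)
  have hgw : g =ᶠ[𝓝 w] 0 := by
    filter_upwards [(hball w hw).2.1.continuousAt.eventually_ne hfw,
      Metric.isOpen_ball.mem_nhds hw] with w' h1 h2
    exact (mul_eq_zero.1 (hball w' h2).1).resolve_left h1
  have hzero := AnalyticOnNhd.eqOn_zero_of_preconnected_of_eventuallyEq_zero
    (fun w' hw' => (hball w' hw').2.2) (convex_ball z r).isPreconnected hw hgw
  filter_upwards [Metric.ball_mem_nhds z hr] with w' hw' using hzero hw'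

/-- A point near 0 where P does not vanish gives a regular direction, by the identity theorem on the
segment joining it to 0. Moving that point slightly at a right angle gives a second, independent
one. -/
theorem AnalyticAt.exists_two_regular_directions {P : ℝ × ℝ → ℝ} (hP : AnalyticAt ℝ P 0)
    (hP0 : P 0 = 0) (hne : ¬ ∀ᶠ z in 𝓝 0, P z = 0) :
    ∃ q q' : ℝ × ℝ, q.1 * q'.2 - q.2 * q'.1 ≠ 0 ∧
      (¬ ∀ᶠ t in 𝓝 (0 : ℝ), P (t • q) = 0) ∧ ¬ ∀ᶠ t in 𝓝 (0 : ℝ), P (t • q') = 0 := by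
  obtain ⟨r, hr, hball⟩ := Metric.eventually_nhds_iff_ball.1 hP.eventually_analyticAt
  have hdir : ∀ q ∈ Metric.ball (0 : ℝ × ℝ) r, P q ≠ 0 → ¬ ∀ᶠ t in 𝓝 (0 : ℝ), P (t • q) = 0 := by
    intro q hq hPq h
    have han : AnalyticOnNhd ℝ (fun t : ℝ => P (t • q)) (Icc 0 1) := fun t ht => by
      refine (hball (t • q) ?_).comp (f := fun t : ℝ => t • q) (analyticAt_id.smul analyticAt_const)
      rw [mem_ball_zero_iff] at hq ⊢
      rw [norm_smul, Real.norm_eq_abs, abs_of_nonneg ht.1]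
      exact (mul_le_of_le_one_left (norm_nonneg _) ht.2).trans_lt hq
    have := han.eqOn_zero_of_preconnected_of_eventuallyEq_zero isPreconnected_Icc
      (by simp : (0 : ℝ) ∈ Icc (0 : ℝ) 1) h (by simp : (1 : ℝ) ∈ Icc (0 : ℝ) 1)
    simp only [one_smul, Pi.zero_apply] at this
    exact hPq this
  obtain ⟨q, hq, hPq⟩ : ∃ q ∈ Metric.ball (0 : ℝ × ℝ) r, P q ≠ 0 := by
    by_contra! hcon
    exact hne (by filter_upwards [Metric.ball_mem_nhds 0 hr] using hcon)
  have hq0 : q ≠ 0 := fun h => hPq (h ▸ hP0)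
  have hline : ContinuousAt (fun s : ℝ => q + s • (-q.2, q.1)) 0 := by fun_prop
  have hline0 : q + (0 : ℝ) • (-q.2, q.1) = q := by simp
  have hev : ∀ᶠ s in 𝓝 (0 : ℝ), q + s • (-q.2, q.1) ∈ Metric.ball (0 : ℝ × ℝ) r ∧
      P (q + s • (-q.2, q.1)) ≠ 0 := by
    have ht : Tendsto (fun s : ℝ => q + s • (-q.2, q.1)) (𝓝 0) (𝓝 q) := by
      simpa only [hline0] using hline.tendsto
    exact ht.eventually ((Metric.isOpen_ball.eventually_mem hq).and
      ((hball q hq).continuousAt.eventually_ne hPq))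
  obtain ⟨s, hs, hs0⟩ := ((hev.filter_mono nhdsWithin_le_nhds).and
    (self_mem_nhdsWithin (s := ({0} : Set ℝ)ᶜ))).exists
  refine ⟨q, _, ?_, hdir q hq hPq, hdir _ hs.1 hs.2⟩
  have hs0' : s ≠ 0 := hs0
  have hsq : 0 < q.1 ^ 2 + q.2 ^ 2 := by
    by_contra! hle
    have h1 : q.1 = 0 := by nlinarith [sq_nonneg q.1, sq_nonneg q.2]
    have h2 : q.2 = 0 := by nlinarith [sq_nonneg q.1, sq_nonneg q.2]
    exact hq0 (Prod.ext h1 h2)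
  have : q.1 * (q + s • (-q.2, q.1)).2 - q.2 * (q + s • (-q.2, q.1)).1
      = s * (q.1 ^ 2 + q.2 ^ 2) := by
    simp only [Prod.snd_add, Prod.fst_add, Prod.smul_mk, smul_eq_mul]; ring
  rw [this]
  exact mul_ne_zero hs0' (ne_of_gt hsq)

/-- The coordinate along `q` is controlled by an analytic function with an isolated zero on a
closed set, if the functions involved do not vanish identically along `q'`. -/
theorem exists_eventually_mul_abs_coord_pow_le {S : Set (ℝ × ℝ)} (hS : IsClosed S)
    {Q h : ℝ × ℝ → ℝ} (hQ : AnalyticAt ℝ Q 0) (hh : AnalyticAt ℝ h 0) {q q' : ℝ × ℝ}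
    (hdet : q.1 * q'.2 - q.2 * q'.1 ≠ 0)
    (hQreg : ¬ ∀ᶠ y in 𝓝 (0 : ℝ), Q (y • q') = 0) (hhreg : ¬ ∀ᶠ y in 𝓝 (0 : ℝ), h (y • q') = 0)
    (h0 : h 0 = 0) (hloc : ∀ᶠ z in 𝓝 (0 : ℝ × ℝ), z ∈ S → Q z = 0 ∨ S ∈ 𝓝 z)
    (hne : ∀ᶠ z in 𝓝 (0 : ℝ × ℝ), z ∈ S → h z = 0 → z = 0) :
    ∃ (M : ℕ) (c : ℝ), 0 < c ∧ ∀ᶠ z in 𝓝 (0 : ℝ × ℝ), z ∈ S →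
      c * |(z.1 * q'.2 - z.2 * q'.1) / (q.1 * q'.2 - q.2 * q'.1)| ^ M ≤ |h z| := by
  set Δ := q.1 * q'.2 - q.2 * q'.1 with hΔ
  -- Coordinates in the basis q, q', in which the line along q' becomes the axis x = 0.
  let T : ℝ × ℝ → ℝ × ℝ := fun z => z.1 • q + z.2 • q'
  let T' : ℝ × ℝ → ℝ × ℝ := fun z =>
    ((z.1 * q'.2 - z.2 * q'.1) / Δ, (q.1 * z.2 - q.2 * z.1) / Δ)
  have hTT' : ∀ z, T (T' z) = z := fun z => by
    ext
    · simp only [T, T', Prod.fst_add, Prod.smul_fst, smul_eq_mul]; field_simp; rw [hΔ]; ring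
    · simp only [T, T', Prod.snd_add, Prod.smul_snd, smul_eq_mul]; field_simp; rw [hΔ]; ring
  have hT'T : ∀ z, T' (T z) = z := fun z => by
    ext
    · simp only [T, T', Prod.fst_add, Prod.smul_fst, Prod.snd_add, Prod.smul_snd, smul_eq_mul]
      field_simp; rw [hΔ]; ring
    · simp only [T, T', Prod.fst_add, Prod.smul_fst, Prod.snd_add, Prod.smul_snd, smul_eq_mul]
      field_simp; rw [hΔ]; ring
  have hTc : Continuous T := by fun_prop
  have hT'c : Continuous T' := by fun_prop
  have hT0 : T 0 = 0 := by simp [T]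
  have hT'0 : T' 0 = 0 := by simp [T']
  have hTan : AnalyticAt ℝ T 0 :=
    (analyticAt_fst.smul analyticAt_const).add (analyticAt_snd.smul analyticAt_const)
  have hTt : Tendsto T (𝓝 0) (𝓝 0) := hTc.tendsto' 0 0 hT0
  have hT'y : ∀ y : ℝ, T (0, y) = y • q' := fun y => by simp [T]
  obtain ⟨M, c, hc, hM⟩ := exists_eventually_mul_abs_fst_pow_le (hS.preimage hTc)
    (hQ.comp_of_eq hTan hT0) (hh.comp_of_eq hTan hT0)
    (by simpa only [Function.comp_apply, hT'y] using hQreg)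
    (by simpa only [Function.comp_apply, hT'y] using hhreg)
    (by rw [Function.comp_apply, hT0, h0])
    (by
      filter_upwards [hTt.eventually hloc] with z hz hzS
      exact (hz hzS).imp id fun h' => hTc.continuousAt.preimage_mem_nhds h')
    (by
      filter_upwards [hTt.eventually hne] with z hz hzS hz0
      rw [← hT'T z, hz hzS hz0, hT'0])
  refine ⟨M, c, hc, ?_⟩
  filter_upwards [(hT'c.tendsto' 0 0 hT'0).eventually hM] with z hz hzS
  have := hz (by rw [mem_preimage, hTT']; exact hzS)
  rw [Function.comp_apply, hTT'] at this
  exact this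

/-- Łojasiewicz inequality at the origin of a closed semianalytic set. -/
theorem IsSemianalytic.exists_eventually_mul_norm_pow_le_zero {S : Set (ℝ × ℝ)}
    (hSA : IsSemianalytic S) (hS : IsClosed S) {h : ℝ × ℝ → ℝ} (hh : AnalyticAt ℝ h 0)
    (h0 : h 0 = 0) (hne : ∀ᶠ z in 𝓝 (0 : ℝ × ℝ), z ∈ S → h z = 0 → z = 0) :
    ∃ (M : ℕ) (c : ℝ), 0 < c ∧ ∀ᶠ z in 𝓝 (0 : ℝ × ℝ), z ∈ S → c * ‖z‖ ^ M ≤ |h z| := by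
  classical
  by_cases hzero : ∀ᶠ z in 𝓝 (0 : ℝ × ℝ), h z = 0
  · refine ⟨1, 1, one_pos, ?_⟩
    filter_upwards [hzero, hne] with z h1 h2 h3
    simp [h2 h3 h1]
  obtain ⟨W, hW, m, k, f, g, hf, hg, hdesc⟩ := hSA 0
  have h0W : (0 : ℝ × ℝ) ∈ W := mem_of_mem_nhds hW
  -- Pieces whose equation vanishes identically near 0 are given there by strict inequalities alone,
  -- hence are open. So near 0 the product of the remaining f i vanishes at every point of S of
  -- which S is not a neighbourhood.
  set I : Finset (Fin m) := Finset.univ.filter fun i => ¬ ∀ᶠ z in 𝓝 (0 : ℝ × ℝ), f i z = 0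
  let Q : ℝ × ℝ → ℝ := fun z => ∏ i ∈ I, f i z
  have hQ : AnalyticAt ℝ Q 0 := Finset.analyticAt_fun_prod I fun i _ => hf i 0 h0W
  have hQne : ¬ ∀ᶠ z in 𝓝 (0 : ℝ × ℝ), Q z = 0 := by
    have : ∀ J ⊆ I, ¬ ∀ᶠ z in 𝓝 (0 : ℝ × ℝ), ∏ i ∈ J, f i z = 0 := by
      intro J
      induction J using Finset.induction_on with
      | empty =>
        intro _ hev
        obtain ⟨z, hz⟩ := hev.exists
        simp at hz
      | insert i J hi ih =>
        intro hJ hev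
        simp only [Finset.prod_insert hi] at hev
        rcases AnalyticAt.eventually_eq_zero_or_of_mul (hf i 0 h0W)
          (Finset.analyticAt_fun_prod J fun i _ => hf i 0 h0W) hev with h1 | h1
        · exact (Finset.mem_filter.1 (hJ (Finset.mem_insert_self i J))).2 h1
        · exact ih ((Finset.subset_insert i J).trans hJ) h1
    exact this I subset_rfl
  have hP : ¬ ∀ᶠ z in 𝓝 (0 : ℝ × ℝ), Q z * h z = 0 := fun hev =>
    (AnalyticAt.eventually_eq_zero_or_of_mul hQ hh hev).elim hQne hzero
  obtain ⟨q, q', hdet, hq, hq'⟩ := (hQ.mul hh).exists_two_regular_directions (by simp [h0]) hP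
  have hloc : ∀ᶠ z in 𝓝 (0 : ℝ × ℝ), z ∈ S → Q z = 0 ∨ S ∈ 𝓝 z := by
    have hall : ∀ᶠ z in 𝓝 (0 : ℝ × ℝ), ∀ i ∉ I, ∀ᶠ w in 𝓝 z, f i w = 0 := by
      rw [eventually_all]
      intro i
      by_cases hi : i ∈ I
      · exact Eventually.of_forall fun z h' => absurd hi h'
      · have : ∀ᶠ z in 𝓝 (0 : ℝ × ℝ), f i z = 0 := by simpa [I] using hi
        filter_upwards [this.eventually_nhds] with z hz _ using hz
    filter_upwards [hall, eventually_mem_nhds_iff.2 hW] with z hz hzW hzS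
    have hzW' := mem_of_mem_nhds hzW
    obtain ⟨i, hfi, hgi⟩ := (hdesc z hzW').1 hzS
    by_cases hi : i ∈ I
    · exact Or.inl (Finset.prod_eq_zero hi hfi)
    · right
      have hpos : ∀ᶠ w in 𝓝 z, ∀ j, 0 < g i j w :=
        eventually_all.2 fun j => (hg i j z hzW').continuousAt.eventually_const_lt (hgi j)
      filter_upwards [hz i hi, hpos, hzW] with w h1 h2 h3
      exact (hdesc w h3).2 ⟨i, h1, h2⟩
  have hregQ : ∀ p : ℝ × ℝ, (¬ ∀ᶠ t in 𝓝 (0 : ℝ), (Q * h) (t • p) = 0) →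
      (¬ ∀ᶠ t in 𝓝 (0 : ℝ), Q (t • p) = 0) ∧ ¬ ∀ᶠ t in 𝓝 (0 : ℝ), h (t • p) = 0 := by
    intro p hp
    refine ⟨fun h' => hp ?_, fun h' => hp ?_⟩ <;> filter_upwards [h'] with t ht <;> simp [ht]
  obtain ⟨M₁, c₁, hc₁, hM₁⟩ := exists_eventually_mul_abs_coord_pow_le hS hQ hh hdet
    (hregQ q' hq').1 (hregQ q' hq').2 h0 hloc hne
  have hdet' : q'.1 * q.2 - q'.2 * q.1 ≠ 0 := fun h' => hdet (by linarith)
  obtain ⟨M₂, c₂, hc₂, hM₂⟩ := exists_eventually_mul_abs_coord_pow_le hS hQ hh hdet'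
    (hregQ q hq).1 (hregQ q hq).2 h0 hloc hne
  set X : ℝ × ℝ → ℝ := fun z => (z.1 * q'.2 - z.2 * q'.1) / (q.1 * q'.2 - q.2 * q'.1)
  set Y : ℝ × ℝ → ℝ := fun z => (z.1 * q.2 - z.2 * q.1) / (q'.1 * q.2 - q'.2 * q.1)
  have hdec : ∀ z, z = X z • q + Y z • q' := fun z => by
    have hYX : Y z = (z.2 * q.1 - z.1 * q.2) / (q.1 * q'.2 - q.2 * q'.1) := by
      simp only [Y]
      rw [← neg_div_neg_eq]
      congr 1 <;> ring
    ext
    · simp only [Prod.fst_add, Prod.smul_fst, smul_eq_mul, hYX]; simp only [X]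
      rw [div_mul_eq_mul_div, div_mul_eq_mul_div, ← add_div, eq_div_iff hdet]; ring
    · simp only [Prod.snd_add, Prod.smul_snd, smul_eq_mul, hYX]; simp only [X]
      rw [div_mul_eq_mul_div, div_mul_eq_mul_div, ← add_div, eq_div_iff hdet]; ring
  set K : ℝ := ‖q‖ + ‖q'‖ + 1 with hK
  have hK0 : 0 < K := by positivity
  -- Near 0 the larger of the two coordinates is at most 1, so either estimate holds with exponent
  -- M₁ + M₂; K compares that coordinate with the norm.
  refine ⟨M₁ + M₂, min c₁ c₂ / K ^ (M₁ + M₂), by positivity, ?_⟩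
  have hXc : Tendsto X (𝓝 0) (𝓝 0) :=
    (by fun_prop : Continuous X).tendsto' 0 0 (by simp [X])
  have hYc : Tendsto Y (𝓝 0) (𝓝 0) :=
    (by fun_prop : Continuous Y).tendsto' 0 0 (by simp [Y])
  filter_upwards [hM₁, hM₂, hXc.eventually (Metric.ball_mem_nhds 0 one_pos),
    hYc.eventually (Metric.ball_mem_nhds 0 one_pos)] with z h1 h2 hX1 hY1 hzS
  rw [Real.dist_eq, sub_zero] at hX1 hY1
  set N := max |X z| |Y z|
  have hN0 : 0 ≤ N := (abs_nonneg _).trans (le_max_left _ _)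
  have hN1 : N ≤ 1 := max_le hX1.le hY1.le
  have hnorm : ‖z‖ ≤ K * N := by
    conv_lhs => rw [hdec z]
    refine (norm_add_le _ _).trans ?_
    rw [norm_smul, norm_smul, Real.norm_eq_abs, Real.norm_eq_abs]
    have e1 : |X z| * ‖q‖ ≤ N * ‖q‖ := by gcongr; exact le_max_left _ _
    have e2 : |Y z| * ‖q'‖ ≤ N * ‖q'‖ := by gcongr; exact le_max_right _ _
    rw [hK]
    nlinarith
  have hNh : min c₁ c₂ * N ^ (M₁ + M₂) ≤ |h z| := by
    rcases max_choice |X z| |Y z| with hmax | hmax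
    · refine le_trans ?_ (h1 hzS)
      refine mul_le_mul (min_le_left _ _) ?_ (by positivity) hc₁.le
      refine (pow_le_pow_of_le_one hN0 hN1 (Nat.le_add_right M₁ M₂)).trans ?_
      exact (congrArg (· ^ M₁) hmax).le
    · refine le_trans ?_ (h2 hzS)
      refine mul_le_mul (min_le_right _ _) ?_ (by positivity) hc₂.le
      refine (pow_le_pow_of_le_one hN0 hN1 (Nat.le_add_left M₂ M₁)).trans ?_
      exact (congrArg (· ^ M₂) hmax).le
  refine le_trans ?_ hNh
  calc min c₁ c₂ / K ^ (M₁ + M₂) * ‖z‖ ^ (M₁ + M₂)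
      ≤ min c₁ c₂ / K ^ (M₁ + M₂) * (K * N) ^ (M₁ + M₂) := by gcongr
    _ = min c₁ c₂ * N ^ (M₁ + M₂) := by rw [mul_pow]; field_simp

theorem IsSemianalytic.preimage_add_right {S : Set (ℝ × ℝ)} (hS : IsSemianalytic S)
    (p : ℝ × ℝ) : IsSemianalytic ((fun z => z + p) ⁻¹' S) := by
  intro z
  obtain ⟨W, hW, m, k, f, g, hf, hg, hdesc⟩ := hS (z + p)
  have hadd : ∀ w : ℝ × ℝ, AnalyticAt ℝ (fun z => z + p) w := fun w =>
    analyticAt_id.add analyticAt_const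
  refine ⟨(fun z => z + p) ⁻¹' W, (hadd z).continuousAt.preimage_mem_nhds hW, m, k,
    fun i z => f i (z + p), fun i j z => g i j (z + p), fun i w hw => ?_, fun i j w hw => ?_,
    fun w hw => hdesc _ hw⟩
  · exact (hf i _ hw).comp (f := fun z => z + p) (hadd w)
  · exact (hg i j _ hw).comp (f := fun z => z + p) (hadd w)

/-- **Łojasiewicz inequality** at an isolated zero on a closed semianalytic set. -/
theorem IsSemianalytic.exists_eventually_mul_norm_pow_le {S : Set (ℝ × ℝ)}
    (hSA : IsSemianalytic S) (hS : IsClosed S) {h : ℝ × ℝ → ℝ} {p : ℝ × ℝ}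
    (hh : AnalyticAt ℝ h p) (h0 : h p = 0) (hne : ∀ z ∈ S, h z = 0 → z = p) :
    ∃ (M : ℕ) (c : ℝ), 0 < c ∧ ∀ᶠ z in 𝓝 p, z ∈ S → c * ‖z - p‖ ^ M ≤ |h z| := by
  have hadd : AnalyticAt ℝ (fun z => z + p) 0 := analyticAt_id.add analyticAt_const
  obtain ⟨M, c, hc, hM⟩ := (hSA.preimage_add_right p).exists_eventually_mul_norm_pow_le_zero
    (hS.preimage (by fun_prop : Continuous fun z => z + p))
    (hh.comp_of_eq hadd (zero_add p)) (by simp [h0])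
    (Eventually.of_forall fun z hz hz0 => by
      have := hne _ hz hz0
      simpa using this)
  refine ⟨M, c, hc, ?_⟩
  have ht : Tendsto (fun z => z - p) (𝓝 p) (𝓝 0) :=
    (by fun_prop : Continuous fun z : ℝ × ℝ => z - p).tendsto' p 0 (sub_self p)
  filter_upwards [ht.eventually hM] with z hz hzS
  simpa using hz (by simpa using hzS)

end

section

/-! ### Families of increasing branches with a power-law critical point -/

/-- The power-law part `u (1 - (1 - x / c) ^ α)` of a branch on `[0, c]`. -/
noncomputable def powPart (α u c x : ℝ) : ℝ := u * (1 - (1 - x / c) ^ α)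

/-- The branch `φ (u (1 - (1 - x / c) ^ α))` on `[0, c]`. -/
noncomputable def branch (α : ℝ) (φ : ℝ → ℝ) (u c x : ℝ) : ℝ := φ (powPart α u c x)

/-- The derivative of `branch α φ u c` in terms of the derivative `φ'` of `φ`. -/
noncomputable def branchDeriv (α : ℝ) (φ' : ℝ → ℝ) (u c x : ℝ) : ℝ :=
  φ' (powPart α u c x) * (u * (α * (1 - x / c) ^ (α - 1) / c))

/-- A continuous family of branches over a compact parameter set, with diffeomorphic parts `φ` of
`[0,1]` of controlled derivative, and without fixed points in the interior of the branch. -/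
structure BranchFamily {X : Type*} [MetricSpace X] (α : ℝ) (U : Set X) (φ φ' : X → ℝ → ℝ)
    (u c : X → ℝ) : Prop where
  one_lt : 1 < α
  isCompact : IsCompact U
  cont_u : ContinuousOn u U
  cont_c : ContinuousOn c U
  cont_phi : ContinuousOn (fun z : X × ℝ => φ z.1 z.2) (U ×ˢ Icc (0 : ℝ) 1)
  cont_dphi : ContinuousOn (fun z : X × ℝ => φ' z.1 z.2) (U ×ˢ Icc (0 : ℝ) 1)
  hasDeriv : ∀ p ∈ U, ∀ x ∈ Icc (0 : ℝ) 1, HasDerivWithinAt (φ p) (φ' p x) (Icc 0 1) x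
  map_zero : ∀ p ∈ U, φ p 0 = 0
  map_one : ∀ p ∈ U, φ p 1 = 1
  half_le : ∀ p ∈ U, ∀ x ∈ Icc (0 : ℝ) 1, 1 / 2 ≤ φ' p x
  le_two : ∀ p ∈ U, ∀ x ∈ Icc (0 : ℝ) 1, φ' p x ≤ 2
  abs_sub_le : ∀ p ∈ U, ∀ x ∈ Icc (0 : ℝ) 1, |φ' p x - φ' p 0| ≤ x
  u_mem : ∀ p ∈ U, u p ∈ Icc (0 : ℝ) 1
  c_mem : ∀ p ∈ U, c p ∈ Ioo (0 : ℝ) 1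
  not_fixed : ∀ p ∈ U, ∀ x ∈ Ioo 0 (c p), branch α (φ p) (u p) (c p) x ≠ x

theorem powPart_zero {α : ℝ} (u c : ℝ) : powPart α u c 0 = 0 := by
  simp [powPart]

theorem powPart_self {α : ℝ} (hα : 1 < α) (u : ℝ) {c : ℝ} (hc : 0 < c) : powPart α u c c = u := by
  rw [powPart, div_self hc.ne', sub_self, Real.zero_rpow (by linarith)]
  ring

theorem one_sub_div_mem {c x : ℝ} (hc : 0 < c) (hx : x ∈ Icc 0 c) :
    1 - x / c ∈ Icc (0 : ℝ) 1 :=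
  ⟨sub_nonneg.2 ((div_le_one hc).2 hx.2), by linarith [div_nonneg hx.1 hc.le]⟩

theorem powPart_mem {α u c x : ℝ} (hα : 1 < α) (hu : u ∈ Icc (0 : ℝ) 1) (hc : 0 < c)
    (hx : x ∈ Icc 0 c) : powPart α u c x ∈ Icc (0 : ℝ) 1 := by
  have h := one_sub_div_mem hc hx
  have h1 : (1 - x / c) ^ α ≤ 1 := Real.rpow_le_one h.1 h.2 (by linarith)
  have h2 : 0 ≤ (1 - x / c) ^ α := Real.rpow_nonneg h.1 _
  exact ⟨mul_nonneg hu.1 (by linarith), mul_le_one₀ hu.2 (by linarith) (by linarith)⟩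

/-- Bernoulli's inequality for (1 - x / c) ^ α. -/
theorem powPart_le {α u c x : ℝ} (hα : 1 < α) (hu : u ∈ Icc (0 : ℝ) 1) (hc : 0 < c)
    (hx : x ∈ Icc 0 c) : powPart α u c x ≤ α * (x / c) := by
  have h := one_sub_div_mem hc hx
  have h1 := one_add_mul_self_le_rpow_one_add (s := -(x / c)) (by linarith [h.1]) hα.le
  rw [← sub_eq_add_neg] at h1
  have h2 : (1 - x / c) ^ α ≤ 1 := Real.rpow_le_one h.1 h.2 (by linarith)
  rw [powPart]
  calc u * (1 - (1 - x / c) ^ α) ≤ 1 * (1 - (1 - x / c) ^ α) := by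
        exact mul_le_mul_of_nonneg_right hu.2 (by linarith)
    _ ≤ _ := by linarith

theorem powPart_strictMonoOn {α u c : ℝ} (hα : 1 < α) (hu : 0 < u) (hc : 0 < c) :
    StrictMonoOn (powPart α u c) (Icc 0 c) := fun x _ y hy hxy => by
  have h := one_sub_div_mem hc hy
  have h1 : (1 - y / c) ^ α < (1 - x / c) ^ α :=
    Real.rpow_lt_rpow h.1 (by gcongr) (by linarith)
  exact mul_lt_mul_of_pos_left (by linarith) hu

theorem hasDerivAt_powPart {α : ℝ} (hα : 1 < α) (u c x : ℝ) :
    HasDerivAt (powPart α u c) (u * (α * (1 - x / c) ^ (α - 1) / c)) x := by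
  have h1 : HasDerivAt (fun x => 1 - x / c) (-(1 / c)) x := by
    simpa using ((hasDerivAt_id x).div_const c).const_sub 1
  have h2 := ((h1.rpow_const (p := α) (Or.inr hα.le)).const_sub 1).const_mul u
  refine h2.congr_deriv ?_
  ring

namespace BranchFamily

variable {X : Type*} [MetricSpace X] {α : ℝ} {U : Set X} {φ φ' : X → ℝ → ℝ} {u c : X → ℝ}

theorem exists_sub_eq (H : BranchFamily α U φ φ' u c) {p : X} (hp : p ∈ U) {x y : ℝ}
    (hx : 0 ≤ x) (hxy : x < y) (hy : y ≤ 1) :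
    ∃ ζ ∈ Ioo x y, φ p y - φ p x = φ' p ζ * (y - x) := by
  have hsub : Icc x y ⊆ Icc 0 1 := Icc_subset_Icc hx hy
  obtain ⟨ζ, hζ, h⟩ := exists_hasDerivAt_eq_slope (φ p) (φ' p) hxy
    (fun z hz => ((H.hasDeriv p hp z (hsub hz)).continuousWithinAt).mono hsub)
    (fun z hz => (H.hasDeriv p hp z (hsub (Ioo_subset_Icc_self hz))).hasDerivAt
      (Icc_mem_nhds (hx.trans_lt hz.1) (hz.2.trans_le hy)))
  refine ⟨ζ, hζ, ?_⟩
  rw [h, div_mul_cancel₀ _ (sub_pos.2 hxy).ne']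

theorem sub_le (H : BranchFamily α U φ φ' u c) {p : X} (hp : p ∈ U) {x y : ℝ}
    (hx : 0 ≤ x) (hxy : x ≤ y) (hy : y ≤ 1) : φ p y - φ p x ≤ 2 * (y - x) := by
  rcases hxy.eq_or_lt with rfl | hlt
  · simp
  obtain ⟨ζ, hζ, h⟩ := H.exists_sub_eq hp hx hlt hy
  rw [h]
  exact mul_le_mul_of_nonneg_right (H.le_two p hp ζ ⟨hx.trans hζ.1.le, hζ.2.le.trans hy⟩)
    (by linarith)

theorem half_sub_le (H : BranchFamily α U φ φ' u c) {p : X} (hp : p ∈ U) {x y : ℝ}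
    (hx : 0 ≤ x) (hxy : x ≤ y) (hy : y ≤ 1) : 1 / 2 * (y - x) ≤ φ p y - φ p x := by
  rcases hxy.eq_or_lt with rfl | hlt
  · simp
  obtain ⟨ζ, hζ, h⟩ := H.exists_sub_eq hp hx hlt hy
  rw [h]
  exact mul_le_mul_of_nonneg_right (H.half_le p hp ζ ⟨hx.trans hζ.1.le, hζ.2.le.trans hy⟩)
    (by linarith)

theorem strictMonoOn_phi (H : BranchFamily α U φ φ' u c) {p : X} (hp : p ∈ U) :
    StrictMonoOn (φ p) (Icc 0 1) := fun x hx y hy hxy => by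
  have := H.half_sub_le hp hx.1 hxy.le hy.2
  linarith

theorem powPart_mem (H : BranchFamily α U φ φ' u c) {p : X} (hp : p ∈ U) {x : ℝ}
    (hx : x ∈ Icc 0 (c p)) : powPart α (u p) (c p) x ∈ Icc (0 : ℝ) 1 :=
  _root_.powPart_mem H.one_lt (H.u_mem p hp) (H.c_mem p hp).1 hx

theorem phi_mem (H : BranchFamily α U φ φ' u c) {p : X} (hp : p ∈ U) {x : ℝ}
    (hx : x ∈ Icc (0 : ℝ) 1) : φ p x ∈ Icc (0 : ℝ) 1 := by
  have h0 := H.half_sub_le hp le_rfl hx.1 hx.2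
  have h1 := H.half_sub_le hp hx.1 hx.2 le_rfl
  rw [H.map_zero p hp] at h0
  rw [H.map_one p hp] at h1
  constructor <;> linarith [hx.1, hx.2]

theorem branch_mem (H : BranchFamily α U φ φ' u c) {p : X} (hp : p ∈ U) {x : ℝ}
    (hx : x ∈ Icc 0 (c p)) : branch α (φ p) (u p) (c p) x ∈ Icc (0 : ℝ) 1 :=
  H.phi_mem hp (H.powPart_mem hp hx)

theorem branch_zero (H : BranchFamily α U φ φ' u c) {p : X} (hp : p ∈ U) :
    branch α (φ p) (u p) (c p) 0 = 0 := by
  rw [branch, powPart_zero, H.map_zero p hp]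

theorem branch_self (H : BranchFamily α U φ φ' u c) {p : X} (hp : p ∈ U) :
    branch α (φ p) (u p) (c p) (c p) = φ p (u p) := by
  rw [branch, powPart_self H.one_lt _ (H.c_mem p hp).1]

theorem strictMonoOn_branch (H : BranchFamily α U φ φ' u c) {p : X} (hp : p ∈ U)
    (hu : 0 < u p) : StrictMonoOn (branch α (φ p) (u p) (c p)) (Icc 0 (c p)) :=
  (H.strictMonoOn_phi hp).comp (powPart_strictMonoOn H.one_lt hu (H.c_mem p hp).1)
    fun _ hx => H.powPart_mem hp hx

theorem hasDerivWithinAt_branch (H : BranchFamily α U φ φ' u c) {p : X} (hp : p ∈ U) {x : ℝ}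
    (hx : x ∈ Icc 0 (c p)) : HasDerivWithinAt (branch α (φ p) (u p) (c p))
      (branchDeriv α (φ' p) (u p) (c p) x) (Icc 0 (c p)) x :=
  (H.hasDeriv p hp _ (H.powPart_mem hp hx)).comp x
    (hasDerivAt_powPart H.one_lt _ _ x).hasDerivWithinAt fun _ hy => H.powPart_mem hp hy

theorem continuousOn_branch_one (H : BranchFamily α U φ φ' u c) {p : X} (hp : p ∈ U) :
    ContinuousOn (branch α (φ p) (u p) (c p)) (Icc 0 (c p)) :=
  fun _ hx => (H.hasDerivWithinAt_branch hp hx).continuousWithinAt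

theorem exists_branch_sub_eq (H : BranchFamily α U φ φ' u c) {p : X} (hp : p ∈ U) {x y : ℝ}
    (hx : 0 ≤ x) (hxy : x < y) (hy : y ≤ c p) :
    ∃ ξ ∈ Ioo x y, branch α (φ p) (u p) (c p) y - branch α (φ p) (u p) (c p) x =
      branchDeriv α (φ' p) (u p) (c p) ξ * (y - x) := by
  have hsub : Icc x y ⊆ Icc 0 (c p) := Icc_subset_Icc hx hy
  obtain ⟨ζ, hζ, h⟩ := exists_hasDerivAt_eq_slope (branch α (φ p) (u p) (c p))
    (branchDeriv α (φ' p) (u p) (c p)) hxy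
    ((H.continuousOn_branch_one hp).mono hsub)
    (fun z hz => (H.hasDerivWithinAt_branch hp (hsub (Ioo_subset_Icc_self hz))).hasDerivAt
      (Icc_mem_nhds (hx.trans_lt hz.1) (hz.2.trans_le hy)))
  refine ⟨ζ, hζ, ?_⟩
  rw [h, div_mul_cancel₀ _ (ne_of_gt (sub_pos.2 hxy))]

/-- The common domain of the branches of a family. -/
def dom (U : Set X) (c : X → ℝ) : Set (X × ℝ) := {z | z.1 ∈ U ∧ z.2 ∈ Icc 0 (c z.1)}

theorem isCompact_dom (H : BranchFamily α U φ φ' u c) : IsCompact (dom U c) := by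
  have hK : IsCompact (U ×ˢ Icc (0 : ℝ) 1) := H.isCompact.prod isCompact_Icc
  have hcont : ContinuousOn (fun z : X × ℝ => c z.1 - z.2) (U ×ˢ Icc (0 : ℝ) 1) :=
    (H.cont_c.comp continuousOn_fst fun z hz => hz.1).sub continuousOn_snd
  refine hK.of_isClosed_subset ?_ fun z hz =>
    ⟨hz.1, hz.2.1, hz.2.2.trans (H.c_mem _ hz.1).2.le⟩
  convert hcont.preimage_isClosed_of_isClosed hK.isClosed (isClosed_Ici (a := (0 : ℝ))) using 1
  ext z
  simp only [dom, mem_ofPred_eq, mem_inter_iff, mem_prod, mem_preimage, mem_Ici, mem_Icc, sub_nonneg]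
  exact ⟨fun h => ⟨⟨h.1, h.2.1, h.2.2.trans (H.c_mem _ h.1).2.le⟩, h.2.2⟩,
    fun h => ⟨h.1.1, h.1.2.1, h.2⟩⟩

theorem continuousOn_powPart (H : BranchFamily α U φ φ' u c) :
    ContinuousOn (fun z : X × ℝ => powPart α (u z.1) (c z.1) z.2) (dom U c) := by
  have h1 : ContinuousOn (fun z : X × ℝ => u z.1) (dom U c) :=
    H.cont_u.comp continuousOn_fst fun z hz => hz.1
  have h2 : ContinuousOn (fun z : X × ℝ => c z.1) (dom U c) :=
    H.cont_c.comp continuousOn_fst fun z hz => hz.1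
  have h3 : ContinuousOn (fun z : X × ℝ => 1 - z.2 / c z.1) (dom U c) :=
    continuousOn_const.sub (continuousOn_snd.div h2 fun z hz => (H.c_mem _ hz.1).1.ne')
  exact h1.mul (continuousOn_const.sub
    (h3.rpow_const fun z _ => Or.inr (by linarith [H.one_lt])))

theorem continuousOn_branch (H : BranchFamily α U φ φ' u c) :
    ContinuousOn (fun z : X × ℝ => branch α (φ z.1) (u z.1) (c z.1) z.2) (dom U c) :=
  H.cont_phi.comp (continuousOn_fst.prodMk H.continuousOn_powPart)
    fun _ hz => ⟨hz.1, H.powPart_mem hz.1 hz.2⟩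

theorem continuousOn_branchDeriv (H : BranchFamily α U φ φ' u c) :
    ContinuousOn (fun z : X × ℝ => branchDeriv α (φ' z.1) (u z.1) (c z.1) z.2) (dom U c) := by
  have h0 := H.one_lt
  have h1 : ContinuousOn (fun z : X × ℝ => u z.1) (dom U c) :=
    H.cont_u.comp continuousOn_fst fun z hz => hz.1
  have h2 : ContinuousOn (fun z : X × ℝ => c z.1) (dom U c) :=
    H.cont_c.comp continuousOn_fst fun z hz => hz.1
  have h3 : ContinuousOn (fun z : X × ℝ => 1 - z.2 / c z.1) (dom U c) :=
    continuousOn_const.sub (continuousOn_snd.div h2 fun z hz => (H.c_mem _ hz.1).1.ne')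
  exact (H.cont_dphi.comp (continuousOn_fst.prodMk H.continuousOn_powPart)
    fun _ hz => ⟨hz.1, H.powPart_mem hz.1 hz.2⟩).mul (h1.mul ((continuousOn_const.mul
      (h3.rpow_const fun z _ => Or.inr (by linarith))).div h2 fun z hz => (H.c_mem _ hz.1).1.ne'))

theorem tendsto_dom {ι : Type*} {𝓕 : Filter ι} {p : ι → X} {x : ι → ℝ} {q : X} {y : ℝ}
    (hp : Tendsto p 𝓕 (𝓝 q)) (hx : Tendsto x 𝓕 (𝓝 y)) (hpU : ∀ᶠ t in 𝓕, p t ∈ U)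
    (hxc : ∀ᶠ t in 𝓕, x t ∈ Icc 0 (c (p t))) :
    Tendsto (fun t => (p t, x t)) 𝓕 (𝓝[dom U c] (q, y)) :=
  tendsto_nhdsWithin_iff.2 ⟨hp.prodMk_nhds hx, hpU.and hxc⟩

/-- The graph is above the diagonal at the critical point and cannot cross it, for lack of interior
fixed points. -/
theorem lt_branch (H : BranchFamily α U φ φ' u c) {p : X} (hp : p ∈ U)
    (hval : c p < φ p (u p)) {x : ℝ} (hx : x ∈ Ioc 0 (c p)) :
    x < branch α (φ p) (u p) (c p) x := by
  rcases hx.2.eq_or_lt with rfl | hlt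
  · rwa [H.branch_self hp]
  by_contra! hle
  have hcont : ContinuousOn (fun y => branch α (φ p) (u p) (c p) y - y) (Icc x (c p)) :=
    ((H.continuousOn_branch_one hp).mono (Icc_subset_Icc_left hx.1.le)).sub continuousOn_id
  obtain ⟨y, hy, hy0⟩ := intermediate_value_Icc hx.2 hcont
    (show (0 : ℝ) ∈ Icc _ _ from ⟨by linarith, by rw [H.branch_self hp]; linarith⟩)
  have hyc : y ≠ c p := by
    rintro rfl
    simp only [H.branch_self hp] at hy0
    linarith
  exact H.not_fixed p hp y ⟨hx.1.trans_le hy.1, lt_of_le_of_ne hy.2 hyc⟩ (by linarith)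

/-- Long orbits in the branches start near the fixed point `0`, uniformly in the family. -/
theorem exists_forall_lt_of_iterate_mem (H : BranchFamily α U φ φ' u c) {s δ : ℝ} (hs : 0 < s)
    (hδ : 0 < δ) : ∃ N : ℕ, ∀ p ∈ U, c p + s ≤ φ p (u p) → ∀ n ≥ N, ∀ x : ℝ,
      (∀ i < n, (branch α (φ p) (u p) (c p))^[i] x ∈ Icc 0 (c p)) → x < δ := by
  have hval : ContinuousOn (fun z : X × ℝ => φ z.1 (u z.1)) (dom U c) :=
    H.cont_phi.comp (continuousOn_fst.prodMk
      (H.cont_u.comp continuousOn_fst fun z hz => hz.1)) fun z hz => ⟨hz.1, H.u_mem _ hz.1⟩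
  have hK : IsCompact (dom U c ∩ (fun z : X × ℝ => (φ z.1 (u z.1) - c z.1, z.2)) ⁻¹'
      (Ici s ×ˢ Ici δ)) := by
    refine H.isCompact_dom.of_isClosed_subset ?_ inter_subset_left
    exact ((hval.sub (H.cont_c.comp continuousOn_fst fun z hz => hz.1)).prodMk
      continuousOn_snd).preimage_isClosed_of_isClosed H.isCompact_dom.isClosed
      (isClosed_Ici.prod isClosed_Ici)
  -- By compactness an orbit point beyond δ moves up by at least η at each step, uniformly in p.
  -- More than 1 / η such steps would leave [0, 1].
  obtain ⟨η, hη, hlow⟩ : ∃ η : ℝ, 0 < η ∧ ∀ z ∈ dom U c ∩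
      (fun z : X × ℝ => (φ z.1 (u z.1) - c z.1, z.2)) ⁻¹' (Ici s ×ˢ Ici δ),
      η ≤ branch α (φ z.1) (u z.1) (c z.1) z.2 - z.2 := by
    rcases (dom U c ∩ (fun z : X × ℝ => (φ z.1 (u z.1) - c z.1, z.2)) ⁻¹'
      (Ici s ×ˢ Ici δ)).eq_empty_or_nonempty with he | hne
    · exact ⟨1, one_pos, fun z hz => by rw [he] at hz; exact hz.elim⟩
    · obtain ⟨z, ⟨hz, hz1, hz2⟩, hmin⟩ := hK.exists_isMinOn hne
        ((H.continuousOn_branch.sub continuousOn_snd).mono inter_subset_left)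
      refine ⟨_, sub_pos.2 (H.lt_branch hz.1 ?_ ⟨hδ.trans_le hz2, hz.2.2⟩), fun w hw => hmin hw⟩
      have : s ≤ φ z.1 (u z.1) - c z.1 := hz1
      linarith
  obtain ⟨m, hm⟩ := exists_nat_gt (1 / η)
  refine ⟨m + 1, fun p hp hps n hn x hx => ?_⟩
  by_contra! hδx
  have hgrow : ∀ i ≤ m, x + i * η ≤ (branch α (φ p) (u p) (c p))^[i] x := by
    intro i
    induction i with
    | zero => simp
    | succ i ih =>
      intro hi
      have h1 := ih (by omega)
      have h2 := hx i (by omega)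
      have h3 := hlow (p, (branch α (φ p) (u p) (c p))^[i] x) ⟨⟨hp, h2⟩,
        (by simpa using by linarith : s ≤ φ p (u p) - c p), by
          have : 0 ≤ (i : ℝ) * η := by positivity
          exact (by linarith : δ ≤ (branch α (φ p) (u p) (c p))^[i] x)⟩
      rw [Function.iterate_succ_apply']
      push_cast
      simp only at h3
      linarith
  have h1 := hgrow m le_rfl
  have h2 := (hx m (by omega)).2
  have h3 := (H.c_mem p hp).2
  rw [div_lt_iff₀ hη] at hm
  linarith

/-- Near a parameter with onto branch the branches expand distances from `0` uniformly. -/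
theorem exists_eventually_le_mul_branch (H : BranchFamily α U φ φ' u c) {q : X} (hq : q ∈ U)
    (hu : u q = 1) (hl : 1 < branchDeriv α (φ' q) (u q) (c q) 0) :
    ∃ ρ : ℝ, 0 < ρ ∧ ρ < 1 ∧ ∀ᶠ p in 𝓝[U] q, ∀ x ∈ Icc 0 (c p),
      x ≤ ρ * branch α (φ p) (u p) (c p) x := by
  obtain ⟨τ, hτ1, hτ⟩ := exists_between hl
  have hcq := H.c_mem q hq
  have hmem0 : (q, (0 : ℝ)) ∈ dom U c := ⟨hq, le_rfl, hcq.1.le⟩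
  have hev : ∀ᶠ z in 𝓝[dom U c] (q, (0 : ℝ)),
      τ < branchDeriv α (φ' z.1) (u z.1) (c z.1) z.2 :=
    (H.continuousOn_branchDeriv _ hmem0).eventually (lt_mem_nhds hτ)
  obtain ⟨r, hr, hball⟩ := Metric.mem_nhdsWithin_iff.1 hev
  have hsmall : ∀ p ∈ U, dist p q < r → ∀ x ∈ Icc 0 (c p), x < r →
      τ * x ≤ branch α (φ p) (u p) (c p) x := by
    intro p hp hpr x hx hxr
    rcases hx.1.eq_or_lt with rfl | hx0
    · rw [H.branch_zero hp, mul_zero]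
    obtain ⟨ξ, hξ, h⟩ := H.exists_branch_sub_eq hp le_rfl hx0 hx.2
    rw [H.branch_zero hp, sub_zero, sub_zero] at h
    rw [h]
    have : (p, ξ) ∈ Metric.ball (q, (0 : ℝ)) r ∩ dom U c := by
      refine ⟨?_, hp, hξ.1.le, hξ.2.le.trans hx.2⟩
      rw [Metric.mem_ball, Prod.dist_eq, Real.dist_eq, sub_zero, abs_of_pos hξ.1]
      exact max_lt hpr (hξ.2.trans hxr)
    have h2 : τ < branchDeriv α (φ' p) (u p) (c p) ξ := hball this
    gcongr
  -- Near 0 expansion comes from the derivative, away from 0 from compactness: the branch of q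
  -- exceeds the identity by more than η there, and the parameters where this fails form the
  -- projection of a compact set missing q.
  set K := dom U c ∩ (fun z : X × ℝ => z.2) ⁻¹' (Ici (r / 2))
  have hK : IsCompact K := H.isCompact_dom.inter_right (isClosed_Ici.preimage continuous_snd)
  have hval : c q < φ q (u q) := by rw [hu, H.map_one q hq]; exact hcq.2
  obtain ⟨η, hη, hlow⟩ : ∃ η : ℝ, 0 < η ∧ ∀ x ∈ Icc (r / 2) (c q),
      η < branch α (φ q) (u q) (c q) x - x := by
    rcases (Icc (r / 2) (c q)).eq_empty_or_nonempty with he | hne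
    · exact ⟨1, one_pos, fun x hx => by simp [he] at hx⟩
    · have hsub : Icc (r / 2) (c q) ⊆ Icc 0 (c q) := Icc_subset_Icc_left (by positivity)
      obtain ⟨x, hx, hmin⟩ := isCompact_Icc.exists_isMinOn hne
        (((H.continuousOn_branch_one hq).mono hsub).sub continuousOn_id)
      have hpos := sub_pos.2 (H.lt_branch hq hval ⟨(by positivity : 0 < r / 2).trans_le hx.1, hx.2⟩)
      refine ⟨(branch α (φ q) (u q) (c q) x - x) / 2, by linarith, fun y hy => ?_⟩
      have := hmin hy
      simp only [mem_ofPred_eq, Pi.sub_apply, id] at this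
      linarith
  have hbad : IsCompact (K ∩ (fun z : X × ℝ => branch α (φ z.1) (u z.1) (c z.1) z.2 - z.2) ⁻¹'
      (Iic η)) := by
    refine hK.of_isClosed_subset ?_ inter_subset_left
    exact ((H.continuousOn_branch.sub continuousOn_snd).mono
      inter_subset_left).preimage_isClosed_of_isClosed hK.isClosed isClosed_Iic
  have hproj := (hbad.image continuous_fst).isClosed.isOpen_compl.mem_nhds
    (show q ∈ _ by
      rintro ⟨⟨p, x⟩, ⟨⟨hz, hz1⟩, hz2⟩, rfl⟩
      exact absurd (hlow x ⟨hz1, hz.2.2⟩) (not_lt.2 hz2))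
  -- Away from 0, x ≤ 1 gives (1 + η) x ≤ x + η, which is at most the branch value.
  refine ⟨max (1 / τ) (1 / (1 + η)), by positivity, ?_, ?_⟩
  · rw [max_lt_iff, div_lt_one (by linarith), div_lt_one (by linarith)]
    exact ⟨hτ1, by linarith⟩
  filter_upwards [mem_nhdsWithin_of_mem_nhds hproj, self_mem_nhdsWithin,
    mem_nhdsWithin_of_mem_nhds (Metric.ball_mem_nhds q hr)] with p hp1 hpU hpr x hx
  have hB := (H.branch_mem hpU hx).1
  rcases lt_or_ge x r with hxr | hxr
  · have h1 := hsmall p hpU hpr x hx hxr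
    calc x ≤ 1 / τ * branch α (φ p) (u p) (c p) x := by
          rw [div_mul_eq_mul_div, one_mul, le_div_iff₀ (by linarith)]; linarith
      _ ≤ _ := by gcongr; exact le_max_left _ _
  · have h2 : η < branch α (φ p) (u p) (c p) x - x := by
      by_contra! hle
      exact hp1 ⟨(p, x), ⟨⟨⟨hpU, hx⟩, (by linarith : r / 2 ≤ x)⟩, hle⟩, rfl⟩
    have hx1 : x ≤ 1 := hx.2.trans (H.c_mem p hpU).2.le
    calc x ≤ 1 / (1 + η) * branch α (φ p) (u p) (c p) x := by
          rw [div_mul_eq_mul_div, one_mul, le_div_iff₀ (by linarith)]; nlinarith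
      _ ≤ _ := by gcongr; exact le_max_right _ _

/-- Read the orbit backwards: the last iterate is at most 1, and every step back contracts by ρ. -/
theorem exists_eventually_iterate_le_pow (H : BranchFamily α U φ φ' u c) {q : X} (hq : q ∈ U)
    (hu : u q = 1) (hl : 1 < branchDeriv α (φ' q) (u q) (c q) 0) :
    ∃ ρ : ℝ, 0 < ρ ∧ ρ < 1 ∧ ∀ᶠ p in 𝓝[U] q, ∀ (n : ℕ) (x : ℝ), 1 ≤ n →
      (∀ i < n, (branch α (φ p) (u p) (c p))^[i] x ∈ Icc 0 (c p)) →
      ∀ k ≤ n, (branch α (φ p) (u p) (c p))^[n - k] x ≤ ρ ^ k := by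
  obtain ⟨ρ, hρ0, hρ1, hρ⟩ := H.exists_eventually_le_mul_branch hq hu hl
  refine ⟨ρ, hρ0, hρ1, ?_⟩
  filter_upwards [hρ, self_mem_nhdsWithin] with p hp hpU n x hn hx k
  induction k with
  | zero =>
    intro _
    obtain ⟨m, rfl⟩ := Nat.exists_eq_add_of_le' hn
    rw [Nat.sub_zero, Function.iterate_succ_apply', pow_zero]
    exact (H.branch_mem hpU (hx m (by omega))).2
  | succ k ih =>
    intro hk
    have h1 := hp _ (hx (n - (k + 1)) (by omega))
    rw [← Function.iterate_succ_apply' (branch α (φ p) (u p) (c p)), Nat.succ_eq_add_one,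
      show n - (k + 1) + 1 = n - k by omega] at h1
    rw [pow_succ']
    exact h1.trans (mul_le_mul_of_nonneg_left (ih (by omega)) hρ0.le)

end BranchFamily

end

/-! ### Distortion of long compositions of branches -/

section

namespace BranchFamily

variable {X : Type*} [MetricSpace X] {α : ℝ} {U : Set X} {φ φ' : X → ℝ → ℝ} {u c : X → ℝ}

theorem branchDeriv_pos (H : BranchFamily α U φ φ' u c) {p : X} (hp : p ∈ U) (hu : 0 < u p)
    {x : ℝ} (hx : x ∈ Ico 0 (c p)) : 0 < branchDeriv α (φ' p) (u p) (c p) x := by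
  have hc := (H.c_mem p hp).1
  have h1 := H.half_le p hp _ (H.powPart_mem hp ⟨hx.1, hx.2.le⟩)
  have h2 : 0 < 1 - x / c p := by rw [sub_pos, div_lt_one hc]; exact hx.2
  have h3 : 0 < (1 - x / c p) ^ (α - 1) := Real.rpow_pos_of_pos h2 _
  have h4 : 0 < α := by linarith [H.one_lt]
  have h5 : 0 < φ' p (powPart α (u p) (c p) x) := by linarith
  unfold branchDeriv
  positivity

theorem abs_log_sub_log_le {a b : ℝ} (ha : 1 / 2 ≤ a) (hb : 1 / 2 ≤ b) :
    |Real.log a - Real.log b| ≤ 2 * |a - b| := by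
  have key : ∀ a b : ℝ, 1 / 2 ≤ a → 1 / 2 ≤ b → Real.log a - Real.log b ≤ 2 * |a - b| := by
    intro a b ha hb
    have hb0 : 0 < b := by linarith
    have ha0 : 0 < a := by linarith
    rw [← Real.log_div ha0.ne' hb0.ne']
    refine (Real.log_le_sub_one_of_pos (div_pos ha0 hb0)).trans ?_
    rw [div_sub_one hb0.ne', div_le_iff₀ hb0]
    nlinarith [le_abs_self (a - b), abs_nonneg (a - b)]
  refine abs_le.2 ⟨?_, key a b ha hb⟩
  have := key b a hb ha
  rw [abs_sub_comm] at this
  linarith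

theorem tendsto_nhdsWithin_c (H : BranchFamily α U φ φ' u c) {q : X} (hq : q ∈ U) :
    Tendsto c (𝓝[U] q) (𝓝 (c q)) := H.cont_c q hq

theorem eventually_u_pos (H : BranchFamily α U φ φ' u c) {q : X} (hq : q ∈ U) (hu : u q = 1) :
    ∀ᶠ p in 𝓝[U] q, 0 < u p :=
  (H.cont_u q hq).eventually (lt_mem_nhds (by rw [hu]; exact one_pos))

/-- Uniform distortion estimate for the branches near their fixed point `0`. -/
theorem exists_eventually_abs_log_branchDeriv_sub_le (H : BranchFamily α U φ φ' u c) {q : X}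
    (hq : q ∈ U) (hu : u q = 1) {s : ℝ} (hs0 : 0 < s) (hs : s < c q) :
    ∃ C : ℝ, 0 ≤ C ∧ ∀ᶠ p in 𝓝[U] q, ∀ x ∈ Icc 0 s,
      |Real.log (branchDeriv α (φ' p) (u p) (c p) x) -
        Real.log (branchDeriv α (φ' p) (u p) (c p) 0)| ≤ C * x := by
  obtain ⟨s', hss', hs'⟩ := exists_between hs
  have hα := H.one_lt
  have hs'0 : 0 < s' := hs0.trans hss'
  -- The first summand bounds the variation of log φ', the second that of the logarithm of (1 - x /
  -- c) ^ (α - 1). The point s' keeps c p away from s for p near q.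
  refine ⟨2 * α / s' + (α - 1) / (s' - s), ?_, ?_⟩
  · have : 0 < s' - s := by linarith
    have : 0 < α - 1 := by linarith
    positivity
  filter_upwards [H.eventually_u_pos hq hu, self_mem_nhdsWithin,
    (H.tendsto_nhdsWithin_c hq).eventually (lt_mem_nhds hs')] with p hup hpU hcp x hx
  have hc := (H.c_mem p hpU).1
  have hxc : x ∈ Icc 0 (c p) := ⟨hx.1, by linarith [hx.2]⟩
  have hxlt : x < c p := by linarith [hx.2]
  have hz := H.powPart_mem hpU hxc
  have h1 := H.half_le p hpU _ hz
  have h10 := H.half_le p hpU 0 (by simp)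
  have hw : 0 < 1 - x / c p := by rw [sub_pos, div_lt_one hc]; exact hxlt
  have hform : ∀ y ∈ Ico 0 (c p), Real.log (branchDeriv α (φ' p) (u p) (c p) y) =
      Real.log (φ' p (powPart α (u p) (c p) y)) + (α - 1) * Real.log (1 - y / c p) +
        Real.log (u p * (α / c p)) := by
    intro y hy
    have hwy : 0 < 1 - y / c p := by rw [sub_pos, div_lt_one hc]; exact hy.2
    have h1 := H.half_le p hpU _ (H.powPart_mem hpU ⟨hy.1, hy.2.le⟩)
    have e : branchDeriv α (φ' p) (u p) (c p) y = φ' p (powPart α (u p) (c p) y) *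
        (1 - y / c p) ^ (α - 1) * (u p * (α / c p)) := by
      unfold branchDeriv; ring
    rw [e, Real.log_mul, Real.log_mul, Real.log_rpow hwy]
    · linarith
    · exact (Real.rpow_pos_of_pos hwy _).ne'
    · exact mul_ne_zero (by linarith) (Real.rpow_pos_of_pos hwy _).ne'
    · exact (mul_pos hup (div_pos (by linarith) hc)).ne'
  rw [hform x ⟨hx.1, hxlt⟩, hform 0 ⟨le_rfl, hc⟩, powPart_zero, zero_div, sub_zero, Real.log_one,
    mul_zero, add_zero, add_sub_add_right_eq_sub, add_sub_right_comm]
  refine (abs_add_le _ _).trans ?_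
  rw [add_mul]
  have hxs' : x / c p ≤ x / s' := div_le_div_of_nonneg_left hx.1 hs'0 hcp.le
  refine add_le_add ?_ ?_
  · refine (abs_log_sub_log_le h1 h10).trans ?_
    have h3 := H.abs_sub_le p hpU _ hz
    have h4 := powPart_le hα (H.u_mem p hpU) hc hxc
    calc _ ≤ 2 * (α * (x / s')) := by
          have : α * (x / c p) ≤ α * (x / s') := by gcongr
          linarith
      _ = _ := by ring
  · have hlog0 : Real.log (1 - x / c p) ≤ 0 :=
      Real.log_nonpos hw.le (by linarith [div_nonneg hx.1 hc.le])
    rw [abs_mul, abs_of_pos (by linarith : 0 < α - 1), abs_of_nonpos hlog0, ← Real.log_inv]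
    have h5 : Real.log (1 - x / c p)⁻¹ ≤ (1 - x / c p)⁻¹ - 1 :=
      Real.log_le_sub_one_of_pos (inv_pos.2 hw)
    have h6 : (1 - x / c p)⁻¹ - 1 = x / (c p - x) := by
      have : c p - x ≠ 0 := by linarith
      have h' : 1 - x / c p = (c p - x) / c p := by field_simp
      rw [h', inv_div]
      field_simp
      ring
    have h7 : x / (c p - x) ≤ x / (s' - s) :=
      div_le_div_of_nonneg_left hx.1 (by linarith) (by linarith [hx.2])
    calc (α - 1) * Real.log (1 - x / c p)⁻¹ ≤ (α - 1) * (x / (s' - s)) :=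
          mul_le_mul_of_nonneg_left (by linarith) (by linarith)
      _ = _ := by ring

theorem tendsto_branch {ι : Type*} {𝓕 : Filter ι} (H : BranchFamily α U φ φ' u c) {q : X}
    (hq : q ∈ U) {p : ι → X} (hp : Tendsto p 𝓕 (𝓝[U] q)) {x : ι → ℝ} {y : ℝ}
    (hx : Tendsto x 𝓕 (𝓝 y)) (hxc : ∀ᶠ t in 𝓕, x t ∈ Icc 0 (c (p t))) (hy : y ∈ Icc 0 (c q)) :
    Tendsto (fun t => branch α (φ (p t)) (u (p t)) (c (p t)) (x t)) 𝓕
      (𝓝 (branch α (φ q) (u q) (c q) y)) :=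
  (H.continuousOn_branch (q, y) ⟨hq, hy⟩).tendsto.comp (tendsto_dom
    (tendsto_nhdsWithin_iff.1 hp).1 hx (tendsto_nhdsWithin_iff.1 hp).2 hxc)

theorem tendsto_branchDeriv {ι : Type*} {𝓕 : Filter ι} (H : BranchFamily α U φ φ' u c) {q : X}
    (hq : q ∈ U) {p : ι → X} (hp : Tendsto p 𝓕 (𝓝[U] q)) {x : ι → ℝ} {y : ℝ}
    (hx : Tendsto x 𝓕 (𝓝 y)) (hxc : ∀ᶠ t in 𝓕, x t ∈ Icc 0 (c (p t))) (hy : y ∈ Icc 0 (c q)) :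
    Tendsto (fun t => branchDeriv α (φ' (p t)) (u (p t)) (c (p t)) (x t)) 𝓕
      (𝓝 (branchDeriv α (φ' q) (u q) (c q) y)) :=
  (H.continuousOn_branchDeriv (q, y) ⟨hq, hy⟩).tendsto.comp (tendsto_dom
    (tendsto_nhdsWithin_iff.1 hp).1 hx (tendsto_nhdsWithin_iff.1 hp).2 hxc)

/-- The inverse branches depend continuously on the parameter. -/
theorem tendsto_of_tendsto_branch {ι : Type*} {𝓕 : Filter ι} (H : BranchFamily α U φ φ' u c)
    {q : X} (hq : q ∈ U) (hu : u q = 1) {p : ι → X} (hp : Tendsto p 𝓕 (𝓝[U] q)) {x : ι → ℝ} {y : ℝ}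
    (hxc : ∀ᶠ t in 𝓕, x t ∈ Icc 0 (c (p t))) (hy : y ∈ Ioo 0 (c q))
    (hB : Tendsto (fun t => branch α (φ (p t)) (u (p t)) (c (p t)) (x t)) 𝓕
      (𝓝 (branch α (φ q) (u q) (c q) y))) : Tendsto x 𝓕 (𝓝 y) := by
  have hmono := H.strictMonoOn_branch hq (by rw [hu]; exact one_pos)
  have hpU := (tendsto_nhdsWithin_iff.1 hp).2
  have hup := hp.eventually (H.eventually_u_pos hq hu)
  have hconst : ∀ a ∈ Ioo 0 (c q), (∀ᶠ t in 𝓕, a ∈ Icc 0 (c (p t))) ∧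
      Tendsto (fun t => branch α (φ (p t)) (u (p t)) (c (p t)) a) 𝓕
        (𝓝 (branch α (φ q) (u q) (c q) a)) := by
    intro a ha
    have hmem : ∀ᶠ t in 𝓕, a ∈ Icc 0 (c (p t)) := by
      filter_upwards [hp.eventually ((H.tendsto_nhdsWithin_c hq).eventually (lt_mem_nhds ha.2))]
        with t ht using ⟨ha.1.le, ht.le⟩
    exact ⟨hmem, H.tendsto_branch hq hp tendsto_const_nhds hmem ⟨ha.1.le, ha.2.le⟩⟩
  refine tendsto_order.2 ⟨fun a ha => ?_, fun b hb => ?_⟩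
  -- The comparison point is moved inside the domain, where monotonicity of the nearby branches can
  -- be used.
  · have ha' : max a (y / 2) ∈ Ioo 0 (c q) :=
      ⟨lt_max_of_lt_right (by linarith [hy.1]), max_lt (ha.trans hy.2) (by linarith [hy.1, hy.2])⟩
    have hlt : max a (y / 2) < y := max_lt ha (by linarith [hy.1])
    obtain ⟨hmem, ht⟩ := hconst _ ha'
    filter_upwards [ht.eventually_lt hB (hmono ⟨ha'.1.le, ha'.2.le⟩ ⟨hy.1.le, hy.2.le⟩ hlt),
      hmem, hxc, hup, hpU] with t h1 h2 h3 h4 h5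
    exact (le_max_left _ _).trans_lt (((H.strictMonoOn_branch h5 h4).lt_iff_lt h2 h3).1 h1)
  · have hb' : min b ((y + c q) / 2) ∈ Ioo 0 (c q) :=
      ⟨lt_min (hy.1.trans hb) (by linarith [hy.1, hy.2]),
        min_lt_of_right_lt (by linarith [hy.1, hy.2])⟩
    have hlt : y < min b ((y + c q) / 2) := lt_min hb (by linarith [hy.2])
    obtain ⟨hmem, ht⟩ := hconst _ hb'
    filter_upwards [hB.eventually_lt ht (hmono ⟨hy.1.le, hy.2.le⟩ ⟨hb'.1.le, hb'.2.le⟩ hlt),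
      hmem, hxc, hup, hpU] with t h1 h2 h3 h4 h5
    exact (((H.strictMonoOn_branch h5 h4).lt_iff_lt h3 h2).1 h1).trans_le (min_le_left _ _)

theorem exists_branch_eq (H : BranchFamily α U φ φ' u c) {q : X} (hq : q ∈ U) (hu : u q = 1)
    {y : ℝ} (hy : y ∈ Ioo (0 : ℝ) 1) :
    ∃ x ∈ Ioo 0 (c q), branch α (φ q) (u q) (c q) x = y := by
  have h1 : branch α (φ q) (u q) (c q) (c q) = 1 := by
    rw [H.branch_self hq, hu, H.map_one q hq]
  obtain ⟨x, hx, hxy⟩ := intermediate_value_Ioo (H.c_mem q hq).1.le (H.continuousOn_branch_one hq)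
    (show y ∈ Ioo _ _ by rw [H.branch_zero hq, h1]; exact hy)
  exact ⟨x, hx, hxy⟩

/-- The backward orbit of the critical point under an onto branch. -/
theorem exists_backward_orbit (H : BranchFamily α U φ φ' u c) {q : X} (hq : q ∈ U)
    (hu : u q = 1) : ∃ w : ℕ → ℝ, w 0 = c q ∧ ∀ k, w (k + 1) ∈ Ioo 0 (c q) ∧
      branch α (φ q) (u q) (c q) (w (k + 1)) = w k := by
  have hex : ∀ y : ℝ, ∃ x, y ∈ Ioo (0 : ℝ) 1 →
      x ∈ Ioo 0 (c q) ∧ branch α (φ q) (u q) (c q) x = y := fun y => by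
    by_cases hy : y ∈ Ioo (0 : ℝ) 1
    · obtain ⟨x, hx⟩ := H.exists_branch_eq hq hu hy
      exact ⟨x, fun _ => hx⟩
    · exact ⟨0, fun h => absurd h hy⟩
  choose b hb using hex
  have hw : ∀ k, b^[k] (c q) ∈ Ioo (0 : ℝ) 1 := fun k => by
    induction k with
    | zero => exact H.c_mem q hq
    | succ k ih =>
      rw [Function.iterate_succ_apply']
      exact ⟨(hb _ ih).1.1, (hb _ ih).1.2.trans (H.c_mem q hq).2⟩
  refine ⟨fun k => b^[k] (c q), rfl, fun k => ?_⟩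
  simp only [Function.iterate_succ_apply']
  exact hb _ (hw k)

/-- The last iterate tends to the critical point by hypothesis; continuity of the inverse branches
passes this to each earlier iterate at a fixed distance from the end. -/
theorem tendsto_iterate_sub {ι : Type*} {𝓕 : Filter ι} (H : BranchFamily α U φ φ' u c)
    {q : X} (hq : q ∈ U) (hu : u q = 1) {p : ι → X} (hp : Tendsto p 𝓕 (𝓝[U] q)) {n : ι → ℕ}
    (hn : Tendsto n 𝓕 atTop) {x : ι → ℝ}
    (hx : ∀ᶠ t in 𝓕, ∀ i < n t, (branch α (φ (p t)) (u (p t)) (c (p t)))^[i] (x t) ∈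
      Icc 0 (c (p t)))
    (hlim : Tendsto (fun t => (branch α (φ (p t)) (u (p t)) (c (p t)))^[n t] (x t)) 𝓕 (𝓝 (c q)))
    {w : ℕ → ℝ} (hw0 : w 0 = c q) (hw : ∀ k, w (k + 1) ∈ Ioo 0 (c q) ∧
      branch α (φ q) (u q) (c q) (w (k + 1)) = w k) (k : ℕ) :
    Tendsto (fun t => (branch α (φ (p t)) (u (p t)) (c (p t)))^[n t - k] (x t)) 𝓕 (𝓝 (w k)) := by
  induction k with
  | zero => simpa [hw0] using hlim
  | succ k ih =>
    have hk := hn.eventually (eventually_ge_atTop (k + 1))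
    refine H.tendsto_of_tendsto_branch hq hu hp ?_ (hw k).1 ?_
    · filter_upwards [hk, hx] with t h1 h2 using h2 _ (by omega)
    · rw [(hw k).2]
      refine ih.congr' ?_
      filter_upwards [hk] with t ht
      rw [← Function.iterate_succ_apply' (branch α (φ (p t)) (u (p t)) (c (p t))),
        Nat.succ_eq_add_one, show n t - (k + 1) + 1 = n t - k by omega]

/-- The mean value theorem at each step turns the ratio of final and initial lengths into a product
of derivatives. -/
theorem exists_log_iterate_sub_eq (H : BranchFamily α U φ φ' u c) {p : X} (hp : p ∈ U)
    (hu : 0 < u p) {x y : ℝ} (hxy : x < y) (n : ℕ)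
    (hx : ∀ i < n, (branch α (φ p) (u p) (c p))^[i] x ∈ Icc 0 (c p))
    (hy : ∀ i < n, (branch α (φ p) (u p) (c p))^[i] y ∈ Icc 0 (c p)) :
    ∃ ξ : ℕ → ℝ, (∀ i < n, ξ i ∈ Ioo ((branch α (φ p) (u p) (c p))^[i] x)
        ((branch α (φ p) (u p) (c p))^[i] y)) ∧
      (branch α (φ p) (u p) (c p))^[n] x < (branch α (φ p) (u p) (c p))^[n] y ∧
      Real.log ((branch α (φ p) (u p) (c p))^[n] y - (branch α (φ p) (u p) (c p))^[n] x) =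
        Real.log (y - x) +
          ∑ i ∈ Finset.range n, Real.log (branchDeriv α (φ' p) (u p) (c p) (ξ i)) := by
  set B := branch α (φ p) (u p) (c p)
  have hlt : ∀ i ≤ n, B^[i] x < B^[i] y := fun i => by
    induction i with
    | zero => exact fun _ => hxy
    | succ i ih =>
      intro hi
      rw [Function.iterate_succ_apply', Function.iterate_succ_apply']
      exact H.strictMonoOn_branch hp hu (hx i (by omega)) (hy i (by omega)) (ih (by omega))
  have hex : ∀ i, ∃ ξ, i < n → ξ ∈ Ioo (B^[i] x) (B^[i] y) ∧
      B^[i + 1] y - B^[i + 1] x = branchDeriv α (φ' p) (u p) (c p) ξ * (B^[i] y - B^[i] x) :=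
    fun i => by
      by_cases hi : i < n
      · obtain ⟨ξ, h1, h2⟩ := H.exists_branch_sub_eq hp (hx i hi).1 (hlt i hi.le) (hy i hi).2
        refine ⟨ξ, fun _ => ⟨h1, ?_⟩⟩
        rw [Function.iterate_succ_apply', Function.iterate_succ_apply']
        exact h2
      · exact ⟨0, fun h => absurd h hi⟩
  choose ξ hξ using hex
  refine ⟨ξ, fun i hi => (hξ i hi).1, hlt n le_rfl, ?_⟩
  have hsum : ∀ m ≤ n, Real.log (B^[m] y - B^[m] x) = Real.log (y - x) +
      ∑ i ∈ Finset.range m, Real.log (branchDeriv α (φ' p) (u p) (c p) (ξ i)) := fun m => by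
    induction m with
    | zero => simp
    | succ m ih =>
      intro hm
      have h1 := (hξ m hm).1
      have hpos := H.branchDeriv_pos hp hu (x := ξ m)
        ⟨(hx m hm).1.trans h1.1.le, h1.2.trans_le (hy m hm).2⟩
      rw [(hξ m hm).2, Real.log_mul hpos.ne' (sub_pos.2 (hlt m (by omega))).ne',
        ih (by omega), Finset.sum_range_succ]
      ring
  exact hsum n le_rfl

/-- Asymptotics of the distortion of long compositions of branches that end near the critical
point: up to the power of the multiplier of the fixed point `0` there is a limit. -/
theorem exists_tendsto_log_iterate_sub {ι : Type*} {𝓕 : Filter ι}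
    (H : BranchFamily α U φ φ' u c) {q : X} (hq : q ∈ U) (hu : u q = 1)
    (hl : 1 < branchDeriv α (φ' q) (u q) (c q) 0) {p : ι → X} (hp : Tendsto p 𝓕 (𝓝[U] q))
    {n : ι → ℕ} (hn : Tendsto n 𝓕 atTop) {x y : ι → ℝ} (hxy : ∀ᶠ t in 𝓕, x t < y t)
    (hx : ∀ᶠ t in 𝓕, ∀ i < n t, (branch α (φ (p t)) (u (p t)) (c (p t)))^[i] (x t) ∈
      Icc 0 (c (p t)))
    (hy : ∀ᶠ t in 𝓕, ∀ i < n t, (branch α (φ (p t)) (u (p t)) (c (p t)))^[i] (y t) ∈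
      Icc 0 (c (p t)))
    (hxlim : Tendsto (fun t => (branch α (φ (p t)) (u (p t)) (c (p t)))^[n t] (x t)) 𝓕 (𝓝 (c q)))
    (hylim : Tendsto (fun t => (branch α (φ (p t)) (u (p t)) (c (p t)))^[n t] (y t)) 𝓕
      (𝓝 (c q))) :
    ∃ κ : ℝ, Tendsto (fun t => Real.log ((branch α (φ (p t)) (u (p t)) (c (p t)))^[n t] (y t) -
        (branch α (φ (p t)) (u (p t)) (c (p t)))^[n t] (x t)) - Real.log (y t - x t) -
        n t * Real.log (branchDeriv α (φ' (p t)) (u (p t)) (c (p t)) 0)) 𝓕 (𝓝 κ) := by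
  obtain ⟨w, hw0, hw⟩ := H.exists_backward_orbit hq hu
  have hwx := H.tendsto_iterate_sub hq hu hp hn hx hxlim hw0 hw
  have hwy := H.tendsto_iterate_sub hq hu hp hn hy hylim hw0 hw
  obtain ⟨ρ, hρ0, hρ1, hρ⟩ := H.exists_eventually_iterate_le_pow hq hu hl
  obtain ⟨ρ', -, hρ1', hρ'⟩ := H.exists_eventually_le_mul_branch hq hu hl
  -- The iterate before the last tends to w 1 < s and orbits increase, so eventually all mean value
  -- points lie in [0, s], away from the critical point, where the derivative degenerates.
  obtain ⟨s, hws, hs⟩ := exists_between (hw 0).1.2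
  obtain ⟨C, hC, hdist⟩ := H.exists_eventually_abs_log_branchDeriv_sub_le hq hu
    ((hw 0).1.1.trans hws) hs
  have hpU := (tendsto_nhdsWithin_iff.1 hp).2
  have hup := hp.eventually (H.eventually_u_pos hq hu)
  have huq : 0 < u q := by rw [hu]; exact one_pos
  have hex : ∀ t, ∃ ξ : ℕ → ℝ, (p t ∈ U ∧ 0 < u (p t) ∧ x t < y t ∧
      (∀ i < n t, (branch α (φ (p t)) (u (p t)) (c (p t)))^[i] (x t) ∈ Icc 0 (c (p t))) ∧
      (∀ i < n t, (branch α (φ (p t)) (u (p t)) (c (p t)))^[i] (y t) ∈ Icc 0 (c (p t)))) →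
      (∀ i < n t, ξ i ∈ Ioo ((branch α (φ (p t)) (u (p t)) (c (p t)))^[i] (x t))
        ((branch α (φ (p t)) (u (p t)) (c (p t)))^[i] (y t))) ∧
      Real.log ((branch α (φ (p t)) (u (p t)) (c (p t)))^[n t] (y t) -
        (branch α (φ (p t)) (u (p t)) (c (p t)))^[n t] (x t)) = Real.log (y t - x t) +
          ∑ i ∈ Finset.range (n t),
            Real.log (branchDeriv α (φ' (p t)) (u (p t)) (c (p t)) (ξ i)) := fun t => by
    by_cases h : p t ∈ U ∧ 0 < u (p t) ∧ x t < y t ∧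
      (∀ i < n t, (branch α (φ (p t)) (u (p t)) (c (p t)))^[i] (x t) ∈ Icc 0 (c (p t))) ∧
      (∀ i < n t, (branch α (φ (p t)) (u (p t)) (c (p t)))^[i] (y t) ∈ Icc 0 (c (p t)))
    · obtain ⟨ξ, h1, -, h3⟩ := H.exists_log_iterate_sub_eq h.1 h.2.1 h.2.2.1 (n t) h.2.2.2.1
        h.2.2.2.2
      exact ⟨ξ, fun _ => ⟨h1, h3⟩⟩
    · exact ⟨0, fun h' => absurd h' h⟩
  choose ξ hξ using hex
  have hgood : ∀ᶠ t in 𝓕, (∀ i < n t,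
      ξ t i ∈ Ioo ((branch α (φ (p t)) (u (p t)) (c (p t)))^[i] (x t))
        ((branch α (φ (p t)) (u (p t)) (c (p t)))^[i] (y t))) ∧
      Real.log ((branch α (φ (p t)) (u (p t)) (c (p t)))^[n t] (y t) -
        (branch α (φ (p t)) (u (p t)) (c (p t)))^[n t] (x t)) = Real.log (y t - x t) +
          ∑ i ∈ Finset.range (n t),
            Real.log (branchDeriv α (φ' (p t)) (u (p t)) (c (p t)) (ξ t i)) := by
    filter_upwards [hpU, hup, hxy, hx, hy] with t h1 h2 h3 h4 h5 using hξ t ⟨h1, h2, h3, h4, h5⟩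
  -- Terms are counted from the end of the orbit. For fixed k the term then has a limit, computed on
  -- the backward orbit w, and it is dominated by C ρ ^ (k + 1); dominated convergence gives the
  -- limit of the sum.
  let f : ι → ℕ → ℝ := fun t k => if k < n t then
    Real.log (branchDeriv α (φ' (p t)) (u (p t)) (c (p t)) (ξ t (n t - (k + 1)))) -
      Real.log (branchDeriv α (φ' (p t)) (u (p t)) (c (p t)) 0) else 0
  let g : ℕ → ℝ := fun k => Real.log (branchDeriv α (φ' q) (u q) (c q) (w (k + 1))) -
    Real.log (branchDeriv α (φ' q) (u q) (c q) 0)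
  have hmem : ∀ k, ∀ᶠ t in 𝓕, ξ t (n t - (k + 1)) ∈ Icc 0 (c (p t)) := fun k => by
    filter_upwards [hgood, hx, hy, hn.eventually (eventually_ge_atTop (k + 1))] with t h1 h2 h3 h4
    have h5 := h1.1 (n t - (k + 1)) (by omega)
    exact ⟨(h2 _ (by omega)).1.trans h5.1.le, h5.2.le.trans (h3 _ (by omega)).2⟩
  have hξlim : ∀ k, Tendsto (fun t => ξ t (n t - (k + 1))) 𝓕 (𝓝 (w (k + 1))) := fun k => by
    refine tendsto_of_tendsto_of_tendsto_of_le_of_le' (hwx (k + 1)) (hwy (k + 1)) ?_ ?_ <;>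
    · filter_upwards [hgood, hn.eventually (eventually_ge_atTop (k + 1))] with t h1 h2
      have h3 := h1.1 (n t - (k + 1)) (by omega)
      first | exact h3.1.le | exact h3.2.le
  have hlam : Tendsto (fun t => branchDeriv α (φ' (p t)) (u (p t)) (c (p t)) 0) 𝓕
      (𝓝 (branchDeriv α (φ' q) (u q) (c q) 0)) := by
    refine H.tendsto_branchDeriv hq hp tendsto_const_nhds ?_ ⟨le_rfl, (H.c_mem q hq).1.le⟩
    filter_upwards [hpU] with t ht using ⟨le_rfl, (H.c_mem _ ht).1.le⟩
  have hflim : ∀ k, Tendsto (f · k) 𝓕 (𝓝 (g k)) := fun k => by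
    have hwk := (hw k).1
    have h1 := H.tendsto_branchDeriv hq hp (hξlim k) (hmem k) ⟨hwk.1.le, hwk.2.le⟩
    have h2 := (h1.log (H.branchDeriv_pos hq huq ⟨hwk.1.le, hwk.2⟩).ne').sub
      (hlam.log (by linarith : branchDeriv α (φ' q) (u q) (c q) 0 ≠ 0))
    refine h2.congr' ?_
    filter_upwards [hn.eventually (eventually_gt_atTop k)] with t ht
    simp only [f, if_pos ht]
  have hbound : ∀ᶠ t in 𝓕, ∀ k, ‖f t k‖ ≤ C * ρ ^ (k + 1) := by
    have hylt : ∀ᶠ t in 𝓕, (branch α (φ (p t)) (u (p t)) (c (p t)))^[n t - 1] (y t) < s :=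
      (hwy 1).eventually (gt_mem_nhds hws)
    filter_upwards [hgood, hx, hy, hp.eventually hρ, hp.eventually hdist, hylt,
      hn.eventually (eventually_ge_atTop 1), hpU, hp.eventually hρ'] with t h1 h2 h3 h4 h5 h6 h7 h8 h11 k
    by_cases hk : k < n t
    · have h10 := h1.1 (n t - (k + 1)) (by omega)
      have h0 := (h2 (n t - (k + 1)) (by omega)).1
      have hle : (branch α (φ (p t)) (u (p t)) (c (p t)))^[n t - (k + 1)] (y t) ≤ ρ ^ (k + 1) :=
        h4 (n t) (y t) h7 h3 (k + 1) (by omega)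
      have hξs : ξ t (n t - (k + 1)) ≤ s := by
        refine h10.2.le.trans (le_trans ?_ h6.le)
        have hinc : ∀ m ≥ n t - (k + 1), m ≤ n t - 1 →
            (branch α (φ (p t)) (u (p t)) (c (p t)))^[n t - (k + 1)] (y t) ≤
              (branch α (φ (p t)) (u (p t)) (c (p t)))^[m] (y t) := by
          intro m hm
          induction m, hm using Nat.le_induction with
          | base => exact fun _ => le_rfl
          | succ m _ ih =>
            intro hm
            refine (ih (by omega)).trans ?_
            have e1 := h3 m (by omega)
            rw [Function.iterate_succ_apply']
            exact (h11 _ e1).trans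
              (mul_le_of_le_one_left (H.branch_mem h8 e1).1 hρ1'.le)
        exact hinc _ (by omega) le_rfl
      simp only [f, if_pos hk, Real.norm_eq_abs]
      refine (h5 _ ⟨h0.trans h10.1.le, hξs⟩).trans ?_
      exact mul_le_mul_of_nonneg_left (h10.2.le.trans hle) hC
    · simp only [f, if_neg hk, norm_zero]
      positivity
  have hsumm : Summable fun k : ℕ => C * ρ ^ (k + 1) :=
    ((summable_nat_add_iff 1).2 (summable_geometric_of_lt_one hρ0.le hρ1)).mul_left C
  refine ⟨∑' k, g k, (tendsto_tsum_of_dominated_convergence hsumm hflim hbound).congr' ?_⟩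
  filter_upwards [hgood] with t ht
  rw [tsum_eq_sum (s := Finset.range (n t)) fun k hk => by
    simp only [f]; rw [if_neg (by simpa using hk)], ht.2,
    ← Finset.sum_range_reflect (fun i =>
      Real.log (branchDeriv α (φ' (p t)) (u (p t)) (c (p t)) (ξ t i)))]
  have : ∀ k ∈ Finset.range (n t), f t k =
      Real.log (branchDeriv α (φ' (p t)) (u (p t)) (c (p t)) (ξ t (n t - 1 - k))) -
        Real.log (branchDeriv α (φ' (p t)) (u (p t)) (c (p t)) 0) := fun k hk => by
    simp only [f]
    rw [if_pos (by simpa using hk), show n t - (k + 1) = n t - 1 - k by omega]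
  rw [Finset.sum_congr rfl this, Finset.sum_sub_distrib, Finset.sum_const, Finset.card_range,
    nsmul_eq_mul]
  ring

end BranchFamily

end

section

/-! ### The two branches of a Lorenz map -/

/-- Conjugation of an interval map by `x ↦ 1 - x`. -/
def flipMap (φ : ℝ → ℝ) (x : ℝ) : ℝ := 1 - φ (1 - x)

namespace LorenzData

/-- The left branch of a Lorenz map, as a function on `[0, c]`. -/
noncomputable def leftBranch (α : ℝ) (f : LorenzData) : ℝ → ℝ := branch α f.phiL f.u f.c

/-- The right branch of a Lorenz map, conjugated to a function on `[0, 1 - c]`. -/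
noncomputable def rightBranch (α : ℝ) (f : LorenzData) : ℝ → ℝ :=
  branch α (flipMap f.phiR) f.v (1 - f.c)

theorem map_of_lt {α : ℝ} {f : LorenzData} (hc : 0 < f.c) {x : ℝ} (hx : x < f.c) :
    f.map α x = f.leftBranch α x := by
  rw [map, if_pos hx, std, if_pos hx, leftBranch, branch, powPart, sub_div, div_self hc.ne']

theorem one_sub_map_of_not_lt {α : ℝ} {f : LorenzData} (hc : f.c < 1) {x : ℝ} (hx : ¬ x < f.c) :
    1 - f.map α x = f.rightBranch α (1 - x) := by
  have h1 : (x - f.c) / (1 - f.c) = 1 - (1 - x) / (1 - f.c) := by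
    have : 1 - f.c ≠ 0 := by linarith
    field_simp
    ring
  rw [map, if_neg hx, std, if_neg hx, rightBranch, branch, flipMap, powPart, h1]
  ring_nf

end LorenzData

/-! ### Analytic families of Lorenz maps as branch families -/

section Analytic

variable {U : Set (ℝ × ℝ)} {φ : ℝ × ℝ → ℝ → ℝ}

theorem hasDerivAt_of_analyticAt_uncurry {p : ℝ × ℝ} {x : ℝ}
    (h : AnalyticAt ℝ (fun z : (ℝ × ℝ) × ℝ => φ z.1 z.2) (p, x)) :
    HasDerivAt (φ p) (fderiv ℝ (fun z : (ℝ × ℝ) × ℝ => φ z.1 z.2) (p, x) (0, 1)) x :=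
  h.differentiableAt.hasFDerivAt.comp_hasDerivAt x
    ((hasDerivAt_const x p).prodMk (hasDerivAt_id x))

theorem analyticAt_uncurry_deriv {p : ℝ × ℝ} {x : ℝ}
    (h : AnalyticAt ℝ (fun z : (ℝ × ℝ) × ℝ => φ z.1 z.2) (p, x)) :
    AnalyticAt ℝ (fun z : (ℝ × ℝ) × ℝ => deriv (φ z.1) z.2) (p, x) := by
  have h1 : AnalyticAt ℝ (fun z => fderiv ℝ (fun z : (ℝ × ℝ) × ℝ => φ z.1 z.2) z (0, 1)) (p, x) :=
    ((ContinuousLinearMap.apply ℝ ℝ ((0 : ℝ × ℝ), (1 : ℝ))).analyticAt _).comp h.fderiv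
  refine h1.congr ?_
  filter_upwards [h.eventually_analyticAt] with z hz
  exact (hasDerivAt_of_analyticAt_uncurry hz).deriv.symm

theorem iteratedDerivWithin_one_eq_deriv {ψ : ℝ → ℝ} {x : ℝ} (hx : x ∈ Icc (0 : ℝ) 1)
    (h : DifferentiableAt ℝ ψ x) : iteratedDerivWithin 1 ψ (Icc 0 1) x = deriv ψ x := by
  rw [iteratedDerivWithin_one]
  exact h.derivWithin (uniqueDiffOn_Icc zero_lt_one x hx)

theorem IsC2CloseToId.abs_iteratedDerivWithin_sub_le {ε : ℝ} {ψ : ℝ → ℝ} (h : IsC2CloseToId ε ψ)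
    (hψ : IsDiffeoPart ψ) {x y : ℝ} (hx : x ∈ Icc (0 : ℝ) 1) (hy : y ∈ Icc (0 : ℝ) 1) :
    |iteratedDerivWithin 1 ψ (Icc 0 1) x - iteratedDerivWithin 1 ψ (Icc 0 1) y| ≤ ε * |x - y| := by
  have hd : DifferentiableOn ℝ (iteratedDerivWithin 1 ψ (Icc 0 1)) (Icc 0 1) :=
    hψ.contDiffOn.differentiableOn_iteratedDerivWithin (by norm_num) (uniqueDiffOn_Icc zero_lt_one)
  refine (convex_Icc (0 : ℝ) 1).norm_image_sub_le_of_norm_derivWithin_le hd (fun z hz => ?_) hy hx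
  rw [← iteratedDerivWithin_succ]
  exact (h z hz).2.2

end Analytic

namespace IsAnalyticFamily

variable {α : ℝ} {U : Set (ℝ × ℝ)} {F : ℝ × ℝ → LorenzData}

/-- Closeness with ε ≤ 1/2 keeps the derivative of the diffeomorphic part within [1/2, 3/2] and its
Lipschitz constant at most 1/2, hence the numerical bounds in `BranchFamily`. -/
theorem leftFamily (hF : IsAnalyticFamily α U F) (hα : 1 < α) {ε : ℝ} (hε : ε ≤ 1 / 2)
    (hclose : ∀ p ∈ U, (F p).IsCloseToStandard ε) :
    BranchFamily α U (fun p => (F p).phiL) (fun p => deriv (F p).phiL) (fun p => (F p).u)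
      (fun p => (F p).c) := by
  have han : ∀ p ∈ U, ∀ x ∈ Icc (0 : ℝ) 1,
      AnalyticAt ℝ (fun z : (ℝ × ℝ) × ℝ => (F z.1).phiL z.2) (p, x) :=
    fun p hp x hx => hF.analytic_phiL (p, x) ⟨hp, hx⟩
  have hdiff : ∀ p ∈ U, ∀ x ∈ Icc (0 : ℝ) 1, DifferentiableAt ℝ (F p).phiL x :=
    fun p hp x hx =>
      (hasDerivAt_of_analyticAt_uncurry (φ := fun p => (F p).phiL) (han p hp x hx)).differentiableAt
  have hbd : ∀ p ∈ U, ∀ x ∈ Icc (0 : ℝ) 1, |deriv (F p).phiL x - 1| ≤ ε := fun p hp x hx => by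
    rw [← iteratedDerivWithin_one_eq_deriv hx (hdiff p hp x hx)]
    exact ((hclose p hp).1 x hx).2.1
  refine ⟨hα, hF.isCompact, hF.analytic_u.continuousOn, hF.analytic_c.continuousOn,
    hF.analytic_phiL.continuousOn, fun z hz => ?_, fun p hp x hx => ?_,
    fun p hp => (hF.isLorenz p hp).phiL.map_zero, fun p hp => (hF.isLorenz p hp).phiL.map_one,
    fun p hp x hx => ?_, fun p hp x hx => ?_, fun p hp x hx => ?_,
    fun p hp => (hF.isLorenz p hp).u_mem, fun p hp => (hF.isLorenz p hp).c_mem,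
    fun p hp x hx h => ?_⟩
  · exact (analyticAt_uncurry_deriv (φ := fun p => (F p).phiL)
      (hF.analytic_phiL z hz)).continuousAt.continuousWithinAt
  · exact (hdiff p hp x hx).hasDerivAt.hasDerivWithinAt
  · linarith [(abs_le.1 (hbd p hp x hx)).1]
  · linarith [(abs_le.1 (hbd p hp x hx)).2]
  · have h0 : (0 : ℝ) ∈ Icc (0 : ℝ) 1 := by simp
    have := (hclose p hp).1.abs_iteratedDerivWithin_sub_le (hF.isLorenz p hp).phiL hx h0
    rw [iteratedDerivWithin_one_eq_deriv hx (hdiff p hp x hx),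
      iteratedDerivWithin_one_eq_deriv h0 (hdiff p hp 0 h0), sub_zero, abs_of_nonneg hx.1] at this
    exact this.trans (mul_le_of_le_one_left hx.1 (by linarith))
  · have hL := hF.isLorenz p hp
    rcases hL.fixed x ⟨hx.1.le, (hx.2.trans hL.c_mem.2).le⟩ hx.2.ne
      (by rw [LorenzData.map_of_lt hL.c_mem.1 hx.2]; exact h) with h' | h'
    · exact hx.1.ne' h'
    · exact (hx.2.trans hL.c_mem.2).ne h'

/-- Conjugation by x ↦ 1 - x makes the right branch a branch on [0, 1 - c] fixing 0, so the
one-branch theory serves both sides. -/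
theorem rightFamily (hF : IsAnalyticFamily α U F) (hα : 1 < α) {ε : ℝ} (hε : ε ≤ 1 / 2)
    (hclose : ∀ p ∈ U, (F p).IsCloseToStandard ε) :
    BranchFamily α U (fun p => flipMap (F p).phiR) (fun p x => deriv (F p).phiR (1 - x))
      (fun p => (F p).v) (fun p => 1 - (F p).c) := by
  have hmem : ∀ {x : ℝ}, x ∈ Icc (0 : ℝ) 1 → 1 - x ∈ Icc (0 : ℝ) 1 := fun hx =>
    ⟨by linarith [hx.2], by linarith [hx.1]⟩
  have han : ∀ p ∈ U, ∀ x ∈ Icc (0 : ℝ) 1,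
      AnalyticAt ℝ (fun z : (ℝ × ℝ) × ℝ => (F z.1).phiR z.2) (p, x) :=
    fun p hp x hx => hF.analytic_phiR (p, x) ⟨hp, hx⟩
  have hdiff : ∀ p ∈ U, ∀ x ∈ Icc (0 : ℝ) 1, DifferentiableAt ℝ (F p).phiR x :=
    fun p hp x hx =>
      (hasDerivAt_of_analyticAt_uncurry (φ := fun p => (F p).phiR) (han p hp x hx)).differentiableAt
  have hbd : ∀ p ∈ U, ∀ x ∈ Icc (0 : ℝ) 1, |deriv (F p).phiR x - 1| ≤ ε := fun p hp x hx => by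
    rw [← iteratedDerivWithin_one_eq_deriv hx (hdiff p hp x hx)]
    exact ((hclose p hp).2 x hx).2.1
  have hflip : Continuous fun z : (ℝ × ℝ) × ℝ => (z.1, 1 - z.2) := by fun_prop
  have hmaps : MapsTo (fun z : (ℝ × ℝ) × ℝ => (z.1, 1 - z.2)) (U ×ˢ Icc (0 : ℝ) 1)
      (U ×ˢ Icc (0 : ℝ) 1) := fun z hz => ⟨hz.1, hmem hz.2⟩
  have hdcont : ContinuousOn (fun z : (ℝ × ℝ) × ℝ => deriv (F z.1).phiR z.2)
      (U ×ˢ Icc (0 : ℝ) 1) := fun z hz =>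
    (analyticAt_uncurry_deriv (φ := fun p => (F p).phiR)
      (hF.analytic_phiR z hz)).continuousAt.continuousWithinAt
  refine ⟨hα, hF.isCompact, hF.analytic_v.continuousOn,
    continuousOn_const.sub hF.analytic_c.continuousOn,
    continuousOn_const.sub (hF.analytic_phiR.continuousOn.comp hflip.continuousOn hmaps),
    hdcont.comp hflip.continuousOn hmaps, fun p hp x hx => ?_,
    fun p hp => ?_, fun p hp => ?_,
    fun p hp x hx => ?_, fun p hp x hx => ?_, fun p hp x hx => ?_,
    fun p hp => (hF.isLorenz p hp).v_mem, fun p hp => ?_,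
    fun p hp x hx h => ?_⟩
  · have h1 : HasDerivAt (fun x : ℝ => 1 - x) (-1) x := by
      simpa using (hasDerivAt_id x).const_sub 1
    have h2 := ((hdiff p hp _ (hmem hx)).hasDerivAt.comp x h1).const_sub 1
    refine (h2.congr_deriv ?_).hasDerivWithinAt
    ring
  · simp [flipMap, (hF.isLorenz p hp).phiR.map_one]
  · simp [flipMap, (hF.isLorenz p hp).phiR.map_zero]
  · linarith [(abs_le.1 (hbd p hp _ (hmem hx))).1]
  · linarith [(abs_le.1 (hbd p hp _ (hmem hx))).2]
  · have h0 : (1 : ℝ) ∈ Icc (0 : ℝ) 1 := by simp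
    have := (hclose p hp).2.abs_iteratedDerivWithin_sub_le (hF.isLorenz p hp).phiR (hmem hx) h0
    rw [iteratedDerivWithin_one_eq_deriv (hmem hx) (hdiff p hp _ (hmem hx)),
      iteratedDerivWithin_one_eq_deriv h0 (hdiff p hp 1 h0),
      show 1 - x - 1 = -x by ring, abs_neg, abs_of_nonneg hx.1] at this
    simp only [sub_zero]
    exact this.trans (mul_le_of_le_one_left hx.1 (by linarith))
  · exact ⟨by linarith [(hF.isLorenz p hp).c_mem.2], by linarith [(hF.isLorenz p hp).c_mem.1]⟩
  · have hL := hF.isLorenz p hp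
    have h1 : (F p).c < 1 - x := by linarith [hx.2]
    have h2 := LorenzData.one_sub_map_of_not_lt (α := α) hL.c_mem.2 h1.le.not_gt
    rw [sub_sub_cancel, LorenzData.rightBranch, h] at h2
    rcases hL.fixed (1 - x) ⟨by linarith [hL.c_mem.1], by linarith [hx.1]⟩ h1.ne' (by linarith)
      with h' | h'
    · linarith [hL.c_mem.1]
    · linarith [hx.1]

end IsAnalyticFamily

/-! ### Orbits of the end points of the return interval and of the critical values -/

/-- The orbits of the critical values are only limits of orbits starting next to the critical point.
Staying in a closed interval and the value at time n survive this limit. -/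
theorem iterate_mem_and_eq_of_tendsto {B E G : ℝ → ℝ} {d e y : ℝ} {𝓛 : Filter ℝ} [𝓛.NeBot]
    (hB : ContinuousOn B (Icc 0 d)) (hE : Tendsto E 𝓛 (𝓝 e)) (hG : Tendsto G 𝓛 (𝓝 y)) {n : ℕ}
    (h : ∀ᶠ x in 𝓛, (∀ i < n, B^[i] (E x) ∈ Icc 0 d) ∧ B^[n] (E x) = G x) :
    (∀ i < n, B^[i] e ∈ Icc 0 d) ∧ B^[n] e = y := by
  have hmem : ∀ i < n, Tendsto (fun x => B^[i] (E x)) 𝓛 (𝓝 (B^[i] e)) →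
      B^[i] e ∈ Icc 0 d := fun i hi ht =>
    isClosed_Icc.mem_of_tendsto ht (h.mono fun x hx => hx.1 i hi)
  have ht : ∀ i ≤ n, Tendsto (fun x => B^[i] (E x)) 𝓛 (𝓝 (B^[i] e)) := fun i => by
    induction i with
    | zero => exact fun _ => hE
    | succ i ih =>
      intro hi
      have h1 := ih (by omega)
      simp only [Function.iterate_succ_apply']
      exact (hB _ (hmem i hi h1)).tendsto.comp
        (tendsto_nhdsWithin_iff.2 ⟨h1, h.mono fun x hx => hx.1 i hi⟩)
  refine ⟨fun i hi => hmem i hi (ht i hi.le), ?_⟩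
  exact tendsto_nhds_unique ((ht n le_rfl).congr' (h.mono fun x hx => hx.2)) hG

namespace LorenzData

theorem IsLorenz.tendsto_map_left {α : ℝ} (hα : 1 < α) {g : LorenzData} (hg : g.IsLorenz α) :
    Tendsto (g.map α) (𝓝[<] g.c) (𝓝 g.critValL) := by
  have hc := hg.c_mem.1
  have hpow : Tendsto (powPart α g.u g.c) (𝓝[<] g.c) (𝓝[Icc 0 1] g.u) := by
    refine tendsto_nhdsWithin_iff.2 ⟨?_, ?_⟩
    · have := (hasDerivAt_powPart hα g.u g.c g.c).continuousAt.tendsto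
      rw [powPart_self hα g.u hc] at this
      exact this.mono_left nhdsWithin_le_nhds
    · filter_upwards [Ioo_mem_nhdsLT hc] with x hx
      exact powPart_mem hα hg.u_mem hc ⟨hx.1.le, hx.2.le⟩
  refine ((hg.phiL.contDiffOn.continuousOn g.u hg.u_mem).tendsto.comp hpow).congr' ?_
  filter_upwards [self_mem_nhdsWithin] with x hx
  rw [map_of_lt hc hx]
  rfl

theorem IsLorenz.tendsto_map_right {α : ℝ} (hα : 1 < α) {g : LorenzData} (hg : g.IsLorenz α) :
    Tendsto (g.map α) (𝓝[>] g.c) (𝓝 g.critValR) := by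
  have hc : 0 < 1 - g.c := by linarith [hg.c_mem.2]
  have hpow : Tendsto (fun x => 1 - powPart α g.v (1 - g.c) (1 - x)) (𝓝[>] g.c)
      (𝓝[Icc 0 1] (1 - g.v)) := by
    refine tendsto_nhdsWithin_iff.2 ⟨?_, ?_⟩
    · have h1 := (hasDerivAt_powPart hα g.v (1 - g.c) (1 - g.c)).continuousAt.tendsto
      rw [powPart_self hα g.v hc] at h1
      have h2 : Tendsto (fun x : ℝ => 1 - x) (𝓝[>] g.c) (𝓝 (1 - g.c)) :=
        ((continuous_const.sub continuous_id).tendsto g.c).mono_left nhdsWithin_le_nhds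
      exact (h1.comp h2).const_sub 1
    · filter_upwards [Ioo_mem_nhdsGT hg.c_mem.2] with x hx
      have := powPart_mem hα hg.v_mem hc (x := 1 - x) ⟨by linarith [hx.2], by linarith [hx.1]⟩
      exact ⟨by linarith [this.2], by linarith [this.1]⟩
  have hv : 1 - g.v ∈ Icc (0 : ℝ) 1 := ⟨by linarith [hg.v_mem.2], by linarith [hg.v_mem.1]⟩
  refine ((hg.phiR.contDiffOn.continuousOn _ hv).tendsto.comp hpow).congr' ?_
  filter_upwards [self_mem_nhdsWithin] with x hx
  have := one_sub_map_of_not_lt (α := α) hg.c_mem.2 (not_lt.2 (le_of_lt hx))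
  rw [rightBranch, branch, flipMap] at this
  rw [Function.comp_apply]
  linarith

theorem IsLorenz.map_zero {α : ℝ} {g : LorenzData} (hg : g.IsLorenz α) : g.map α 0 = 0 := by
  rw [map_of_lt hg.c_mem.1 hg.c_mem.1, leftBranch, branch, powPart_zero, hg.phiL.map_zero]

theorem IsLorenz.map_one {α : ℝ} {g : LorenzData} (hg : g.IsLorenz α) : g.map α 1 = 1 := by
  have := one_sub_map_of_not_lt (α := α) hg.c_mem.2 hg.c_mem.2.le.not_gt
  rw [sub_self, rightBranch, branch, powPart_zero, flipMap, sub_zero, hg.phiR.map_one] at this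
  linarith

/-- What is used about a full renormalization with return interval `[l, r]`: the orbits of the end
points and of the critical values, in terms of the two branches. -/
structure FullReturn (α : ℝ) (a b : ℕ) (f : LorenzData) (x l r : ℝ) : Prop where
  l_nonneg : 0 ≤ l
  l_lt : l < f.c
  lt_r : f.c < r
  r_le : r ≤ 1
  crit_eq : x = (f.c - l) / (r - l)
  lt_leftBranch : f.c < f.leftBranch α f.c
  lt_rightBranch : 1 - f.c < f.rightBranch α (1 - f.c)
  left_crit : (∀ i < b, (f.leftBranch α)^[i] (1 - f.rightBranch α (1 - f.c)) ∈ Icc 0 f.c) ∧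
    (f.leftBranch α)^[b] (1 - f.rightBranch α (1 - f.c)) = l
  left_end : (∀ i < b, (f.leftBranch α)^[i] (1 - f.rightBranch α (1 - r)) ∈ Icc 0 f.c) ∧
    (f.leftBranch α)^[b] (1 - f.rightBranch α (1 - r)) = r
  right_crit : (∀ i < a, (f.rightBranch α)^[i] (1 - f.leftBranch α f.c) ∈ Icc 0 (1 - f.c)) ∧
    (f.rightBranch α)^[a] (1 - f.leftBranch α f.c) = 1 - r
  right_end : (∀ i < a, (f.rightBranch α)^[i] (1 - f.leftBranch α l) ∈ Icc 0 (1 - f.c)) ∧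
    (f.rightBranch α)^[a] (1 - f.leftBranch α l) = 1 - l

/-- Intermediate iterates stay on one side of c, so after the first step a return is an iterate of a
single branch. Fullness of g carries the right critical value to l and the left one to r; since g
fixes 0 and 1, the end points return to themselves. -/
theorem exists_fullReturn {α : ℝ} {U : Set (ℝ × ℝ)} {F : ℝ × ℝ → LorenzData} {p : ℝ × ℝ}
    (hp : p ∈ U) (hα : 1 < α) (hlor : (F p).IsLorenz α)
    {φ' ψ' : ℝ × ℝ → ℝ → ℝ}
    (HL : BranchFamily α U (fun p => (F p).phiL) φ' (fun p => (F p).u) (fun p => (F p).c))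
    (HR : BranchFamily α U (fun p => flipMap (F p).phiR) ψ' (fun p => (F p).v)
      (fun p => 1 - (F p).c))
    {a b : ℕ} {g : LorenzData} (hren : (F p).IsRenormalization α a b g) (hfull : g.IsFull) :
    ∃ l r, FullReturn α a b (F p) g.c l r := by
  obtain ⟨ha, hb, hg, -, l, r, hl, hlc, hcr, hr, -, hgc, hleft, hright⟩ := hren
  set f := F p with hf
  have hc := hlor.c_mem
  have hrl : 0 < r - l := by linarith
  have hLmem : ∀ {x}, x ∈ Icc 0 f.c → f.leftBranch α x ∈ Icc (0 : ℝ) 1 := HL.branch_mem hp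
  have hRmem : ∀ {x}, x ∈ Icc 0 (1 - f.c) → f.rightBranch α x ∈ Icc (0 : ℝ) 1 := HR.branch_mem hp
  have hL : ∀ x ∈ Ico l f.c,
      (∀ i < a, (f.rightBranch α)^[i] (1 - f.leftBranch α x) ∈ Icc 0 (1 - f.c)) ∧
        (f.rightBranch α)^[a] (1 - f.leftBranch α x) =
          1 - (l + (r - l) * g.map α ((x - l) / (r - l))) := by
    intro x hx
    have hx' := hleft x hx
    have key : ∀ i ≤ a, (f.rightBranch α)^[i] (1 - f.leftBranch α x) =
        1 - (f.map α)^[i + 1] x ∧ (f.map α)^[i + 1] x ≤ 1 := fun i => by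
      induction i with
      | zero =>
        intro _
        simp only [Function.iterate_zero, id, zero_add, Function.iterate_one]
        rw [map_of_lt hc.1 hx.2]
        exact ⟨rfl, (hLmem ⟨hl.trans hx.1, hx.2.le⟩).2⟩
      | succ i ih =>
        intro hi
        have h1 := ih (by omega)
        have h2 := (hx'.1 (i + 1) (by omega) hi).1
        have h3 := one_sub_map_of_not_lt (α := α) hc.2 h2.le.not_gt
        rw [Function.iterate_succ_apply', h1.1, Function.iterate_succ_apply' (f.map α) (i + 1), h3]
        refine ⟨rfl, ?_⟩
        have h4 := hRmem (x := 1 - (f.map α)^[i + 1] x) ⟨by linarith [h1.2], by linarith⟩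
        linarith [h4.1]
    refine ⟨fun i hi => ?_, ?_⟩
    · have h1 := key i hi.le
      have h2 := (hx'.1 (i + 1) (by omega) hi).1
      rw [h1.1]
      exact ⟨by linarith [h1.2], by linarith⟩
    · rw [(key a le_rfl).1, hx'.2]
  have hR : ∀ x ∈ Ioc f.c r,
      (∀ i < b, (f.leftBranch α)^[i] (1 - f.rightBranch α (1 - x)) ∈ Icc 0 f.c) ∧
        (f.leftBranch α)^[b] (1 - f.rightBranch α (1 - x)) =
          l + (r - l) * g.map α ((x - l) / (r - l)) := by
    intro x hx
    have hx' := hright x hx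
    have key : ∀ i ≤ b, (f.leftBranch α)^[i] (1 - f.rightBranch α (1 - x)) =
        (f.map α)^[i + 1] x ∧ 0 ≤ (f.map α)^[i + 1] x := fun i => by
      induction i with
      | zero =>
        intro _
        simp only [Function.iterate_zero, id, zero_add, Function.iterate_one]
        rw [← one_sub_map_of_not_lt (α := α) hc.2 hx.1.le.not_gt, sub_sub_cancel]
        refine ⟨rfl, ?_⟩
        have h4 := hRmem (x := 1 - x) ⟨by linarith [hx.2], by linarith [hx.1]⟩
        rw [← one_sub_map_of_not_lt (α := α) hc.2 hx.1.le.not_gt] at h4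
        linarith [h4.2]
      | succ i ih =>
        intro hi
        have h1 := ih (by omega)
        have h2 := (hx'.1 (i + 1) (by omega) hi).1
        rw [Function.iterate_succ_apply', h1.1, Function.iterate_succ_apply' (f.map α) (i + 1),
          map_of_lt hc.1 h2]
        exact ⟨rfl, (hLmem ⟨h1.2, h2.le⟩).1⟩
    refine ⟨fun i hi => ?_, ?_⟩
    · have h1 := key i hi.le
      have h2 := (hx'.1 (i + 1) (by omega) hi).1
      rw [h1.1]
      exact ⟨h1.2, h2.le⟩
    · rw [(key b le_rfl).1, hx'.2]
  have hLcont : ContinuousOn (f.leftBranch α) (Icc 0 f.c) := HL.continuousOn_branch_one hp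
  have hRcont : ContinuousOn (f.rightBranch α) (Icc 0 (1 - f.c)) := HR.continuousOn_branch_one hp
  have haff : ContinuousAt (fun x => (x - l) / (r - l)) f.c := by fun_prop
  have hscale : ∀ x y : ℝ, (x - l) / (r - l) < (y - l) / (r - l) ↔ x < y := fun x y => by
    rw [div_lt_div_iff_of_pos_right hrl, sub_lt_sub_iff_right]
  refine ⟨l, r, hl, hlc, hcr, hr, hgc, ?_, ?_, ?_, ?_, ?_, ?_⟩
  · have h1 := (hL l ⟨le_rfl, hlc⟩).1 0 ha
    have h2 := (hleft l ⟨le_rfl, hlc⟩).1 1 le_rfl ha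
    rw [Function.iterate_one, map_of_lt hc.1 hlc] at h2
    -- If u = 0 the left branch is identically 0, but the first iterate of l lies to the right of c.
    have hu : 0 < f.u := by
      refine lt_of_le_of_ne hlor.u_mem.1 fun h0 => ?_
      have : f.leftBranch α l = 0 := by
        rw [leftBranch, branch, powPart, ← h0, zero_mul, hlor.phiL.map_zero]
      linarith [h2.1, hc.1]
    exact h2.1.trans (HL.strictMonoOn_branch hp hu ⟨hl, hlc.le⟩ ⟨hc.1.le, le_rfl⟩ hlc)
  · have h2 := (hright r ⟨hcr, le_rfl⟩).1 1 le_rfl hb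
    have h3 := one_sub_map_of_not_lt (α := α) hc.2 hcr.le.not_gt
    rw [Function.iterate_one] at h2
    have hv : 0 < f.v := by
      refine lt_of_le_of_ne hlor.v_mem.1 fun h0 => ?_
      have : f.rightBranch α (1 - r) = 0 := by
        rw [rightBranch, branch, powPart, ← h0, zero_mul, flipMap, sub_zero, hlor.phiR.map_one,
          sub_self]
      linarith [h2.1, hc.2]
    have h4 : f.rightBranch α (1 - r) < f.rightBranch α (1 - f.c) :=
      HR.strictMonoOn_branch hp hv ⟨by linarith, by linarith⟩ ⟨by linarith [hc.2], le_rfl⟩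
        (by linarith)
    linarith [h2.1]
  · have hE : Tendsto (fun x => 1 - f.rightBranch α (1 - x)) (𝓝[>] f.c)
        (𝓝 (1 - f.rightBranch α (1 - f.c))) := by
      refine Tendsto.const_sub 1 ?_
      refine (hRcont (1 - f.c) ⟨by linarith [hc.2], le_rfl⟩).tendsto.comp
        (tendsto_nhdsWithin_iff.2 ⟨((continuous_const.sub continuous_id).tendsto
          f.c).mono_left nhdsWithin_le_nhds, ?_⟩)
      filter_upwards [Ioo_mem_nhdsGT hc.2] with x hx
      exact ⟨sub_nonneg.2 hx.2.le, sub_le_sub_left hx.1.le 1⟩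
    have hG : Tendsto (fun x => l + (r - l) * g.map α ((x - l) / (r - l))) (𝓝[>] f.c) (𝓝 l) := by
      have h1 : Tendsto (fun x => (x - l) / (r - l)) (𝓝[>] f.c) (𝓝[>] g.c) := by
        rw [hgc]
        refine tendsto_nhdsWithin_iff.2 ⟨haff.tendsto.mono_left nhdsWithin_le_nhds, ?_⟩
        filter_upwards [self_mem_nhdsWithin] with x hx using (hscale _ _).2 hx
      have h2 := (((hg.tendsto_map_right hα).comp h1).const_mul (r - l)).const_add l
      rwa [hfull.2, mul_zero, add_zero] at h2
    refine iterate_mem_and_eq_of_tendsto hLcont hE hG ?_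
    filter_upwards [Ioc_mem_nhdsGT hcr] with x hx using hR x hx
  · have h1 := hR r ⟨hcr, le_rfl⟩
    rw [div_self hrl.ne', hg.map_one] at h1
    exact ⟨h1.1, by rw [h1.2]; ring⟩
  · have hE : Tendsto (fun x => 1 - f.leftBranch α x) (𝓝[<] f.c) (𝓝 (1 - f.leftBranch α f.c)) := by
      refine Tendsto.const_sub 1 ?_
      refine (hLcont f.c ⟨hc.1.le, le_rfl⟩).tendsto.mono_left ?_
      refine nhdsWithin_le_iff.2 ?_
      filter_upwards [Ioo_mem_nhdsLT hc.1] with x hx using ⟨hx.1.le, hx.2.le⟩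
    have hG : Tendsto (fun x => 1 - (l + (r - l) * g.map α ((x - l) / (r - l)))) (𝓝[<] f.c)
        (𝓝 (1 - r)) := by
      have h1 : Tendsto (fun x => (x - l) / (r - l)) (𝓝[<] f.c) (𝓝[<] g.c) := by
        rw [hgc]
        refine tendsto_nhdsWithin_iff.2 ⟨haff.tendsto.mono_left nhdsWithin_le_nhds, ?_⟩
        filter_upwards [self_mem_nhdsWithin] with x hx using (hscale _ _).2 hx
      have h2 := ((((hg.tendsto_map_left hα).comp h1).const_mul (r - l)).const_add l).const_sub 1
      rwa [hfull.1, mul_one, add_sub_cancel] at h2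
    refine iterate_mem_and_eq_of_tendsto hRcont hE hG ?_
    filter_upwards [Ico_mem_nhdsLT hlc] with x hx using hL x hx
  · have h1 := hL l ⟨le_rfl, hlc⟩
    rw [sub_self, zero_div, hg.map_zero, mul_zero, add_zero] at h1
    exact h1

end LorenzData

end

/-! ### The critical point, and convergence of full vertices to the full map -/

section

namespace BranchFamily

variable {X : Type*} [MetricSpace X] {α : ℝ} {U : Set X} {φ φ' : X → ℝ → ℝ} {u c : X → ℝ}

theorem sub_powPart_eq {α u c x : ℝ} : u - powPart α u c x = u * (1 - x / c) ^ α := by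
  rw [powPart]; ring

theorem branch_self_sub_le (H : BranchFamily α U φ φ' u c) {p : X} (hp : p ∈ U) {x : ℝ}
    (hx : x ∈ Icc 0 (c p)) :
    branch α (φ p) (u p) (c p) (c p) - branch α (φ p) (u p) (c p) x ≤ 2 * (1 - x / c p) ^ α := by
  have hz := H.powPart_mem hp hx
  have hpow := Real.rpow_nonneg (one_sub_div_mem (H.c_mem p hp).1 hx).1 α
  have hu := H.u_mem p hp
  have hle : powPart α (u p) (c p) x ≤ u p := by
    have := mul_nonneg hu.1 hpow
    rw [← sub_powPart_eq] at this
    linarith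
  have h := H.sub_le hp hz.1 hle hu.2
  rw [sub_powPart_eq] at h
  rw [H.branch_self hp, branch]
  refine h.trans ?_
  gcongr
  exact mul_le_of_le_one_left hpow hu.2

theorem mul_rpow_le_branch_self_sub (H : BranchFamily α U φ φ' u c) {p : X} (hp : p ∈ U) {x : ℝ}
    (hx : x ∈ Icc 0 (c p)) : u p / 2 * (c p - x) ^ α ≤
      branch α (φ p) (u p) (c p) (c p) - branch α (φ p) (u p) (c p) x := by
  have hz := H.powPart_mem hp hx
  have hc := H.c_mem p hp
  have hpow := Real.rpow_nonneg (one_sub_div_mem hc.1 hx).1 α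
  have hu := H.u_mem p hp
  have hle : powPart α (u p) (c p) x ≤ u p := by
    have := mul_nonneg hu.1 hpow
    rw [← sub_powPart_eq] at this
    linarith
  have h := H.half_sub_le hp hz.1 hle hu.2
  rw [sub_powPart_eq] at h
  rw [H.branch_self hp, branch]
  refine le_trans ?_ h
  have h1 : (c p - x) ^ α ≤ (1 - x / c p) ^ α := by
    refine Real.rpow_le_rpow (by linarith [hx.2]) ?_ (by linarith [H.one_lt])
    have : 1 - x / c p = (c p - x) / c p := by rw [sub_div, div_self hc.1.ne']
    rw [this, le_div_iff₀ hc.1]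
    exact mul_le_of_le_one_right (by linarith [hx.2]) hc.2.le
  calc u p / 2 * (c p - x) ^ α ≤ u p / 2 * (1 - x / c p) ^ α :=
        mul_le_mul_of_nonneg_left h1 (by linarith [hu.1])
    _ = _ := by ring

/-- If the branch value at distance `t` from the critical point is below the critical point, then
the critical value exceeds the critical point by at most a multiple of `t ^ α`. -/
theorem exists_critVal_sub_le (H : BranchFamily α U φ φ' u c) :
    ∃ C : ℝ, 0 < C ∧ ∀ p ∈ U, ∀ x ∈ Icc 0 (c p), branch α (φ p) (u p) (c p) x ≤ c p →
      branch α (φ p) (u p) (c p) (c p) - c p ≤ C * (c p - x) ^ α := by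
  rcases U.eq_empty_or_nonempty with rfl | hne
  · exact ⟨1, one_pos, fun p hp => hp.elim⟩
  obtain ⟨q, hq, hmin⟩ := H.isCompact.exists_isMinOn hne H.cont_c
  have hcq := (H.c_mem q hq).1
  -- The minimum of c over the compact set U makes the constant uniform.
  refine ⟨2 / (c q) ^ α, div_pos two_pos (Real.rpow_pos_of_pos hcq _), fun p hp x hx hle => ?_⟩
  have hc := (H.c_mem p hp).1
  have h := H.branch_self_sub_le hp hx
  have h1 : (1 - x / c p) ^ α ≤ ((c p - x) / c q) ^ α := by
    refine Real.rpow_le_rpow (one_sub_div_mem hc hx).1 ?_ (by linarith [H.one_lt])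
    have : 1 - x / c p = (c p - x) / c p := by rw [sub_div, div_self hc.ne']
    rw [this]
    exact div_le_div_of_nonneg_left (by linarith [hx.2]) hcq (hmin hp)
  rw [Real.div_rpow (by linarith [hx.2]) hcq.le] at h1
  calc _ ≤ 2 * ((c p - x) ^ α / c q ^ α) := by linarith
    _ = _ := by ring

/-- Substituting one inequality into the other gives s ≤ K s ^ (α²), and α² > 1 keeps s away from 0.
-/
theorem exists_le_of_le_mul_rpow {α : ℝ} (hα : 1 < α) {C : ℝ} (hC : 0 < C) :
    ∃ s₀ : ℝ, 0 < s₀ ∧ ∀ s t : ℝ, 0 < s → 0 < t → s ≤ C * t ^ α → t ≤ C * s ^ α → s₀ ≤ s := by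
  set K := C * C ^ α with hK
  have hK0 : 0 < K := mul_pos hC (Real.rpow_pos_of_pos hC _)
  have hβ : 0 < α * α - 1 := by nlinarith
  refine ⟨(1 / K) ^ (1 / (α * α - 1)), Real.rpow_pos_of_pos (by positivity) _,
    fun s t hs ht h1 h2 => ?_⟩
  have h3 : s ≤ K * s ^ (α * α) := by
    calc s ≤ C * t ^ α := h1
      _ ≤ C * (C * s ^ α) ^ α := by
          have := Real.rpow_le_rpow ht.le h2 (by linarith : 0 ≤ α)
          gcongr
      _ = K * s ^ (α * α) := by
          rw [Real.mul_rpow hC.le (Real.rpow_nonneg hs.le _), ← Real.rpow_mul hs.le, hK]; ring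
  have h4 : s ^ (α * α) = s * s ^ (α * α - 1) := by
    rw [Real.rpow_sub_one hs.ne']; field_simp
  rw [h4] at h3
  have h5 : 1 / K ≤ s ^ (α * α - 1) := by
    rw [div_le_iff₀ hK0]
    nlinarith
  calc (1 / K) ^ (1 / (α * α - 1)) ≤ (s ^ (α * α - 1)) ^ (1 / (α * α - 1)) :=
        Real.rpow_le_rpow (by positivity) h5 (by positivity)
    _ = s := by rw [← Real.rpow_mul hs.le, mul_one_div_cancel hβ.ne', Real.rpow_one]

/-- Asymptotics of a branch at its critical point. -/
theorem tendsto_log_branch_self_sub {ι : Type*} {𝓕 : Filter ι} (H : BranchFamily α U φ φ' u c)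
    {q : X} (hq : q ∈ U) (hu : u q = 1) {p : ι → X} (hp : Tendsto p 𝓕 (𝓝[U] q)) {x : ι → ℝ}
    (hxc : ∀ᶠ t in 𝓕, x t ∈ Ico 0 (c (p t))) (hx : Tendsto x 𝓕 (𝓝 (c q))) :
    Tendsto (fun t => Real.log (branch α (φ (p t)) (u (p t)) (c (p t)) (c (p t)) -
      branch α (φ (p t)) (u (p t)) (c (p t)) (x t)) - α * Real.log (c (p t) - x t)) 𝓕
      (𝓝 (Real.log (φ' q 1) - α * Real.log (c q))) := by
  have hpU := (tendsto_nhdsWithin_iff.1 hp).2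
  have hup := hp.eventually (H.eventually_u_pos hq hu)
  have hcq := H.c_mem q hq
  have hex : ∀ t, ∃ ζ, p t ∈ U ∧ 0 < u (p t) ∧ x t ∈ Ico 0 (c (p t)) →
      ζ ∈ Ioo (powPart α (u (p t)) (c (p t)) (x t)) (u (p t)) ∧
      φ (p t) (u (p t)) - φ (p t) (powPart α (u (p t)) (c (p t)) (x t)) =
        φ' (p t) ζ * (u (p t) - powPart α (u (p t)) (c (p t)) (x t)) := fun t => by
    by_cases h : p t ∈ U ∧ 0 < u (p t) ∧ x t ∈ Ico 0 (c (p t))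
    · obtain ⟨h1, h2, h3⟩ := h
      have hc := H.c_mem _ h1
      have hlt := powPart_strictMonoOn H.one_lt h2 hc.1 ⟨h3.1, h3.2.le⟩ ⟨hc.1.le, le_rfl⟩ h3.2
      rw [powPart_self H.one_lt _ hc.1] at hlt
      obtain ⟨ζ, hζ⟩ := H.exists_sub_eq h1 (H.powPart_mem h1 ⟨h3.1, h3.2.le⟩).1 hlt
        (H.u_mem _ h1).2
      exact ⟨ζ, fun _ => hζ⟩
    · exact ⟨0, fun h' => absurd h' h⟩
  choose ζ hζ using hex
  have hgood := (hpU.and (hup.and hxc)).mono fun t ht => hζ t ht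
  have hulim : Tendsto (fun t => u (p t)) 𝓕 (𝓝 1) := by
    rw [← hu]; exact (H.cont_u q hq).tendsto.comp hp
  have hclim : Tendsto (fun t => c (p t)) 𝓕 (𝓝 (c q)) := (H.tendsto_nhdsWithin_c hq).comp hp
  have hzlim : Tendsto (fun t => powPart α (u (p t)) (c (p t)) (x t)) 𝓕 (𝓝 1) := by
    have := (H.continuousOn_powPart (q, c q) ⟨hq, hcq.1.le, le_rfl⟩).tendsto.comp (tendsto_dom
      (tendsto_nhdsWithin_iff.1 hp).1 hx hpU (hxc.mono fun t ht => ⟨ht.1, ht.2.le⟩))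
    rw [powPart_self H.one_lt _ hcq.1, hu] at this
    exact this
  have hζlim : Tendsto ζ 𝓕 (𝓝 1) :=
    tendsto_of_tendsto_of_tendsto_of_le_of_le' hzlim hulim (hgood.mono fun t ht => ht.1.1.le)
      (hgood.mono fun t ht => ht.1.2.le)
  have hdlim : Tendsto (fun t => φ' (p t) (ζ t)) 𝓕 (𝓝 (φ' q 1)) := by
    refine (H.cont_dphi (q, 1) ⟨hq, by simp⟩).tendsto.comp (tendsto_nhdsWithin_iff.2
      ⟨(tendsto_nhdsWithin_iff.1 hp).1.prodMk_nhds hζlim, ?_⟩)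
    filter_upwards [hgood, hpU, hxc] with t h1 h2 h3
    exact ⟨h2, (H.powPart_mem h2 ⟨h3.1, h3.2.le⟩).1.trans h1.1.1.le,
      h1.1.2.le.trans (H.u_mem _ h2).2⟩
  have hd1 : 1 / 2 ≤ φ' q 1 := H.half_le q hq 1 (by simp)
  have hlim := ((hdlim.log (by linarith : φ' q 1 ≠ 0)).add (hulim.log one_ne_zero)).sub
    ((hclim.log hcq.1.ne').const_mul α)
  rw [Real.log_one, add_zero] at hlim
  refine hlim.congr' ?_
  filter_upwards [hgood, hpU, hup, hxc] with t h1 h2 h3 h4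
  have hc := H.c_mem _ h2
  have hz := H.powPart_mem h2 ⟨h4.1, h4.2.le⟩
  have hd := H.half_le _ h2 (ζ t) ⟨hz.1.trans h1.1.1.le, h1.1.2.le.trans (H.u_mem _ h2).2⟩
  have hc0 : 0 < c (p t) := hc.1
  have hpos : 0 < c (p t) - x t := by linarith [h4.2]
  rw [H.branch_self h2, branch, h1.2, sub_powPart_eq,
    show 1 - x t / c (p t) = (c (p t) - x t) / c (p t) by rw [sub_div, div_self hc.1.ne'],
    Real.log_mul (by linarith) (by positivity), Real.log_mul h3.ne' (by positivity),
    Real.log_rpow (by positivity), Real.log_div hpos.ne' hc.1.ne']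
  ring

end BranchFamily

open LorenzData

section Vertices

variable {α : ℝ} {U : Set (ℝ × ℝ)} {F : ℝ × ℝ → LorenzData} {φ' ψ' : ℝ × ℝ → ℝ → ℝ}

/-- The critical values of all full vertices with long return times are uniformly separated from
the critical point. -/
theorem exists_critVal_gap
    (HL : BranchFamily α U (fun p => (F p).phiL) φ' (fun p => (F p).u) (fun p => (F p).c))
    (HR : BranchFamily α U (fun p => flipMap (F p).phiR) ψ' (fun p => (F p).v)
      (fun p => 1 - (F p).c)) :
    ∃ s₀ : ℝ, 0 < s₀ ∧ ∀ p ∈ U, ∀ (a b : ℕ) (x l r : ℝ), 2 ≤ a → 2 ≤ b →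
      FullReturn α a b (F p) x l r → (F p).c + s₀ ≤ (F p).leftBranch α (F p).c ∧
        1 - (F p).c + s₀ ≤ (F p).rightBranch α (1 - (F p).c) := by
  obtain ⟨C₁, hC₁, h₁⟩ := HL.exists_critVal_sub_le
  obtain ⟨C₂, hC₂, h₂⟩ := HR.exists_critVal_sub_le
  obtain ⟨s₀, hs₀, hs⟩ := BranchFamily.exists_le_of_le_mul_rpow HL.one_lt
    (lt_max_of_lt_left hC₁ : 0 < max C₁ C₂)
  refine ⟨s₀, hs₀, fun p hp a b x l r ha hb hret => ?_⟩
  set s := (F p).leftBranch α (F p).c - (F p).c with hsdef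
  set t := (F p).rightBranch α (1 - (F p).c) - (1 - (F p).c) with htdef
  have hs0 : 0 < s := sub_pos.2 hret.lt_leftBranch
  have ht0 : 0 < t := sub_pos.2 hret.lt_rightBranch
  -- The right critical value lies at distance t below c. As b ≥ 2, its image under the left branch
  -- is still at most c, so the left critical value exceeds c by at most a multiple of t ^ α. The
  -- other inequality is symmetric.
  have hst : s ≤ max C₁ C₂ * t ^ α := by
    have h := h₁ p hp _ (hret.left_crit.1 0 (by omega)) (hret.left_crit.1 1 (by omega)).2
    have e : (F p).c - (1 - (F p).rightBranch α (1 - (F p).c)) = t := by rw [htdef]; ring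
    simp only [Function.iterate_zero, id, e] at h
    exact h.trans (mul_le_mul_of_nonneg_right (le_max_left _ _) (Real.rpow_nonneg ht0.le _))
  have hts : t ≤ max C₁ C₂ * s ^ α := by
    have h := h₂ p hp _ (hret.right_crit.1 0 (by omega)) (hret.right_crit.1 1 (by omega)).2
    have e : 1 - (F p).c - (1 - (F p).leftBranch α (F p).c) = s := by rw [hsdef]; ring
    simp only [Function.iterate_zero, id, e] at h
    exact h.trans (mul_le_mul_of_nonneg_right (le_max_right _ _) (Real.rpow_nonneg hs0.le _))
  have e1 := hs s t hs0 ht0 hst hts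
  have e2 := hs t s ht0 hs0 hts hst
  constructor <;> linarith

theorem one_sub_le_of_branch {X : Type*} [MetricSpace X] {U : Set X} {φ φ' : X → ℝ → ℝ}
    {u c : X → ℝ} (H : BranchFamily α U φ φ' u c) {p : X} (hp : p ∈ U) :
    1 - u p ≤ 2 * (1 - branch α (φ p) (u p) (c p) (c p)) := by
  have h := H.half_sub_le hp (H.u_mem p hp).1 (H.u_mem p hp).2 le_rfl
  rw [H.map_one p hp] at h
  rw [H.branch_self hp]
  linarith

variable {ι : Type*} {𝓕 : Filter ι} {p : ι → ℝ × ℝ} {a b : ι → ℕ} {x l r : ι → ℝ} {q : ℝ × ℝ}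

/-- Full vertices with long return times accumulate only at the full map. -/
theorem tendsto_param
    (HL : BranchFamily α U (fun p => (F p).phiL) φ' (fun p => (F p).u) (fun p => (F p).c))
    (HR : BranchFamily α U (fun p => flipMap (F p).phiR) ψ' (fun p => (F p).v)
      (fun p => 1 - (F p).c))
    (hq : ∀ p ∈ U, (F p).u = 1 → (F p).v = 1 → p = q)
    (ha : Tendsto a 𝓕 atTop) (hb : Tendsto b 𝓕 atTop) (hpU : ∀ᶠ t in 𝓕, p t ∈ U)
    (hret : ∀ᶠ t in 𝓕, FullReturn α (a t) (b t) (F (p t)) (x t) (l t) (r t)) :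
    Tendsto p 𝓕 (𝓝[U] q) := by
  refine tendsto_nhdsWithin_iff.2 ⟨?_, hpU⟩
  obtain ⟨s₀, hs₀, hgap⟩ := exists_critVal_gap HL HR
  -- The long orbits of the critical values under the opposite branches must start within δ of 0,
  -- which pushes both critical values, hence u and v, towards 1.
  have hsmall : ∀ δ > 0, ∀ᶠ t in 𝓕, (1 - (F (p t)).u) + (1 - (F (p t)).v) < 4 * δ := by
    intro δ hδ
    obtain ⟨N₁, hN₁⟩ := HL.exists_forall_lt_of_iterate_mem hs₀ hδ
    obtain ⟨N₂, hN₂⟩ := HR.exists_forall_lt_of_iterate_mem hs₀ hδ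
    filter_upwards [hpU, hret, ha.eventually (eventually_ge_atTop (max 2 N₂)),
      hb.eventually (eventually_ge_atTop (max 2 N₁))] with t h1 h2 h3 h4
    obtain ⟨g1, g2⟩ := hgap (p t) h1 (a t) (b t) _ _ _ ((le_max_left _ _).trans h3)
      ((le_max_left _ _).trans h4) h2
    have e1 := hN₁ (p t) h1 (by rw [← HL.branch_self h1]; exact g1) (b t)
      ((le_max_right _ _).trans h4) _ h2.left_crit.1
    have e2 := hN₂ (p t) h1 (by rw [← HR.branch_self h1]; exact g2) (a t)
      ((le_max_right _ _).trans h3) _ h2.right_crit.1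
    have e3 : 1 - (F (p t)).u ≤ 2 * (1 - (F (p t)).leftBranch α (F (p t)).c) :=
      one_sub_le_of_branch HL h1
    have e4 : 1 - (F (p t)).v ≤ 2 * (1 - (F (p t)).rightBranch α (1 - (F (p t)).c)) :=
      one_sub_le_of_branch HR h1
    linarith
  intro V hV
  change ∀ᶠ t in 𝓕, p t ∈ V
  obtain ⟨W, hWV, hWo, hqW⟩ := mem_nhds_iff.1 hV
  have hK : IsCompact (U \ W) := HL.isCompact.diff hWo
  have hcont : ContinuousOn (fun p => (1 - (F p).u) + (1 - (F p).v)) (U \ W) :=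
    ((continuousOn_const.sub HL.cont_u).add (continuousOn_const.sub HR.cont_u)).mono sdiff_subset
  rcases (U \ W).eq_empty_or_nonempty with he | hne
  · filter_upwards [hpU] with t ht
    by_contra hn
    have : p t ∈ U \ W := ⟨ht, fun h => hn (hWV h)⟩
    rw [he] at this
    exact this
  obtain ⟨z, hz, hmin⟩ := hK.exists_isMinOn hne hcont
  have hu := HL.u_mem z hz.1
  have hv := HR.u_mem z hz.1
  have hpos : 0 < (1 - (F z).u) + (1 - (F z).v) := by
    by_contra! hle
    have e1 : (F z).u = 1 := by linarith [hu.2, hv.2]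
    have e2 : (F z).v = 1 := by linarith [hu.2, hv.2]
    exact hz.2 (hq z hz.1 e1 e2 ▸ hqW)
  filter_upwards [hpU, hsmall _ (by linarith : 0 < ((1 - (F z).u) + (1 - (F z).v)) / 4)] with t h1 h2
  by_contra hn
  have h3 : (1 - (F z).u) + (1 - (F z).v) ≤ (1 - (F (p t)).u) + (1 - (F (p t)).v) :=
    hmin ⟨h1, fun h => hn (hWV h)⟩
  linarith

/-- One-sided estimate: the end of the return interval tends to the critical point. -/
theorem tendsto_end {X : Type*} [MetricSpace X] {U : Set X} {φ φ' : X → ℝ → ℝ} {u c : X → ℝ}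
    (H : BranchFamily α U φ φ' u c) {q : X} (hq : q ∈ U) (hu : u q = 1) {p : ι → X}
    (hp : Tendsto p 𝓕 (𝓝[U] q)) {y : ι → ℝ} (hy : ∀ᶠ t in 𝓕, y t ∈ Ico 0 (c (p t)))
    (hval : Tendsto (fun t => 1 - branch α (φ (p t)) (u (p t)) (c (p t)) (y t)) 𝓕 (𝓝 0)) :
    Tendsto y 𝓕 (𝓝 (c q)) := by
  have hα := H.one_lt
  have hulim : Tendsto (fun t => u (p t)) 𝓕 (𝓝 1) := by
    rw [← hu]; exact (H.cont_u q hq).tendsto.comp hp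
  have hclim : Tendsto (fun t => c (p t)) 𝓕 (𝓝 (c q)) := (H.tendsto_nhdsWithin_c hq).comp hp
  -- The critical value is at most 1 and exceeds the value at y by at least u/2 times this power; u
  -- > 1/2 eventually, hence the factor 4.
  have hpow : Tendsto (fun t => (c (p t) - y t) ^ α) 𝓕 (𝓝 0) := by
    have h4 : Tendsto (fun t => 4 * (1 - branch α (φ (p t)) (u (p t)) (c (p t)) (y t))) 𝓕
        (𝓝 0) := by simpa using hval.const_mul 4
    refine tendsto_of_tendsto_of_tendsto_of_le_of_le' tendsto_const_nhds h4 ?_ ?_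
    · filter_upwards [hy] with t ht using Real.rpow_nonneg (by linarith [ht.2]) _
    · filter_upwards [hy, (tendsto_nhdsWithin_iff.1 hp).2,
        hulim.eventually (lt_mem_nhds (by norm_num : (1 / 2 : ℝ) < 1))] with t h1 h2 h3
      have e1 := H.mul_rpow_le_branch_self_sub h2 (x := y t) ⟨h1.1, h1.2.le⟩
      have e2 := (H.branch_mem h2 (x := c (p t)) ⟨(H.c_mem _ h2).1.le, le_rfl⟩).2
      have e3 : 0 ≤ (c (p t) - y t) ^ α := Real.rpow_nonneg (by linarith [h1.2]) _
      nlinarith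
  have hdiff : Tendsto (fun t => c (p t) - y t) 𝓕 (𝓝 0) := by
    have h5 := hpow.rpow_const (p := 1 / α) (Or.inr (by positivity))
    rw [Real.zero_rpow (by positivity)] at h5
    refine h5.congr' ?_
    filter_upwards [hy] with t ht
    rw [← Real.rpow_mul (by linarith [ht.2]), mul_one_div_cancel (by linarith), Real.rpow_one]
  simpa using hclim.sub hdiff

/-- Take (M + 1)-st powers: a geometric sequence beats any power, and a ≤ A b lets ρ ^ b absorb the
powers of a. -/
theorem tendsto_nat_mul_norm_sub_of_pow_le {X : Type*} [SeminormedAddCommGroup X] {p : ι → X} {q : X}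
    {M : ℕ} {C ρ : ℝ} (hC : 0 ≤ C) (hρ0 : 0 < ρ) (hρ1 : ρ < 1) {A : ℝ}
    (hb : Tendsto b 𝓕 atTop) (ha : Tendsto a 𝓕 atTop)
    (hab : ∀ᶠ t in 𝓕, (a t : ℝ) ≤ A * b t)
    (hle : ∀ᶠ t in 𝓕, ‖p t - q‖ ^ (M + 1) ≤ C * (ρ ^ a t + ρ ^ b t)) :
    Tendsto (fun t => (a t : ℝ) * ‖p t - q‖) 𝓕 (𝓝 0) := by
  have hgeo := tendsto_pow_const_mul_const_pow_of_abs_lt_one (M + 1)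
    (by rwa [abs_of_pos hρ0] : |ρ| < 1)
  have h1 := ((hgeo.comp ha).const_mul C).add ((hgeo.comp hb).const_mul (C * A ^ (M + 1)))
  simp only [mul_zero, add_zero] at h1
  have hpow : Tendsto (fun t => ((a t : ℝ) * ‖p t - q‖) ^ (M + 1)) 𝓕 (𝓝 0) := by
    refine tendsto_of_tendsto_of_tendsto_of_le_of_le' tendsto_const_nhds h1
      (Eventually.of_forall fun t => by positivity) ?_
    filter_upwards [hle, hab] with t h2 h3
    rw [mul_pow]
    calc (a t : ℝ) ^ (M + 1) * ‖p t - q‖ ^ (M + 1)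
        ≤ (a t : ℝ) ^ (M + 1) * (C * (ρ ^ a t + ρ ^ b t)) := by gcongr
      _ = C * ((a t : ℝ) ^ (M + 1) * ρ ^ a t) + C * ((a t : ℝ) ^ (M + 1) * ρ ^ b t) := by ring
      _ ≤ C * ((a t : ℝ) ^ (M + 1) * ρ ^ a t) + C * ((A * b t) ^ (M + 1) * ρ ^ b t) := by gcongr
      _ = _ := by simp only [Function.comp]; ring
  rw [Metric.tendsto_nhds]
  intro δ hδ
  filter_upwards [hpow.eventually (gt_mem_nhds (pow_pos hδ (M + 1)))] with t ht
  rw [Real.dist_eq, sub_zero, abs_of_nonneg (by positivity)]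
  exact lt_of_pow_lt_pow_left₀ _ hδ.le ht

end Vertices

end

/-! ### Multipliers and the asymptotics of the renormalized critical point -/

section

namespace LorenzData

/-- The multiplier of the fixed point `0`. -/
noncomputable def leftMult (α : ℝ) (f : LorenzData) : ℝ :=
  branchDeriv α (deriv f.phiL) f.u f.c 0

/-- The multiplier of the fixed point `1`. -/
noncomputable def rightMult (α : ℝ) (f : LorenzData) : ℝ :=
  branchDeriv α (fun x => deriv f.phiR (1 - x)) f.v (1 - f.c) 0

theorem leftMult_eq (α : ℝ) (f : LorenzData) :
    f.leftMult α = deriv f.phiL 0 * (f.u * (α / f.c)) := by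
  simp [leftMult, branchDeriv, powPart_zero]

theorem rightMult_eq (α : ℝ) (f : LorenzData) :
    f.rightMult α = deriv f.phiR 1 * (f.v * (α / (1 - f.c))) := by
  simp [rightMult, branchDeriv, powPart_zero]

end LorenzData

open LorenzData

section

variable {α ε : ℝ} {U : Set (ℝ × ℝ)} {F : ℝ × ℝ → LorenzData} {q : ℝ × ℝ}

theorem isFull_iff {φ' ψ' : ℝ × ℝ → ℝ → ℝ}
    (HL : BranchFamily α U (fun p => (F p).phiL) φ' (fun p => (F p).u) (fun p => (F p).c))
    (HR : BranchFamily α U (fun p => flipMap (F p).phiR) ψ' (fun p => (F p).v)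
      (fun p => 1 - (F p).c)) {p : ℝ × ℝ} (hp : p ∈ U) :
    (F p).IsFull ↔ (F p).u = 1 ∧ (F p).v = 1 := by
  have h1 : (1 : ℝ) ∈ Icc (0 : ℝ) 1 := by simp
  have hL := (HL.strictMonoOn_phi hp).injOn.eq_iff (HL.u_mem p hp) h1
  have hR := (HR.strictMonoOn_phi hp).injOn.eq_iff (HR.u_mem p hp) h1
  rw [HL.map_one p hp] at hL
  rw [HR.map_one p hp, flipMap, sub_eq_self] at hR
  exact and_congr hL hR

theorem exists_eventually_abs_log_sub_le {lam : ℝ × ℝ → ℝ} (h : AnalyticAt ℝ lam q)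
    (h0 : lam q ≠ 0) :
    ∃ K : ℝ, ∀ᶠ p in 𝓝 q, |Real.log (lam p) - Real.log (lam q)| ≤ K * ‖p - q‖ := by
  obtain ⟨K, hK⟩ := ((h.differentiableAt.log h0).isBigO_sub).bound
  exact ⟨K, hK⟩

theorem IsAnalyticFamily.analyticAt_leftMult (hF : IsAnalyticFamily α U F) (hq : q ∈ U) :
    AnalyticAt ℝ (fun p => (F p).leftMult α) q := by
  simp only [leftMult_eq]
  have h1 : AnalyticAt ℝ (fun p => deriv (F p).phiL 0) q :=
    (analyticAt_uncurry_deriv (φ := fun p => (F p).phiL)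
      (hF.analytic_phiL (q, 0) ⟨hq, by simp⟩)).comp_of_eq (f := fun p : ℝ × ℝ => (p, (0 : ℝ)))
      (analyticAt_id.prod analyticAt_const) rfl
  exact h1.mul ((hF.analytic_u q hq).mul
    (analyticAt_const.div (hF.analytic_c q hq) (hF.isLorenz q hq).c_mem.1.ne'))

theorem IsAnalyticFamily.analyticAt_rightMult (hF : IsAnalyticFamily α U F) (hq : q ∈ U) :
    AnalyticAt ℝ (fun p => (F p).rightMult α) q := by
  simp only [rightMult_eq]
  have h1 : AnalyticAt ℝ (fun p => deriv (F p).phiR 1) q :=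
    (analyticAt_uncurry_deriv (φ := fun p => (F p).phiR)
      (hF.analytic_phiR (q, 1) ⟨hq, by simp⟩)).comp_of_eq (f := fun p : ℝ × ℝ => (p, (1 : ℝ)))
      (analyticAt_id.prod analyticAt_const) rfl
  exact h1.mul ((hF.analytic_v q hq).mul
    (analyticAt_const.div (analyticAt_const.sub (hF.analytic_c q hq))
      (by linarith [(hF.isLorenz q hq).c_mem.2])))

/-- This allows the n-th power of the multiplier at p to be replaced by that at q: log λ changes by
at most a multiple of ‖p - q‖. -/
theorem tendsto_nat_mul_log_sub {ι : Type*} {𝓕 : Filter ι} {p : ι → ℝ × ℝ} {n : ι → ℕ}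
    {lam : ℝ × ℝ → ℝ} (h : AnalyticAt ℝ lam q) (h0 : lam q ≠ 0) (hp : Tendsto p 𝓕 (𝓝 q))
    (hn : Tendsto (fun t => (n t : ℝ) * ‖p t - q‖) 𝓕 (𝓝 0)) :
    Tendsto (fun t => (n t : ℝ) * (Real.log (lam (p t)) - Real.log (lam q))) 𝓕 (𝓝 0) := by
  obtain ⟨K, hK⟩ := exists_eventually_abs_log_sub_le h h0
  have h1 : Tendsto (fun t => K * ((n t : ℝ) * ‖p t - q‖)) 𝓕 (𝓝 0) := by
    simpa using hn.const_mul K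
  refine squeeze_zero_norm' ?_ h1
  filter_upwards [hp.eventually hK] with t ht
  rw [norm_mul, Real.norm_natCast, Real.norm_eq_abs]
  calc (n t : ℝ) * |Real.log (lam (p t)) - Real.log (lam q)| ≤ (n t : ℝ) * (K * ‖p t - q‖) := by
        gcongr
    _ = _ := by ring

/-- The critical points of the renormalizations at full vertices: the logarithm of the ratio of the
two sides of the return interval is asymptotically affine in the return times. -/
theorem exists_tendsto_log_crit (hα : 1 < α) (hF : IsAnalyticFamily α U F) (hε : ε ≤ 1 / 2)
    (hclose : ∀ p ∈ U, (F p).IsCloseToStandard ε) (hq : IsUniqueFullParam U F q)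
    (hlL : 1 < (F q).leftMult α) (hlR : 1 < (F q).rightMult α)
    {ι : Type*} {𝓕 : Filter ι} {p : ι → ℝ × ℝ} {a b : ι → ℕ} {g : ι → LorenzData}
    (ha : Tendsto a 𝓕 atTop) (hb : Tendsto b 𝓕 atTop) {A : ℝ}
    (hab : ∀ᶠ t in 𝓕, (a t : ℝ) ≤ A * b t) (hba : ∀ᶠ t in 𝓕, (b t : ℝ) ≤ A * a t)
    (hvert : ∀ᶠ t in 𝓕, IsFullVertex α U F (a t) (b t) (p t) (g t)) :
    ∃ κ : ℝ, Tendsto (fun t => α * (Real.log (g t).c - Real.log (1 - (g t).c)) +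
      a t * Real.log ((F q).rightMult α) - b t * Real.log ((F q).leftMult α)) 𝓕 (𝓝 κ) := by
  have HL := hF.leftFamily hα hε hclose
  have HR := hF.rightFamily hα hε hclose
  obtain ⟨hqU, hqfull, huniq⟩ := hq
  obtain ⟨huq, hvq⟩ := (isFull_iff HL HR hqU).1 hqfull
  have hpU : ∀ᶠ t in 𝓕, p t ∈ U := hvert.mono fun t ht => ht.1
  have hex : ∀ t, ∃ lr : ℝ × ℝ, IsFullVertex α U F (a t) (b t) (p t) (g t) →
      FullReturn α (a t) (b t) (F (p t)) (g t).c lr.1 lr.2 := fun t => by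
    by_cases h : IsFullVertex α U F (a t) (b t) (p t) (g t)
    · obtain ⟨l, r, hlr⟩ := exists_fullReturn h.1 hα (hF.isLorenz _ h.1) HL HR h.2.1 h.2.2
      exact ⟨(l, r), fun _ => hlr⟩
    · exact ⟨0, fun h' => absurd h' h⟩
  choose lr hlr using hex
  set l : ι → ℝ := fun t => (lr t).1
  set r : ι → ℝ := fun t => (lr t).2
  have hret : ∀ᶠ t in 𝓕, FullReturn α (a t) (b t) (F (p t)) (g t).c (l t) (r t) :=
    hvert.mono fun t ht => hlr t ht
  have hp : Tendsto p 𝓕 (𝓝[U] q) := tendsto_param HL HR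
    (fun p hp h1 h2 => huniq p hp ((isFull_iff HL HR hp).2 ⟨h1, h2⟩)) ha hb hpU hret
  have hpq : Tendsto p 𝓕 (𝓝 q) := (tendsto_nhdsWithin_iff.1 hp).1
  obtain ⟨ρ₁, hρ₁0, hρ₁1, hρ₁⟩ := HL.exists_eventually_iterate_le_pow hqU huq hlL
  obtain ⟨ρ₂, hρ₂0, hρ₂1, hρ₂⟩ := HR.exists_eventually_iterate_le_pow hqU hvq hlR
  set ρ := max ρ₁ ρ₂
  have hρ0 : 0 < ρ := lt_max_of_lt_left hρ₁0
  have hρ1 : ρ < 1 := max_lt hρ₁1 hρ₂1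
  -- Contraction backwards along the whole orbit puts its starting point within ρ ^ b of 0.
  have hLpow : ∀ᶠ t in 𝓕, 1 - (F (p t)).rightBranch α (1 - (F (p t)).c) ≤ ρ ^ b t ∧
      1 - (F (p t)).rightBranch α (1 - r t) ≤ ρ ^ b t := by
    filter_upwards [hret, hp.eventually hρ₁, hb.eventually (eventually_ge_atTop 1)] with t h1 h2 h3
    have hle : ρ₁ ^ b t ≤ ρ ^ b t := pow_le_pow_left₀ hρ₁0.le (le_max_left _ _) _
    have e1 := h2 (b t) _ h3 h1.left_crit.1 (b t) le_rfl
    have e2 := h2 (b t) _ h3 h1.left_end.1 (b t) le_rfl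
    rw [Nat.sub_self, Function.iterate_zero, id] at e1 e2
    exact ⟨e1.trans hle, e2.trans hle⟩
  have hRpow : ∀ᶠ t in 𝓕, 1 - (F (p t)).leftBranch α (F (p t)).c ≤ ρ ^ a t ∧
      1 - (F (p t)).leftBranch α (l t) ≤ ρ ^ a t := by
    filter_upwards [hret, hp.eventually hρ₂, ha.eventually (eventually_ge_atTop 1)] with t h1 h2 h3
    have hle : ρ₂ ^ a t ≤ ρ ^ a t := pow_le_pow_left₀ hρ₂0.le (le_max_right _ _) _
    have e1 := h2 (a t) _ h3 h1.right_crit.1 (a t) le_rfl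
    have e2 := h2 (a t) _ h3 h1.right_end.1 (a t) le_rfl
    rw [Nat.sub_self, Function.iterate_zero, id] at e1 e2
    exact ⟨e1.trans hle, e2.trans hle⟩
  have hgeo := tendsto_pow_atTop_nhds_zero_of_lt_one hρ0.le hρ1
  have hlmem : ∀ᶠ t in 𝓕, l t ∈ Ico 0 (F (p t)).c :=
    hret.mono fun t ht => ⟨ht.l_nonneg, ht.l_lt⟩
  have hrmem : ∀ᶠ t in 𝓕, 1 - r t ∈ Ico 0 (1 - (F (p t)).c) :=
    hret.mono fun t ht => ⟨by linarith [ht.r_le], by linarith [ht.lt_r]⟩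
  have hllim : Tendsto l 𝓕 (𝓝 (F q).c) := by
    refine tendsto_end HL hqU huq hp hlmem (tendsto_of_tendsto_of_tendsto_of_le_of_le'
      tendsto_const_nhds (hgeo.comp ha) ?_ (hRpow.mono fun t ht => ht.2))
    filter_upwards [hpU, hlmem] with t h1 h2
    linarith [(HL.branch_mem h1 (x := l t) ⟨h2.1, h2.2.le⟩).2]
  have hrlim : Tendsto (fun t => 1 - r t) 𝓕 (𝓝 (1 - (F q).c)) := by
    refine tendsto_end HR hqU hvq hp hrmem (tendsto_of_tendsto_of_tendsto_of_le_of_le'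
      tendsto_const_nhds (hgeo.comp hb) ?_ (hLpow.mono fun t ht => ht.2))
    filter_upwards [hpU, hrmem] with t h1 h2
    linarith [(HR.branch_mem h1 (x := 1 - r t) ⟨h2.1, h2.2.le⟩).2]
  have hup := hp.eventually (HL.eventually_u_pos hqU huq)
  have hvp := hp.eventually (HR.eventually_u_pos hqU hvq)
  have hLlt : ∀ᶠ t in 𝓕, (F (p t)).leftBranch α (l t) < (F (p t)).leftBranch α (F (p t)).c := by
    filter_upwards [hup, hpU, hlmem] with t h1 h2 h3
    exact HL.strictMonoOn_branch h2 h1 ⟨h3.1, h3.2.le⟩ ⟨(HL.c_mem _ h2).1.le, le_rfl⟩ h3.2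
  have hRlt : ∀ᶠ t in 𝓕,
      (F (p t)).rightBranch α (1 - r t) < (F (p t)).rightBranch α (1 - (F (p t)).c) := by
    filter_upwards [hvp, hpU, hrmem] with t h1 h2 h3
    exact HR.strictMonoOn_branch h2 h1 ⟨h3.1, h3.2.le⟩ ⟨(HR.c_mem _ h2).1.le, le_rfl⟩ h3.2
  -- The interval from 1 - L(c) to 1 - L(l) is mapped by R^a to that from 1 - r to 1 - l; both ends
  -- tend to the critical point 1 - c of the flipped branch.
  obtain ⟨κ₁, hκ₁⟩ := HR.exists_tendsto_log_iterate_sub hqU hvq hlR hp ha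
    (x := fun t => 1 - (F (p t)).leftBranch α (F (p t)).c)
    (y := fun t => 1 - (F (p t)).leftBranch α (l t))
    (hLlt.mono fun t ht => by linarith) (hret.mono fun t ht => ht.right_crit.1)
    (hret.mono fun t ht => ht.right_end.1)
    (hrlim.congr' (hret.mono fun t ht => ht.right_crit.2.symm))
    ((hllim.const_sub 1).congr' (hret.mono fun t ht => ht.right_end.2.symm))
  obtain ⟨κ₂, hκ₂⟩ := HL.exists_tendsto_log_iterate_sub hqU huq hlL hp hb
    (x := fun t => 1 - (F (p t)).rightBranch α (1 - (F (p t)).c))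
    (y := fun t => 1 - (F (p t)).rightBranch α (1 - r t))
    (hRlt.mono fun t ht => by linarith) (hret.mono fun t ht => ht.left_crit.1)
    (hret.mono fun t ht => ht.left_end.1)
    (hllim.congr' (hret.mono fun t ht => ht.left_crit.2.symm))
    ((show Tendsto r 𝓕 (𝓝 (F q).c) by simpa using hrlim.const_sub 1).congr'
      (hret.mono fun t ht => ht.left_end.2.symm))
  have hcL := HL.tendsto_log_branch_self_sub hqU huq hp hlmem hllim
  have hcR := HR.tendsto_log_branch_self_sub hqU hvq hp hrmem hrlim
  -- On U the nonnegative function (1 - u) + (1 - v) vanishes only at q, so it controls a power of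
  -- ‖p - q‖.
  obtain ⟨M, c, hc, hM⟩ := hF.semianalytic.exists_eventually_mul_norm_pow_le hF.isCompact.isClosed
    (h := fun p => (1 - (F p).u) + (1 - (F p).v)) (p := q)
    ((analyticAt_const.sub (hF.analytic_u q hqU)).add (analyticAt_const.sub (hF.analytic_v q hqU)))
    (by rw [huq, hvq]; ring)
    (fun z hz h0 => by
      have hu := HL.u_mem z hz
      have hv := HR.u_mem z hz
      exact huniq z hz ((isFull_iff HL HR hz).2
        ⟨by linarith [hu.2, hv.2], by linarith [hu.2, hv.2]⟩))
  have hdist : ∀ᶠ t in 𝓕, ‖p t - q‖ ^ (M + 1) ≤ 2 / c * (ρ ^ a t + ρ ^ b t) := by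
    filter_upwards [hpq.eventually hM, hpq.eventually (Metric.ball_mem_nhds q one_pos), hpU, hLpow,
      hRpow] with t h1 h2 h3 h4 h5
    have hn1 : ‖p t - q‖ ≤ 1 := by rw [← dist_eq_norm]; exact le_of_lt h2
    have e1 : 1 - (F (p t)).u ≤ 2 * (1 - (F (p t)).leftBranch α (F (p t)).c) :=
      one_sub_le_of_branch HL h3
    have e2 : 1 - (F (p t)).v ≤ 2 * (1 - (F (p t)).rightBranch α (1 - (F (p t)).c)) :=
      one_sub_le_of_branch HR h3
    have e3 := h1 h3
    rw [abs_of_nonneg (by linarith [(HL.u_mem _ h3).2, (HR.u_mem _ h3).2])] at e3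
    have e4 : ‖p t - q‖ ^ (M + 1) ≤ ‖p t - q‖ ^ M :=
      pow_le_pow_of_le_one (norm_nonneg _) hn1 (Nat.le_succ M)
    rw [div_mul_eq_mul_div, le_div_iff₀ hc]
    calc ‖p t - q‖ ^ (M + 1) * c ≤ ‖p t - q‖ ^ M * c := by gcongr
      _ ≤ _ := by linarith [h4.1, h5.1]
  have hna : Tendsto (fun t => (a t : ℝ) * ‖p t - q‖) 𝓕 (𝓝 0) :=
    tendsto_nat_mul_norm_sub_of_pow_le (by positivity) hρ0 hρ1 hb ha hab hdist
  have hnb : Tendsto (fun t => (b t : ℝ) * ‖p t - q‖) 𝓕 (𝓝 0) :=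
    tendsto_nat_mul_norm_sub_of_pow_le (M := M) (C := 2 / c) (by positivity) hρ0 hρ1 ha hb hba
      (hdist.mono fun t ht => by rw [add_comm (ρ ^ a t)] at ht; exact ht)
  have hlamL := tendsto_nat_mul_log_sub (hF.analyticAt_leftMult hqU)
    (by linarith : (F q).leftMult α ≠ 0) hpq hnb
  have hlamR := tendsto_nat_mul_log_sub (hF.analyticAt_rightMult hqU)
    (by linarith : (F q).rightMult α ≠ 0) hpq hna
  -- Subtracting the two expressions for log(r - l) cancels it and leaves α log((c - l)/(r - c))
  -- with the two multiplier terms.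
  refine ⟨_, ((((hκ₂.add hcR).add hlamL).sub ((hκ₁.add hcL).add hlamR))).congr' ?_⟩
  filter_upwards [hret] with t ht
  have h1 : 0 < (F (p t)).c - l t := sub_pos.2 ht.l_lt
  have h2 : 0 < r t - (F (p t)).c := sub_pos.2 ht.lt_r
  have h3 : 0 < r t - l t := by linarith
  have hgc : Real.log (g t).c = Real.log ((F (p t)).c - l t) - Real.log (r t - l t) := by
    rw [ht.crit_eq, Real.log_div h1.ne' h3.ne']
  have hgc' : Real.log (1 - (g t).c) = Real.log (r t - (F (p t)).c) - Real.log (r t - l t) := by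
    rw [ht.crit_eq, ← Real.log_div h2.ne' h3.ne']
    congr 1
    field_simp
    ring
  have e1 := ht.left_crit.2
  have e2 := ht.left_end.2
  have e3 := ht.right_crit.2
  have e4 := ht.right_end.2
  simp only [leftBranch, rightBranch] at e1 e2 e3 e4
  simp only [leftBranch, rightBranch, e1, e2, e3, e4]
  rw [hgc, hgc']
  simp only [leftMult, rightMult]
  have e5 : ∀ y z : ℝ, 1 - y - (1 - z) = z - y := fun y z => by ring
  simp only [e5]
  ring

end

end

/-! ### Numerical constants, rounding, and the final assembly -/

section

variable {α : ℝ}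

theorem one_lt_thetaCrit (hα : 1 < α) : 1 < thetaCrit α := by
  have h1 : 0 < Real.log 2 := Real.log_pos one_lt_two
  have h2 : 0 < Real.log (3 * α) := Real.log_pos (by linarith)
  have := div_pos h1 h2
  rw [thetaCrit]
  linarith

/-- Comparing with e, log y ≤ y / e gives log(3α/2) ≤ 3α/(2e) ≤ (3/5) α, while log(7/2) ≥ 2 - 2e/7 >
6/5. -/
theorem two_mul_log_three_halves_mul_lt (hα : 1 < α) :
    2 * Real.log (3 / 2 * α) < α * (Real.log 7 - Real.log 2) := by
  have he1 := Real.exp_one_gt_d9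
  have he2 := Real.exp_one_lt_d9
  have h1 : Real.log (3 / 2 * α / Real.exp 1) ≤ 3 / 2 * α / Real.exp 1 - 1 :=
    Real.log_le_sub_one_of_pos (by positivity)
  rw [Real.log_div (by positivity) (Real.exp_pos 1).ne', Real.log_exp] at h1
  have h2 := Real.one_sub_inv_le_log_of_pos (x := 7 / 2 / Real.exp 1) (by positivity)
  rw [Real.log_div (by norm_num) (Real.exp_pos 1).ne', Real.log_exp,
    Real.log_div (by norm_num) (by norm_num), inv_div] at h2
  have h3 : 3 / 2 * α / Real.exp 1 ≤ α * (3 / 5) := by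
    rw [div_le_iff₀ (Real.exp_pos 1)]
    nlinarith
  have h4 : 6 / 5 < Real.log 7 - Real.log 2 := by linarith
  nlinarith

/-- A distance to standard maps within which the multipliers at the full map are controlled. -/
theorem exists_closeness (hα : 1 < α) : ∃ ε : ℝ, 0 < ε ∧ ε ≤ 1 / 2 ∧ 1 < (1 - ε) * α ∧
    thetaCrit α < Real.log (3 * α * (1 - ε)) / Real.log (3 / 2 * α * (1 + ε)) ∧
    2 * Real.log (3 / 2 * α * (1 + ε)) < α * (Real.log 7 - Real.log 2) := by
  have hl2 : 0 < Real.log 2 := Real.log_pos one_lt_two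
  have hL : 0 < Real.log (3 / 2 * α) := Real.log_pos (by linarith)
  have hc1 : ContinuousAt (fun ε : ℝ => Real.log (3 / 2 * α * (1 + ε))) 0 :=
    ContinuousAt.log (by fun_prop) (by simp; linarith)
  have hc2 : ContinuousAt (fun ε : ℝ => Real.log (3 * α * (1 - ε))) 0 :=
    ContinuousAt.log (by fun_prop) (by simp; linarith)
  have hc3 := hc2.div hc1 (by simpa using hL.ne')
  have hc4 : ContinuousAt (fun ε : ℝ => (1 - ε) * α) 0 := by fun_prop
  have e1 : ∀ᶠ ε : ℝ in 𝓝 0, 1 < (1 - ε) * α :=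
    hc4.eventually (lt_mem_nhds (by simpa using hα))
  -- At ε = 0, with k = log 2 and L = log(3α/2), the claim is (k + L)/L > 1 + k/(k + L), whose
  -- difference cleared of L is k²/(k + L). All conditions are open, so they persist for small ε.
  have e2 := hc3.eventually (lt_mem_nhds (a := thetaCrit α) (by
    have h3 : Real.log (3 * α) = Real.log 2 + Real.log (3 / 2 * α) := by
      rw [← Real.log_mul (by norm_num) (by positivity)]
      ring_nf
    simp only [Pi.div_apply, sub_zero, add_zero, mul_one, thetaCrit]
    rw [h3, lt_div_iff₀ hL, ← sub_pos]
    generalize Real.log (3 / 2 * α) = L at hL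
    generalize Real.log 2 = k at hl2
    have : k + L - (1 + k / (k + L)) * L = k ^ 2 / (k + L) := by
      field_simp
      ring
    rw [this]
    positivity))
  have e3 := (hc1.const_mul 2).eventually (gt_mem_nhds (a := α * (Real.log 7 - Real.log 2)) (by
    simpa using two_mul_log_three_halves_mul_lt hα))
  have e4 : ∀ᶠ ε : ℝ in 𝓝 0, ε ≤ 1 / 2 := ge_mem_nhds (by norm_num)
  obtain ⟨ε, ⟨⟨⟨h1, h2⟩, h3⟩, h4⟩, h0⟩ := ((((e1.and e2).and e3).and e4).filter_mono
    nhdsWithin_le_nhds |>.and (self_mem_nhdsWithin (s := Ioi (0 : ℝ)))).exists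
  exact ⟨ε, h0, h4, h1, h2, h3⟩

theorem log_sub_log_one_sub_le_iff {x : ℝ} (hx : x ∈ Ioo (0 : ℝ) 1) {k : ℝ} (hk : 0 < k) :
    Real.log x - Real.log (1 - x) ≤ Real.log k ↔ x ≤ k * (1 - x) := by
  have h1 : 0 < 1 - x := by linarith [hx.2]
  rw [← Real.log_div hx.1.ne' h1.ne', Real.log_le_log_iff (div_pos hx.1 h1) hk, div_le_iff₀ h1]

theorem le_log_sub_log_one_sub_iff {x : ℝ} (hx : x ∈ Ioo (0 : ℝ) 1) {k : ℝ} (hk : 0 < k) :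
    Real.log k ≤ Real.log x - Real.log (1 - x) ↔ k * (1 - x) ≤ x := by
  have h1 : 0 < 1 - x := by linarith [hx.2]
  rw [← Real.log_div hx.1.ne' h1.ne', Real.log_le_log_iff hk (div_pos hx.1 h1), le_div_iff₀ h1]

/-- If the log-odds of `x` are, up to a small error, an affine function of the integers `a` and `b`,
then keeping `b` at a fixed distance from `⌊θ * a⌋` controls `x`. -/
theorem exists_floor_sub_of_abs_log_le {V : ℕ → ℕ → ℝ → Prop}
    (hV : ∀ a b x, V a b x → x ∈ Ioo (0 : ℝ) 1) {Λ₀ Λ₁ κ : ℝ} (hα : 0 < α) (h₀ : 0 < Λ₀) (h₁ : 0 < Λ₁)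
    (hsmall : 2 * Λ₀ < α * (Real.log 7 - Real.log 2))
    (h : ∀ η > 0, ∃ N : ℕ, ∀ a b x, V a b x → N ≤ a → Λ₁ / Λ₀ / 2 * a ≤ b → b ≤ 2 * (Λ₁ / Λ₀) * a →
      |α * (Real.log x - Real.log (1 - x)) + a * Λ₁ - b * Λ₀ - κ| ≤ η) :
    ∃ N n m : ℤ, ∀ a : ℕ, N ≤ (a : ℤ) →
      1 ≤ ⌊Λ₁ / Λ₀ * (a : ℝ)⌋ - n ∧ 1 ≤ ⌊Λ₁ / Λ₀ * (a : ℝ)⌋ - m ∧ ∀ b x, V a b x →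
        ((b : ℤ) = ⌊Λ₁ / Λ₀ * (a : ℝ)⌋ - n → 1 / 8 ≤ x ∧ x ≤ 1 / 3) ∧
        ((b : ℤ) = ⌊Λ₁ / Λ₀ * (a : ℝ)⌋ - m → 2 / 3 ≤ x) := by
  set θ := Λ₁ / Λ₀ with hθ
  have hθ0 : 0 < θ := div_pos h₁ h₀
  have hΛ : Λ₁ = Λ₀ * θ := by rw [hθ]; field_simp
  obtain ⟨η, hη0, hη⟩ : ∃ η > 0, 2 * Λ₀ + 2 * η ≤ α * (Real.log 7 - Real.log 2) :=
    ⟨(α * (Real.log 7 - Real.log 2) - 2 * Λ₀) / 2, by linarith, by linarith⟩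
  obtain ⟨N, hN⟩ := h η hη0
  -- The least n that forces odds at most 1/2, i.e. x ≤ 1/3. Rounding n and rounding θa each cost at
  -- most Λ₀ and the error costs 2η, so `hη` keeps the odds at least 1/7, i.e. x ≥ 1/8. The integer
  -- m is small enough to force odds at least 2.
  set n : ℤ := ⌈(κ + η + α * Real.log 2) / Λ₀⌉
  set m : ℤ := ⌊(κ - η - α * Real.log 2) / Λ₀⌋ - 1
  have hn1 : κ + η + α * Real.log 2 ≤ n * Λ₀ := (div_le_iff₀ h₀).1 (Int.le_ceil _)
  have hn2 : (n - 1) * Λ₀ < κ + η + α * Real.log 2 :=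
    (lt_div_iff₀ h₀).1 (by linarith [Int.ceil_lt_add_one ((κ + η + α * Real.log 2) / Λ₀)])
  have hm : (m + 1) * Λ₀ ≤ κ - η - α * Real.log 2 :=
    (le_div_iff₀ h₀).1 (by
      simp only [m, Int.cast_sub, Int.cast_one, sub_add_cancel]
      exact Int.floor_le _)
  have key : ∀ (k : ℤ) (a : ℕ), N ≤ a → 2 + |(k : ℝ)| ≤ θ / 2 * a → 1 ≤ ⌊θ * (a : ℝ)⌋ - k ∧
      ∀ b x, V a b x → (b : ℤ) = ⌊θ * (a : ℝ)⌋ - k →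
        κ - η - (k + 1) * Λ₀ ≤ α * (Real.log x - Real.log (1 - x)) ∧
        α * (Real.log x - Real.log (1 - x)) ≤ κ + η - k * Λ₀ := by
    intro k a ha hk
    have hf1 := Int.floor_le (θ * (a : ℝ))
    have hf2 := Int.lt_floor_add_one (θ * (a : ℝ))
    have hk1 := le_abs_self (k : ℝ)
    have hk2 := neg_abs_le (k : ℝ)
    refine ⟨?_, fun b x hx hb => ?_⟩
    · have : (1 : ℝ) ≤ ⌊θ * (a : ℝ)⌋ - k := by linarith
      exact_mod_cast this
    · have hb' : (b : ℝ) = ⌊θ * (a : ℝ)⌋ - k := by exact_mod_cast congrArg (Int.cast : ℤ → ℝ) hb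
      have := abs_le.1 (hN a b x hx ha (by linarith) (by linarith))
      have g1 : Λ₀ * (b : ℝ) ≤ Λ₀ * (θ * a - k) := mul_le_mul_of_nonneg_left (by linarith) h₀.le
      have g2 : Λ₀ * (θ * a - 1 - k) ≤ Λ₀ * (b : ℝ) :=
        mul_le_mul_of_nonneg_left (by linarith) h₀.le
      rw [hΛ] at this
      constructor <;> linarith [this.1, this.2]
  -- Such a large a keeps ⌊θa⌋ - k at least 1 and between θa/2 and 2θa for both shifts k, as the
  -- asymptotic estimate requires.
  refine ⟨max N ⌈(2 + |(n : ℝ)| + |(m : ℝ)|) / (θ / 2)⌉, n, m, fun a ha => ?_⟩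
  have haN : N ≤ a := by exact_mod_cast (le_max_left _ _).trans ha
  have haθ : 2 + |(n : ℝ)| + |(m : ℝ)| ≤ θ / 2 * a := by
    have := Int.ceil_le.1 ((le_max_right _ _).trans ha)
    rw [div_le_iff₀ (by positivity), mul_comm] at this
    exact_mod_cast this
  obtain ⟨hn3, hn4⟩ := key n a haN (by linarith [abs_nonneg (m : ℝ)])
  obtain ⟨hm3, hm4⟩ := key m a haN (by linarith [abs_nonneg (n : ℝ)])
  refine ⟨hn3, hm3, fun b x hx => ⟨fun hb => ?_, fun hb => ?_⟩⟩
  · obtain ⟨i1, i2⟩ := hn4 b x hx hb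
    have j1 : Real.log (7⁻¹) ≤ Real.log x - Real.log (1 - x) := by
      rw [Real.log_inv]
      exact le_of_mul_le_mul_left (by linarith) hα
    have j2 : Real.log x - Real.log (1 - x) ≤ Real.log (2⁻¹) := by
      rw [Real.log_inv]
      exact le_of_mul_le_mul_left (by linarith) hα
    rw [le_log_sub_log_one_sub_iff (hV _ _ _ hx) (by norm_num)] at j1
    rw [log_sub_log_one_sub_le_iff (hV _ _ _ hx) (by norm_num)] at j2
    constructor <;> linarith
  · obtain ⟨i1, i2⟩ := hm4 b x hx hb
    have j1 : Real.log 2 ≤ Real.log x - Real.log (1 - x) :=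
      le_of_mul_le_mul_left (by linarith) hα
    rw [le_log_sub_log_one_sub_iff (hV _ _ _ hx) (by norm_num)] at j1
    linarith

variable {U : Set (ℝ × ℝ)} {F : ℝ × ℝ → LorenzData} {q : ℝ × ℝ} {ε : ℝ}

/-- The multiplier bounds at the full map that closeness to standard maps gives. -/
theorem mult_mem_Icc (hα : 1 < α) (hF : IsAnalyticFamily α U F) (hε : ε ≤ 1 / 2)
    (hclose : ∀ p ∈ U, (F p).IsCloseToStandard ε) (hq : IsUniqueFullParam U F q) :
    (F q).leftMult α ∈ Icc ((1 - ε) * (α / (F q).c)) ((1 + ε) * (α / (F q).c)) ∧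
    (F q).rightMult α ∈ Icc ((1 - ε) * (α / (1 - (F q).c))) ((1 + ε) * (α / (1 - (F q).c))) := by
  obtain ⟨hqU, hfull, -⟩ := hq
  obtain ⟨hu, hv⟩ :=
    (isFull_iff (hF.leftFamily hα hε hclose) (hF.rightFamily hα hε hclose) hqU).1 hfull
  have hc := (hF.isLorenz q hqU).c_mem
  have h0 : (0 : ℝ) ∈ Icc (0 : ℝ) 1 := by simp
  have h1 : (1 : ℝ) ∈ Icc (0 : ℝ) 1 := by simp
  have hL := ((hclose q hqU).1 0 h0).2.1
  have hR := ((hclose q hqU).2 1 h1).2.1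
  rw [iteratedDerivWithin_one_eq_deriv h0
    (hasDerivAt_of_analyticAt_uncurry (φ := fun p => (F p).phiL)
      (hF.analytic_phiL (q, 0) ⟨hqU, h0⟩)).differentiableAt,
    abs_le] at hL
  rw [iteratedDerivWithin_one_eq_deriv h1
    (hasDerivAt_of_analyticAt_uncurry (φ := fun p => (F p).phiR)
      (hF.analytic_phiR (q, 1) ⟨hqU, h1⟩)).differentiableAt,
    abs_le] at hR
  have hcL : 0 ≤ α / (F q).c := div_nonneg (by linarith) hc.1.le
  have hcR : 0 ≤ α / (1 - (F q).c) := div_nonneg (by linarith) (by linarith [hc.2])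
  rw [LorenzData.leftMult_eq, LorenzData.rightMult_eq, hu, hv, one_mul, one_mul]
  exact ⟨⟨mul_le_mul_of_nonneg_right (by linarith) hcL,
    mul_le_mul_of_nonneg_right (by linarith) hcL⟩,
    mul_le_mul_of_nonneg_right (by linarith) hcR, mul_le_mul_of_nonneg_right (by linarith) hcR⟩

theorem IsFullVertex.c_mem {a b : ℕ} {p : ℝ × ℝ} {g : LorenzData} (h : IsFullVertex α U F a b p g) :
    g.c ∈ Ioo (0 : ℝ) 1 := h.2.1.2.2.1.c_mem

/-- Apply `exists_tendsto_log_crit` along the filter of all full vertices with a → ∞ and b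
comparable to a: convergence along it is uniformity over the vertices, and no sequence has to be
chosen. -/
theorem exists_forall_abs_log_crit_sub_le (hα : 1 < α) (hF : IsAnalyticFamily α U F)
    (hε : ε ≤ 1 / 2) (hclose : ∀ p ∈ U, (F p).IsCloseToStandard ε) (hq : IsUniqueFullParam U F q)
    (hlL : 1 < (F q).leftMult α) (hlR : 1 < (F q).rightMult α) {θ : ℝ} (hθ : 0 < θ) :
    ∃ κ : ℝ, ∀ η > 0, ∃ N : ℕ, ∀ a b p g, IsFullVertex α U F a b p g → N ≤ a →
      θ / 2 * a ≤ b → b ≤ 2 * θ * a →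
      |α * (Real.log g.c - Real.log (1 - g.c)) + a * Real.log ((F q).rightMult α) -
        b * Real.log ((F q).leftMult α) - κ| ≤ η := by
  set S : Set (ℕ × ℕ × (ℝ × ℝ) × LorenzData) :=
    {t | IsFullVertex α U F t.1 t.2.1 t.2.2.1 t.2.2.2 ∧ θ / 2 * t.1 ≤ t.2.1 ∧ t.2.1 ≤ 2 * θ * t.1}
  set 𝓕 := comap (fun t : ℕ × ℕ × (ℝ × ℝ) × LorenzData => t.1) atTop ⊓ 𝓟 S
  have hS : ∀ᶠ t in 𝓕, t ∈ S := mem_inf_of_right (mem_principal_self S)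
  have ha : Tendsto (fun t : ℕ × ℕ × (ℝ × ℝ) × LorenzData => t.1) 𝓕 atTop :=
    tendsto_comap.mono_left inf_le_left
  have hb : Tendsto (fun t : ℕ × ℕ × (ℝ × ℝ) × LorenzData => t.2.1) 𝓕 atTop :=
    tendsto_natCast_atTop_iff.1 (tendsto_atTop_mono' 𝓕 (hS.mono fun t ht => ht.2.1)
      ((tendsto_natCast_atTop_iff.2 ha).const_mul_atTop (by positivity)))
  obtain ⟨κ, hκ⟩ := exists_tendsto_log_crit hα hF hε hclose hq hlL hlR (𝓕 := 𝓕)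
    (p := fun t => t.2.2.1) (g := fun t => t.2.2.2) ha hb (A := max (2 / θ) (2 * θ))
    (hS.mono fun t ht => by
      have h1 : (t.1 : ℝ) ≤ 2 / θ * t.2.1 := by
        rw [div_mul_eq_mul_div, le_div_iff₀ hθ]
        linarith [ht.2.1]
      exact h1.trans (mul_le_mul_of_nonneg_right (le_max_left _ _) (Nat.cast_nonneg _)))
    (hS.mono fun t ht => ht.2.2.trans
      (mul_le_mul_of_nonneg_right (le_max_right _ _) (Nat.cast_nonneg _)))
    (hS.mono fun t ht => ht.1)
  refine ⟨κ, fun η hη => ?_⟩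
  have h1 := hκ.eventually (Metric.closedBall_mem_nhds κ hη)
  rw [eventually_inf_principal, eventually_comap] at h1
  obtain ⟨N, hN⟩ := eventually_atTop.1 h1
  exact ⟨N, fun a b p g hv haN hab hba => hN a haN (a, b, p, g) rfl ⟨hv, hab, hba⟩⟩

theorem thetaCrit_lt_div_log {x y : ℝ} (hα : 1 < α) (hε0 : 0 < ε) (hε1 : ε ≤ 1 / 2) (hx : 1 < x)
    (hθ : thetaCrit α < Real.log (3 * α * (1 - ε)) / Real.log (3 / 2 * α * (1 + ε)))
    (hxle : x ≤ 3 / 2 * α * (1 + ε)) (hley : 3 * α * (1 - ε) ≤ y) :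
    thetaCrit α < Real.log y / Real.log x := by
  have h1 : 0 < 3 * α * (1 - ε) := mul_pos (by linarith) (by linarith)
  have h2 : 1 ≤ 3 * α * (1 - ε) := by nlinarith
  refine hθ.trans_le ?_
  gcongr
  · exact (Real.log_nonneg h2).trans (Real.log_le_log h1 hley)
  · exact Real.log_pos hx

end

theorem mainTheorem4 (α : ℝ) (hα : 1 < α) :
    ∃ ε : ℝ, 0 < ε ∧
      ∀ (U : Set (ℝ × ℝ)) (F : ℝ × ℝ → LorenzData) (pfull : ℝ × ℝ),
        IsAnalyticFamily α U F →
        (∀ p ∈ U, (F p).IsCloseToStandard ε) →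
        IsUniqueFullParam U F pfull →
        (2 / 3 ≤ (F pfull).c →
          ∃ θ : ℝ, thetaCrit α < θ ∧ 1 < thetaCrit α ∧ ∃ N n m : ℤ,
            ∀ a : ℕ, N ≤ (a : ℤ) →
              1 ≤ ⌊θ * (a : ℝ)⌋ - n ∧ 1 ≤ ⌊θ * (a : ℝ)⌋ - m ∧
              ∀ (b : ℕ) (p : ℝ × ℝ) (g : LorenzData), IsFullVertex α U F a b p g →
                ((b : ℤ) = ⌊θ * (a : ℝ)⌋ - n → 1 / 8 ≤ g.c ∧ g.c ≤ 1 / 3) ∧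
                ((b : ℤ) = ⌊θ * (a : ℝ)⌋ - m → 2 / 3 ≤ g.c)) ∧
        ((F pfull).c ≤ 1 / 3 →
          ∃ θ : ℝ, thetaCrit α < θ ∧ 1 < thetaCrit α ∧ ∃ N n m : ℤ,
            ∀ b : ℕ, N ≤ (b : ℤ) →
              1 ≤ ⌊θ * (b : ℝ)⌋ - n ∧ 1 ≤ ⌊θ * (b : ℝ)⌋ - m ∧
              ∀ (a : ℕ) (p : ℝ × ℝ) (g : LorenzData), IsFullVertex α U F a b p g →
                ((a : ℤ) = ⌊θ * (b : ℝ)⌋ - n → 2 / 3 ≤ g.c ∧ g.c ≤ 7 / 8) ∧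
                ((a : ℤ) = ⌊θ * (b : ℝ)⌋ - m → g.c ≤ 1 / 3)) := by
  obtain ⟨ε, hε0, hε1, hεα, hεθ, hεs⟩ := exists_closeness hα
  refine ⟨ε, hε0, fun U F q hF hclose hq => ?_⟩
  obtain ⟨⟨hL1, hL2⟩, hR1, hR2⟩ := mult_mem_Icc hα hF hε1 hclose hq
  have hc := (hF.isLorenz q hq.1).c_mem
  have hα0 : 0 < α := by linarith
  have hc' : 0 < 1 - (F q).c := by linarith [hc.2]
  -- Since c < 1, α / c ≥ α, and (1 - ε) α > 1 makes the fixed point repelling.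
  have hlL : 1 < (F q).leftMult α := by
    refine hεα.trans_le (le_trans ?_ hL1)
    gcongr
    · linarith
    · rw [le_div_iff₀ hc.1]
      nlinarith [hc.2]
  have hlR : 1 < (F q).rightMult α := by
    refine hεα.trans_le (le_trans ?_ hR1)
    gcongr
    · linarith
    · rw [le_div_iff₀ hc']
      nlinarith [hc.1]
  have hΛL := Real.log_pos hlL
  have hΛR := Real.log_pos hlR
  have upper : ∀ d : ℝ, 2 / 3 ≤ d → (1 + ε) * (α / d) ≤ 3 / 2 * α * (1 + ε) := fun d hd => by
    have : α / d ≤ 3 / 2 * α := by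
      rw [div_le_iff₀ (by linarith)]
      nlinarith
    nlinarith
  have lower : ∀ d : ℝ, 0 < d → d ≤ 1 / 3 → 3 * α * (1 - ε) ≤ (1 - ε) * (α / d) := fun d h0 hd => by
    have : 3 * α ≤ α / d := by
      rw [le_div_iff₀ h0]
      nlinarith
    nlinarith
  refine ⟨fun hge => ?_, fun hle => ?_⟩
  · have hxle := hL2.trans (upper _ hge)
    have hley := (lower _ hc' (by linarith)).trans hR1
    obtain ⟨κ, hκ⟩ := exists_forall_abs_log_crit_sub_le hα hF hε1 hclose hq hlL hlR
      (div_pos hΛR hΛL)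
    obtain ⟨N, n, m, h⟩ := exists_floor_sub_of_abs_log_le
      (V := fun a b x => ∃ p g, IsFullVertex α U F a b p g ∧ x = g.c)
      (by rintro a b x ⟨p, g, hg, rfl⟩; exact hg.c_mem) hα0 hΛL hΛR
      (lt_of_le_of_lt (by gcongr) hεs) fun η hη => by
        obtain ⟨N, hN⟩ := hκ η hη
        exact ⟨N, by rintro a b x ⟨p, g, hg, rfl⟩; exact hN a b p g hg⟩
    exact ⟨_, thetaCrit_lt_div_log hα hε0 hε1 hlL hεθ hxle hley, one_lt_thetaCrit hα, N, n, m,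
      fun a ha => ⟨(h a ha).1, (h a ha).2.1, fun b p g hg => (h a ha).2.2 b g.c ⟨p, g, hg, rfl⟩⟩⟩
  · have hxle := hR2.trans (upper _ (by linarith))
    have hley := (lower _ hc.1 hle).trans hL1
    set θ := Real.log ((F q).leftMult α) / Real.log ((F q).rightMult α) with hθ
    have hθ0 : 0 < θ := div_pos hΛL hΛR
    obtain ⟨κ, hκ⟩ := exists_forall_abs_log_crit_sub_le hα hF hε1 hclose hq hlL hlR
      (inv_pos.2 hθ0)
    -- The free integer is now b, and passing to 1 - g.c changes the sign of the log-odds, hence of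
    -- the whole affine expression and of κ.
    obtain ⟨N, n, m, h⟩ := exists_floor_sub_of_abs_log_le (κ := -κ)
      (V := fun b a x => ∃ p g, IsFullVertex α U F a b p g ∧ x = 1 - g.c)
      (by
        rintro b a x ⟨p, g, hg, rfl⟩
        exact ⟨by linarith [hg.c_mem.2], by linarith [hg.c_mem.1]⟩) hα0 hΛR hΛL
      (lt_of_le_of_lt (by gcongr) hεs) fun η hη => by
        obtain ⟨N, hN⟩ := hκ η hη
        -- The threshold N concerns a; since a ≥ θb/2 it follows from this threshold on b.
        refine ⟨⌈(N : ℝ) / (θ / 2)⌉₊, ?_⟩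
        rintro b a x ⟨p, g, hg, rfl⟩ hb hba hab
        have h1 : (N : ℝ) ≤ a := by
          have := (div_le_iff₀ (by positivity)).1 (Nat.ceil_le.1 hb)
          linarith
        have h2 := hN a b p g hg (by exact_mod_cast h1)
          (by
            have : θ⁻¹ / 2 * (a : ℝ) = a / 2 / θ := by ring
            rw [this, div_le_iff₀ hθ0]
            linarith)
          (by
            have : 2 * θ⁻¹ * (a : ℝ) = 2 * a / θ := by ring
            rw [this, le_div_iff₀ hθ0]
            linarith)
        rw [← abs_neg] at h2
        convert h2 using 2
        rw [sub_sub_cancel]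
        ring
    exact ⟨θ, thetaCrit_lt_div_log hα hε0 hε1 hlR hεθ hxle hley, one_lt_thetaCrit hα, N, n, m,
      fun b hb => ⟨(h b hb).1, (h b hb).2.1, fun a p g hg => by
        obtain ⟨h1, h2⟩ := (h b hb).2.2 a (1 - g.c) ⟨p, g, hg, rfl⟩
        exact ⟨fun e => ⟨by linarith [(h1 e).2], by linarith [(h1 e).1]⟩,
          fun e => by linarith [h2 e]⟩⟩⟩
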